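/- Let $\alpha,\beta:\mathbb R\to[0,\infty)$ be measurable functions that vanish on $(-\infty,0]$, are not almost everywhere zero, and have finite bimoments $\iint_{\mathbb R_+^2}\frac{x^jy^k}{x+y}\,\alpha(x)\beta(y)\,dx\,dy<\infty$ for all $j,k\ge 0$. Put $\alpha^\star(x)=\alpha(-x)$, $\beta^\star(y)=\beta(-y)$, let $\operatorname{supp}$ denote the support of the corresponding measure, and let $\Omega=\mathbb C\setminus(\operatorname{supp}\alpha\cup\operatorname{supp}\beta^\star)$. The Cauchy biorthogonal polynomials are real polynomials $p_j,q_j$ $(j\ge 0)$ of exact degree $j$, with equal and positive leading coefficients, such that $\iint_{\mathbb R_+^2} p_j(x)q_k(y)\frac{\alpha(x)\beta(y)}{x+y}\,dx\,dy=\delta_{jk}$. Put $p_j^{(0)}=p_j$, $q_j^{(0)}=q_j$ and $$p_j^{(1)}(z)=\int_{\mathbb R_+}\frac{p_j(x)\alpha(x)}{z-x}dx,\quad p_j^{(2)}(z)=\int_{\mathbb R_+}\frac{p_j^{(1)}(-y)\beta(y)}{z+y}dy,\quad q_j^{(1)}(w)=\int_{\mathbb R_+}\frac{q_j(y)\beta(y)}{w-y}dy,\quad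 q_j^{(2)}(w)=\int_{\mathbb R_+}\frac{q_j^{(1)}(-x)\alpha(x)}{w+x}dx .$$ For a density $a$ let $W_a(z)=\int_{\mathbb R}\frac{a(x)}{z-x}dx$; further let $W_{\alpha^\star\beta}(w)=-\iint_{\mathbb R_+^2}\frac{\alpha(x)\beta(y)}{(w+x)(x+y)}dx\,dy$, $W_{\beta^\star\alpha}(z)=-\iint_{\mathbb R_+^2}\frac{\alpha(x)\beta(y)}{(z+y)(x+y)}dx\,dy$, and $$\mathbb F(w,z)=\begin{bmatrix}0&0&1\\0&1&W_{\beta^\star}(z)+W_\beta(w)\\1&W_\alpha(z)+W_{\alpha^\star}(w)&W_{\alpha^\star}(w)W_{\beta^\star}(z)+W_{\alpha^\star\beta}(w)+W_{\beta^\star\alpha}(z)\end{bmatrix},\qquad \mathbb J=\begin{bmatrix}0&0&1\\0&1&0\\1&0&0\end{bmatrix}.$$ For $n\ge 0$ define the $3\times3$ matrix kernel, with indices $\mu,\nu\in\{0,1,2\}$, by $$[\mathbb H_n(z,w)]_{\mu\nu}=\sum_{j=0}^{n-1}q_j^{(\mu)}(w)\,p_j^{(\nu)}(z)+\frac{\mathbb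 F_{\mu\nu}(w,z)}{z+w}.$$ Consider the Riemann–Hilbert problem of index $n$ for a $3\times 3$ matrix function $\widehat\Gamma$: (1) $\widehat\Gamma$ is analytic on $\Omega$; (2) on the real line $\widehat\Gamma_+=\widehat\Gamma_-V$ with $$V(x)=\begin{bmatrix}1&-2\pi i\,\alpha(x)&0\\0&1&-2\pi i\,\beta^\star(x)\\0&0&1\end{bmatrix},$$ in the sense that $\int_{\mathbb R}\varphi(x)\big(\widehat\Gamma(x+i\varepsilon)-\widehat\Gamma(x-i\varepsilon)V(x)\big)dx\to0$ as $\varepsilon\downarrow0$ for every continuous compactly supported $\varphi$; (3) $\widehat\Gamma(z)=(\mathbf 1+E(z))\operatorname{diag}(z^n,1,z^{-n})$ for $\operatorname{Im}z\ne0$ and $|z|$ large, where the entries of $E(z)$ are bounded by $\frac{C}{|z|}\big(1+\frac1{|\operatorname{Im}z|}\big)$ for some constant $C$. Then Cauchy biorthogonal polynomials exist, and for every $n\ge0$ the Riemann–Hilbert problem has a solution, unique on $\Omega$. If $p_j,q_j$ are the Cauchy biorthogonal polynomials and $\widehat\Gamma$ solves the Riemann–Hilbert problem of index $n$, then for all $z,w\in\mathbb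 C$ with $z\in\Omega$, $-w\in\Omega$ and $z+w\ne0$ the matrix $\widehat\Gamma(-w)$ is invertible and $$\mathbb H_n(z,w)=\frac{\mathbb J\,\widehat\Gamma(-w)^{-1}\,\widehat\Gamma(z)}{z+w}.$$ -/

import Mathlib

open MeasureTheory Set Filter Topology Polynomial

noncomputable section

namespace CauchyBOP

/-- `a` is a density on the positive half-line: measurable, nonnegative, vanishing outside
`(0,∞)` and not almost everywhere zero. -/
structure IsWeight (a : ℝ → ℝ) : Prop where
  measurable : Measurable a
  nonneg : ∀ x, 0 ≤ a x
  eq_zero : ∀ x, x ≤ 0 → a x = 0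
  ne_zero : ¬ a =ᵐ[volume] 0

/-- All bimoments `∬ x ^ j y ^ k α(x) β(y) / (x + y) dx dy` are finite. -/
def FiniteBimoments (α β : ℝ → ℝ) : Prop :=
  ∀ j k : ℕ, IntegrableOn
    (fun s : ℝ × ℝ => s.1 ^ j * s.2 ^ k / (s.1 + s.2) * (α s.1 * β s.2))
    (Ioi 0 ×ˢ Ioi 0)

/-- The Cauchy biorthogonal polynomials of `α(x)dx`, `β(y)dy`: exact degrees, equal and positive
leading coefficients, biorthonormal with respect to the Cauchy kernel. -/
structure IsCauchyBOP (α β : ℝ → ℝ) (p q : ℕ → ℝ[X]) : Prop where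
  natDegree_p : ∀ j, (p j).natDegree = j
  natDegree_q : ∀ j, (q j).natDegree = j
  leadingCoeff_eq : ∀ j, (p j).leadingCoeff = (q j).leadingCoeff
  leadingCoeff_pos : ∀ j, 0 < (p j).leadingCoeff
  biorthogonal : ∀ j k,
    (∫ x in Ioi (0 : ℝ), ∫ y in Ioi (0 : ℝ),
      (p j).eval x * (q k).eval y / (x + y) * (α x * β y)) = if j = k then 1 else 0

/-- `P⁽¹⁾(z) = ∫ P(x) a(x) / (z - x) dx`. -/
def trans₁ (a : ℝ → ℝ) (P : ℝ[X]) (z : ℂ) : ℂ :=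
  ∫ x in Ioi (0 : ℝ), ((P.eval x * a x : ℝ) : ℂ) / (z - x)

/-- `P⁽²⁾(z) = ∫ P⁽¹⁾(-y) b(y) / (z + y) dy`. -/
def trans₂ (a b : ℝ → ℝ) (P : ℝ[X]) (z : ℂ) : ℂ :=
  ∫ y in Ioi (0 : ℝ), trans₁ a P (-(y : ℂ)) * (b y : ℂ) / (z + y)

/-- `(P⁽⁰⁾(z), P⁽¹⁾(z), P⁽²⁾(z))`, with `P⁽⁰⁾ = P`. -/
def trans (a b : ℝ → ℝ) (P : ℝ[X]) (z : ℂ) : Fin 3 → ℂ :=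
  ![aeval z P, trans₁ a P z, trans₂ a b P z]

/-- The reflected density `a⋆(x) = a(-x)`. -/
def star (a : ℝ → ℝ) (x : ℝ) : ℝ := a (-x)

/-- The Weyl function `W_a(z) = ∫ a(x) / (z - x) dx`. -/
def weyl (a : ℝ → ℝ) (z : ℂ) : ℂ := ∫ x : ℝ, (a x : ℂ) / (z - x)

/-- The iterated Weyl function `W_{a⋆b}(z) = -∬ a(x) b(y) / ((z + x) (x + y)) dx dy`. -/
def weylStar (a b : ℝ → ℝ) (z : ℂ) : ℂ :=
  -∫ x in Ioi (0 : ℝ), ∫ y in Ioi (0 : ℝ), ((a x * b y : ℝ) : ℂ) / ((z + x) * (x + y))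

/-- The matrix `𝔽(w,z)`. -/
def matF (α β : ℝ → ℝ) (w z : ℂ) : Matrix (Fin 3) (Fin 3) ℂ :=
  !![0, 0, 1;
     0, 1, weyl (star β) z + weyl β w;
     1, weyl α z + weyl (star α) w,
       weyl (star α) w * weyl (star β) z + weylStar α β w + weylStar β α z]

/-- The matrix `𝕁`. -/
def matJ : Matrix (Fin 3) (Fin 3) ℂ := !![0, 0, 1; 0, 1, 0; 1, 0, 0]

/-- The matrix kernel `ℍ_n(z,w)`; the row index is `μ` and the column index is `ν`. -/
def matH (α β : ℝ → ℝ) (p q : ℕ → ℝ[X]) (n : ℕ) (z w : ℂ) : Matrix (Fin 3) (Fin 3) ℂ :=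
  Matrix.of fun μ ν =>
    (∑ j ∈ Finset.range n, trans β α (q j) w μ * trans α β (p j) z ν)
      + matF α β w z μ ν / (z + w)

/-- The support of the measure `a(x)dx`. -/
def supp (a : ℝ → ℝ) : Set ℝ :=
  (volume.withDensity fun x => ENNReal.ofReal (a x)).support

/-- The domain `ℂ ∖ (supp α ∪ supp β⋆)`. -/
def dom (α β : ℝ → ℝ) : Set ℂ :=
  ((fun x : ℝ => (x : ℂ)) '' (supp α ∪ supp (star β)))ᶜ

/-- The jump matrix on the real line. As `α` lives on the positive and `β⋆` on the negative
half-line, it has at most one nonzero off-diagonal entry at every point. -/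
def jump (α β : ℝ → ℝ) (x : ℝ) : Matrix (Fin 3) (Fin 3) ℂ :=
  !![1, -2 * Real.pi * Complex.I * α x, 0;
     0, 1, -2 * Real.pi * Complex.I * star β x;
     0, 0, 1]

/-- `G` solves the `3 × 3` Riemann–Hilbert problem of index `n`.

* The relation `G₊ = G₋ V` between the boundary values on the real line is understood in the sense
  of vague convergence: `G(x + iε) - G(x - iε) V(x)` tends to zero as `ε ↓ 0` against every
  continuous compactly supported function. The densities are merely measurable, so boundary values
  need not exist pointwise everywhere; the end points of the supports are included.
* `G(z) = (1 + O(1/z)) diag(z ^ n, 1, z ^ (-n))` as `z → ∞` off the real line: the constant in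
  `O(1/z)` is uniform for `|Im z| ≥ 1`, and may grow like `1 / |Im z|` towards the real line,
  which carries the (possibly unbounded) supports. -/
structure IsRHPSolution (α β : ℝ → ℝ) (n : ℕ) (G : ℂ → Matrix (Fin 3) (Fin 3) ℂ) : Prop where
  analytic : ∀ i j, AnalyticOnNhd ℂ (fun z => G z i j) (dom α β)
  jump_rel : ∀ φ : ℝ → ℝ, Continuous φ → HasCompactSupport φ → ∀ i j,
    Tendsto (fun ε : ℝ => ∫ x : ℝ, (φ x : ℂ) *
        (G (x + ε * Complex.I) - G (x - ε * Complex.I) * jump α β x) i j)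
      (𝓝[>] 0) (𝓝 0)
  asymptotic : ∃ (C R : ℝ) (E : ℂ → Matrix (Fin 3) (Fin 3) ℂ), 0 < R ∧
    ∀ z : ℂ, R ≤ ‖z‖ → z.im ≠ 0 →
      G z = (1 + E z) * Matrix.diagonal ![z ^ n, 1, (z ^ n)⁻¹] ∧
      ∀ i j, ‖E z i j‖ ≤ C / ‖z‖ * (1 + 1 / |z.im|)

end CauchyBOP

end

/-!
The first entry of a row of a solution has no jump, so by a Liouville argument it is a polynomial
`P` of degree at most `n`. The growth bound permits a simple singularity at the real axis, so the
divided differences of `f` are obtained by integrating `f(z) (z ^ 2 - L ^ 2) / ∏ (z - a)` along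
large squares, where the quadratic factor vanishes at the points where the contour meets the axis.
Writing `C` for the Cauchy transform, the other two entries are then forced to be `c + C[P α]` and
`d + C[(c + C[P α]) β⋆]`, and the decay `z ^ (-n)` of the third one says that moments vanish. In the
homogeneous problem `c = d = 0`, the degree of `P` is less than `n`, and these moments are, up to
sign, the pairings of `P` with `1, y, …, y ^ (n - 1)`, so uniqueness is nondegeneracy of the Cauchy
pairing on polynomials of degree less than `n`.

The nondegeneracy, and with it the biorthogonal polynomials, comes from zeros: the Stieltjes
transform `∫ P(x) α(x) / (x + y) dx` of a polynomial of degree `m` has at most `m` zeros `y > 0`,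
since otherwise a partial fraction expansion of `P(x) ^ 2 / ∏ (x + t)` over `m + 1` of them would
have both zero and positive integral. Multiplied by the monic polynomial vanishing at its sign
changes it keeps its sign, hence `P` does not pair to zero with every polynomial of degree `≤ m`.

For fixed `w` the rows of `(z + w) ℍ_n(z, w)`, as functions of `z`, again satisfy the jump relation,
and the reproducing property of the Christoffel–Darboux sum makes exactly the moments vanish that
the decay at infinity requires. By uniqueness the matrix is `V Γ(z)` with `V` constant. At `z = -w`
it equals `𝕁`, because `W_α W_{β⋆} = W_{α⋆β}(-·) + W_{β⋆α}`, and so `V = 𝕁 Γ(-w)⁻¹`. The same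
evaluation shows that the matrix of leading coefficients is invertible, which yields a solution.
-/

namespace CauchyBOP

open Complex (I)

/-- The integral of `f` along the positively oriented boundary of `[a, b] × [c, d]`. -/
noncomputable def rectIntegral (f : ℂ → ℂ) (a b c d : ℝ) : ℂ :=
  (∫ x in a..b, f (x + c * I)) - (∫ x in a..b, f (x + d * I))
    + I * (∫ y in c..d, f (b + y * I)) - I * (∫ y in c..d, f (a + y * I))

/-- The boundary of `[a, b] × [c, d]`. -/
def rectBoundary (a b c d : ℝ) : Set ℂ :=
  {z | z ∈ Icc a b ×ℂ Icc c d ∧ z ∉ Ioo a b ×ℂ Ioo c d}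

section Rectangle

variable {f g : ℂ → ℂ} {a b c d : ℝ}

theorem horizontal_mem_rectBoundary (hcd : c ≤ d) {x t : ℝ} (hx : x ∈ Icc a b)
    (ht : t = c ∨ t = d) : (x + t * I : ℂ) ∈ rectBoundary a b c d := by
  rcases ht with rfl | rfl <;>
    simpa [rectBoundary, Complex.mem_reProdIm, hcd] using hx

theorem vertical_mem_rectBoundary (hab : a ≤ b) {y t : ℝ} (hy : y ∈ Icc c d)
    (ht : t = a ∨ t = b) : (t + y * I : ℂ) ∈ rectBoundary a b c d := by
  rcases ht with rfl | rfl <;>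
    simpa [rectBoundary, Complex.mem_reProdIm, hab] using hy

theorem intervalIntegrable_horizontal (hab : a ≤ b) (hcd : c ≤ d)
    (hf : ContinuousOn f (rectBoundary a b c d)) {t : ℝ} (ht : t = c ∨ t = d) :
    IntervalIntegrable (fun x : ℝ => f (x + t * I)) volume a b :=
  (hf.comp (by fun_prop) fun _ hx =>
    horizontal_mem_rectBoundary hcd (uIcc_of_le hab ▸ hx) ht).intervalIntegrable

theorem intervalIntegrable_vertical (hab : a ≤ b) (hcd : c ≤ d)
    (hf : ContinuousOn f (rectBoundary a b c d)) {t : ℝ} (ht : t = a ∨ t = b) :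
    IntervalIntegrable (fun y : ℝ => f (t + y * I)) volume c d :=
  (hf.comp (by fun_prop) fun _ hy =>
    vertical_mem_rectBoundary hab (uIcc_of_le hcd ▸ hy) ht).intervalIntegrable

theorem rectIntegral_congr (hab : a ≤ b) (hcd : c ≤ d)
    (h : ∀ z ∈ rectBoundary a b c d, f z = g z) :
    rectIntegral f a b c d = rectIntegral g a b c d := by
  have hor : ∀ t, t = c ∨ t = d → ∫ x in a..b, f (x + t * I) = ∫ x in a..b, g (x + t * I) :=
    fun t ht => intervalIntegral.integral_congr fun x hx =>
      h _ (horizontal_mem_rectBoundary hcd (uIcc_of_le hab ▸ hx) ht)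
  have ver : ∀ t, t = a ∨ t = b → ∫ y in c..d, f (t + y * I) = ∫ y in c..d, g (t + y * I) :=
    fun t ht => intervalIntegral.integral_congr fun y hy =>
      h _ (vertical_mem_rectBoundary hab (uIcc_of_le hcd ▸ hy) ht)
  simp only [rectIntegral, hor c (.inl rfl), hor d (.inr rfl), ver a (.inl rfl), ver b (.inr rfl)]

theorem rectIntegral_add (hab : a ≤ b) (hcd : c ≤ d)
    (hf : ContinuousOn f (rectBoundary a b c d)) (hg : ContinuousOn g (rectBoundary a b c d)) :
    rectIntegral (fun z => f z + g z) a b c d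
      = rectIntegral f a b c d + rectIntegral g a b c d := by
  have hor : ∀ t, t = c ∨ t = d → ∫ x in a..b, (f (x + t * I) + g (x + t * I))
      = (∫ x in a..b, f (x + t * I)) + ∫ x in a..b, g (x + t * I) := fun t ht =>
    intervalIntegral.integral_add (intervalIntegrable_horizontal hab hcd hf ht)
      (intervalIntegrable_horizontal hab hcd hg ht)
  have ver : ∀ t, t = a ∨ t = b → ∫ y in c..d, (f (t + y * I) + g (t + y * I))
      = (∫ y in c..d, f (t + y * I)) + ∫ y in c..d, g (t + y * I) := fun t ht =>
    intervalIntegral.integral_add (intervalIntegrable_vertical hab hcd hf ht)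
      (intervalIntegrable_vertical hab hcd hg ht)
  simp only [rectIntegral, hor c (.inl rfl), hor d (.inr rfl), ver a (.inl rfl), ver b (.inr rfl)]
  ring

theorem rectIntegral_const_mul (f : ℂ → ℂ) (k : ℂ) (a b c d : ℝ) :
    rectIntegral (fun z => k * f z) a b c d = k * rectIntegral f a b c d := by
  simp only [rectIntegral, intervalIntegral.integral_const_mul]
  ring

theorem rectIntegral_eq_zero (hf : DifferentiableOn ℂ f (uIcc a b ×ℂ uIcc c d)) :
    rectIntegral f a b c d = 0 := by
  simpa [rectIntegral] using
    Complex.integral_boundary_rect_eq_zero_of_differentiableOn f ⟨a, c⟩ ⟨b, d⟩ hf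

theorem norm_integral_horizontal_le (hab : a ≤ b) (hcd : c ≤ d) {M t : ℝ} (ht : t = c ∨ t = d)
    (hM : ∀ z ∈ rectBoundary a b c d, z.im = t → ‖f z‖ ≤ M) :
    ‖∫ x in a..b, f (x + t * I)‖ ≤ M * (b - a) := by
  rw [← abs_of_nonneg (sub_nonneg.2 hab)]
  refine intervalIntegral.norm_integral_le_of_norm_le_const fun x hx => hM _ ?_ (by simp)
  exact horizontal_mem_rectBoundary hcd (Ioc_subset_Icc_self (uIoc_of_le hab ▸ hx)) ht

theorem norm_integral_vertical_le (hab : a ≤ b) (hcd : c ≤ d) {M t : ℝ} (ht : t = a ∨ t = b)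
    (hM : ∀ z ∈ rectBoundary a b c d, c < z.im → z.im < d → ‖f z‖ ≤ M) :
    ‖∫ y in c..d, f (t + y * I)‖ ≤ M * (d - c) := by
  rw [← abs_of_nonneg (sub_nonneg.2 hcd)]
  refine intervalIntegral.norm_integral_le_of_norm_le_const_ae ?_
  filter_upwards [volume.ae_ne d] with y hyd hy
  rw [uIoc_of_le hcd] at hy
  exact hM _ (vertical_mem_rectBoundary hab (Ioc_subset_Icc_self hy) ht) (by simpa using hy.1)
    (by simpa using lt_of_le_of_ne hy.2 hyd)

theorem norm_rectIntegral_sub_bottom_le (hab : a ≤ b) (hcd : c < d) {M : ℝ}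
    (hM : ∀ z ∈ rectBoundary a b c d, c < z.im → ‖f z‖ ≤ M) :
    ‖rectIntegral f a b c d - ∫ x in a..b, f (x + c * I)‖ ≤ M * (b - a) + 2 * (M * (d - c)) := by
  have top := norm_integral_horizontal_le hab hcd.le (.inr rfl)
    fun z hz h => hM z hz (h ▸ hcd)
  have ver : ∀ t, t = a ∨ t = b → ‖∫ y in c..d, f (t + y * I)‖ ≤ M * (d - c) := fun t ht =>
    norm_integral_vertical_le hab hcd.le ht fun z hz h _ => hM z hz h
  calc ‖rectIntegral f a b c d - ∫ x in a..b, f (x + c * I)‖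
      = ‖I * ((∫ y in c..d, f (b + y * I)) - ∫ y in c..d, f (a + y * I))
          - ∫ x in a..b, f (x + d * I)‖ := by
        rw [rectIntegral]; congr 1; ring
    _ ≤ M * (b - a) + 2 * (M * (d - c)) := by
        refine (norm_sub_le _ _).trans ?_
        rw [norm_mul, Complex.norm_I, one_mul]
        linarith [norm_sub_le (∫ y in c..d, f (b + y * I)) (∫ y in c..d, f (a + y * I)),
          ver a (.inl rfl), ver b (.inr rfl)]

theorem norm_rectIntegral_add_top_le (hab : a ≤ b) (hcd : c < d) {M : ℝ}
    (hM : ∀ z ∈ rectBoundary a b c d, z.im < d → ‖f z‖ ≤ M) :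
    ‖rectIntegral f a b c d + ∫ x in a..b, f (x + d * I)‖ ≤ M * (b - a) + 2 * (M * (d - c)) := by
  have bottom := norm_integral_horizontal_le hab hcd.le (.inl rfl)
    fun z hz h => hM z hz (h ▸ hcd)
  have ver : ∀ t, t = a ∨ t = b → ‖∫ y in c..d, f (t + y * I)‖ ≤ M * (d - c) := fun t ht =>
    norm_integral_vertical_le hab hcd.le ht fun z hz _ h => hM z hz h
  calc ‖rectIntegral f a b c d + ∫ x in a..b, f (x + d * I)‖
      = ‖I * ((∫ y in c..d, f (b + y * I)) - ∫ y in c..d, f (a + y * I))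
          + ∫ x in a..b, f (x + c * I)‖ := by
        rw [rectIntegral]; congr 1; ring
    _ ≤ M * (b - a) + 2 * (M * (d - c)) := by
        refine (norm_add_le _ _).trans ?_
        rw [norm_mul, Complex.norm_I, one_mul]
        linarith [norm_sub_le (∫ y in c..d, f (b + y * I)) (∫ y in c..d, f (a + y * I)),
          ver a (.inl rfl), ver b (.inr rfl)]

end Rectangle

section Residues

theorem log_I_mul {ζ : ℂ} (hζ : 0 < ζ.re) :
    Complex.log (I * ζ) = Complex.log ζ + Real.pi / 2 * I := by
  have hne : ζ ≠ 0 := fun h => by simp [h] at hζ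
  have harg := abs_lt.1 (Complex.abs_arg_lt_pi_div_two_iff.2 (Or.inl hζ))
  rw [(Complex.log_mul_eq_add_log_iff Complex.I_ne_zero hne).2, Complex.log_I]
  · ring
  · rw [Complex.arg_I]
    constructor <;> linarith [Real.pi_pos, harg.1, harg.2]

theorem mul_integral_inv_eq_log_sub_log {γ : ℝ → ℂ} {u v : ℂ} {a b : ℝ}
    (hγ : ∀ t, HasDerivAt γ v t) (hu : ∀ t ∈ uIcc a b, 0 < (u * γ t).re) :
    v * ∫ t in a..b, (γ t)⁻¹ = Complex.log (u * γ b) - Complex.log (u * γ a) := by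
  have hu0 : u ≠ 0 := by rintro rfl; simpa using hu a left_mem_uIcc
  rw [← intervalIntegral.integral_const_mul]
  apply intervalIntegral.integral_eq_sub_of_hasDerivAt (f := fun t => Complex.log (u * γ t))
  · intro t ht
    have hlog := ((hγ t).const_mul u).clog_real (Or.inl (hu t ht))
    rwa [mul_div_mul_left _ _ hu0, div_eq_mul_inv] at hlog
  · have hcont : Continuous γ := continuous_iff_continuousAt.2 fun t => (hγ t).continuousAt
    refine (continuousOn_const.mul (hcont.continuousOn.inv₀ fun t ht h0 => ?_)).intervalIntegrable
    simpa [h0] using hu t ht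

/-- The four branches `log (u * (z - z₀))` with `u = I, 1, -I, -1` are primitives of `(z - z₀)⁻¹`
near the four sides, and consecutive ones differ by `π / 2 * I` at the common corner. -/
theorem rectIntegral_inv_sub {a b c d : ℝ} {z₀ : ℂ} (hz : z₀ ∈ Ioo a b ×ℂ Ioo c d) :
    rectIntegral (fun z => (z - z₀)⁻¹) a b c d = 2 * Real.pi * I := by
  obtain ⟨⟨ha, hb⟩, hc, hd⟩ := hz
  have hor : ∀ s t : ℝ, HasDerivAt (fun x : ℝ => (x : ℂ) + s * I - z₀) 1 t := fun s t =>
    ((Complex.ofRealCLM.hasDerivAt (x := t)).add_const _).sub_const _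
  have ver : ∀ s t : ℝ, HasDerivAt (fun y : ℝ => (s : ℂ) + y * I - z₀) I t := fun s t => by
    simpa using
      (((Complex.ofRealCLM.hasDerivAt (x := t)).mul_const I).const_add (s : ℂ)).sub_const z₀
  have bottom := mul_integral_inv_eq_log_sub_log (u := I) (a := a) (b := b) (hor c)
    (fun t _ => by simpa using hc)
  have top := mul_integral_inv_eq_log_sub_log (u := -I) (a := a) (b := b) (hor d)
    (fun t _ => by simpa using hd)
  have right := mul_integral_inv_eq_log_sub_log (u := 1) (a := c) (b := d) (ver b)
    (fun t _ => by simpa using hb)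
  have left := mul_integral_inv_eq_log_sub_log (u := -1) (a := c) (b := d) (ver a)
    (fun t _ => by simpa using ha)
  have corner_bc := log_I_mul (ζ := b + c * I - z₀) (by simpa using hb)
  have corner_bd := log_I_mul (ζ := -I * (b + d * I - z₀)) (by simpa using hd)
  have corner_ad := log_I_mul (ζ := -1 * (a + d * I - z₀)) (by simpa using ha)
  have corner_ac := log_I_mul (ζ := I * (a + c * I - z₀)) (by simpa using hc)
  rw [← mul_assoc] at corner_bd corner_ad corner_ac
  rw [one_mul] at bottom top
  rw [show I * -I = 1 by simp] at corner_bd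
  rw [mul_neg_one] at corner_ad
  rw [Complex.I_mul_I] at corner_ac
  rw [rectIntegral, bottom, top, right, left, corner_bc, corner_bd, corner_ad, corner_ac, one_mul]
  ring

variable {f : ℂ → ℂ} {a b c d : ℝ} {U : Set ℂ}

theorem sub_ne_zero_of_notMem_rectBoundary {ζ : ℂ} (hζ : ζ ∉ rectBoundary a b c d) :
    ∀ z ∈ rectBoundary a b c d, z - ζ ≠ 0 :=
  fun _ hz h => hζ (sub_eq_zero.1 h ▸ hz)

theorem rectIntegral_mul_inv_sub_of_mem (hab : a ≤ b) (hcd : c ≤ d) (hU : IsOpen U)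
    (hf : DifferentiableOn ℂ f U) (hsub : Icc a b ×ℂ Icc c d ⊆ U) {ζ : ℂ}
    (hζ : ζ ∈ Ioo a b ×ℂ Ioo c d) :
    rectIntegral (fun z => f z * (z - ζ)⁻¹) a b c d = 2 * Real.pi * I * f ζ := by
  have hζU : ζ ∈ U := hsub ⟨Ioo_subset_Icc_self hζ.1, Ioo_subset_Icc_self hζ.2⟩
  have hne := sub_ne_zero_of_notMem_rectBoundary (fun h => h.2 hζ)
  have hslope : DifferentiableOn ℂ (dslope f ζ) U :=
    (Complex.differentiableOn_dslope (hU.mem_nhds hζU)).2 hf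
  have hsplit : ∀ z ∈ rectBoundary a b c d,
      f z * (z - ζ)⁻¹ = dslope f ζ z + f ζ * (z - ζ)⁻¹ := fun z hz => by
    have := hne z hz
    rw [dslope_of_ne _ (sub_ne_zero.1 this), slope_def_field]
    field_simp
    ring
  have hdslope : rectIntegral (dslope f ζ) a b c d = 0 :=
    rectIntegral_eq_zero (by rw [uIcc_of_le hab, uIcc_of_le hcd]; exact hslope.mono hsub)
  rw [rectIntegral_congr hab hcd hsplit,
    rectIntegral_add (g := fun z => f ζ * (z - ζ)⁻¹) hab hcd
      (hslope.continuousOn.mono fun z h => hsub h.1)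
      (continuousOn_const.mul ((continuousOn_id.sub continuousOn_const).inv₀ hne)),
    hdslope, rectIntegral_const_mul, rectIntegral_inv_sub hζ]
  ring

theorem rectIntegral_mul_inv_sub_of_notMem (hab : a ≤ b) (hcd : c ≤ d)
    (hf : DifferentiableOn ℂ f (Icc a b ×ℂ Icc c d)) {ζ : ℂ} (hζ : ζ ∉ Icc a b ×ℂ Icc c d) :
    rectIntegral (fun z => f z * (z - ζ)⁻¹) a b c d = 0 := by
  apply rectIntegral_eq_zero
  rw [uIcc_of_le hab, uIcc_of_le hcd]
  exact hf.mul ((differentiableOn_id.sub_const _).inv fun z hz h0 =>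
    hζ ((sub_eq_zero.1 h0 : z = ζ) ▸ hz))

open Classical in
theorem rectIntegral_mul_sum_inv_sub (hab : a ≤ b) (hcd : c ≤ d) (hU : IsOpen U)
    (hf : DifferentiableOn ℂ f U) (hsub : Icc a b ×ℂ Icc c d ⊆ U) (s : Finset ℂ) (r : ℂ → ℂ)
    (hs : ∀ ζ ∈ s, ζ ∉ rectBoundary a b c d) :
    rectIntegral (fun z => f z * ∑ ζ ∈ s, r ζ * (z - ζ)⁻¹) a b c d
      = 2 * Real.pi * I * ∑ ζ ∈ s with ζ ∈ Ioo a b ×ℂ Ioo c d, r ζ * f ζ := by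
  have hcont : ∀ ζ ∈ s, ContinuousOn (fun z => r ζ * (f z * (z - ζ)⁻¹)) (rectBoundary a b c d) :=
    fun ζ hζ => continuousOn_const.mul ((hf.continuousOn.mono fun z h => hsub h.1).mul
      ((continuousOn_id.sub continuousOn_const).inv₀
        (sub_ne_zero_of_notMem_rectBoundary (hs ζ hζ))))
  have hswap : rectIntegral (fun z => ∑ ζ ∈ s, r ζ * (f z * (z - ζ)⁻¹)) a b c d
      = ∑ ζ ∈ s, r ζ * rectIntegral (fun z => f z * (z - ζ)⁻¹) a b c d := by
    clear hs
    induction s using Finset.induction_on with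
    | empty => simp [rectIntegral]
    | insert ζ s hζ ih =>
      have hrest := fun ξ hξ => hcont ξ (Finset.mem_insert_of_mem hξ)
      simp only [Finset.sum_insert hζ]
      rw [rectIntegral_add hab hcd (hcont ζ (Finset.mem_insert_self _ _))
        (continuousOn_finsetSum _ hrest), ih hrest, rectIntegral_const_mul]
  simp only [Finset.mul_sum, mul_left_comm _ (r _)] at hswap ⊢
  rw [hswap, Finset.sum_filter]
  refine Finset.sum_congr rfl fun ζ hζ => ?_
  split_ifs with hin
  · rw [rectIntegral_mul_inv_sub_of_mem hab hcd hU hf hsub hin]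
  · rw [rectIntegral_mul_inv_sub_of_notMem hab hcd (hf.mono hsub) fun h => hs ζ hζ ⟨h, hin⟩,
      mul_zero]

end Residues

section OffReal

theorem isOpen_im_ne_zero : IsOpen {z : ℂ | z.im ≠ 0} :=
  isOpen_ne_fun Complex.continuous_im continuous_const

/-- Approach to infinity off the real line. -/
noncomputable def offReal : Filter ℂ := Bornology.cobounded ℂ ⊓ 𝓟 {z | z.im ≠ 0}

/-- The comparison function for growth of order `k` at infinity that tolerates a simple singularity
towards the real line; asymptotics off the real line are stated as `f =O[offReal] growth k`. -/
noncomputable def growth (k : ℤ) (z : ℂ) : ℝ := ‖z‖ ^ k * (1 + 1 / |z.im|)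

theorem eventually_offReal_iff {p : ℂ → Prop} :
    (∀ᶠ z in offReal, p z) ↔ ∃ R, ∀ z : ℂ, R ≤ ‖z‖ → z.im ≠ 0 → p z := by
  rw [offReal, eventually_inf_principal, ← comap_norm_atTop, eventually_comap, eventually_atTop]
  exact ⟨fun ⟨R, h⟩ => ⟨R, fun z hz => h _ hz z rfl⟩,
    fun ⟨R, h⟩ => ⟨R, fun _ hr z hz => h z (hz ▸ hr)⟩⟩

theorem eventually_offReal_norm_ge (R : ℝ) : ∀ᶠ z in offReal, R ≤ ‖z‖ :=
  eventually_offReal_iff.2 ⟨R, fun _ h _ => h⟩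

theorem eventually_offReal_im_ne_zero : ∀ᶠ z in offReal, z.im ≠ 0 :=
  eventually_offReal_iff.2 ⟨0, fun _ _ h => h⟩

theorem growth_nonneg (k : ℤ) (z : ℂ) : 0 ≤ growth k z := by
  unfold growth; positivity

theorem isBigO_growth_iff {E : Type*} [Norm E] {f : ℂ → E} {k : ℤ} :
    f =O[offReal] growth k ↔ ∃ C R : ℝ, 0 ≤ C ∧
      ∀ z : ℂ, R ≤ ‖z‖ → z.im ≠ 0 → ‖f z‖ ≤ C * growth k z := by
  constructor
  · intro h
    obtain ⟨C, hC, hle⟩ := h.exists_nonneg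
    obtain ⟨R, hR⟩ := eventually_offReal_iff.1 hle.bound
    refine ⟨C, R, hC, fun z hz him => ?_⟩
    simpa only [Real.norm_of_nonneg (growth_nonneg k z)] using hR z hz him
  · rintro ⟨C, R, -, h⟩
    refine Asymptotics.IsBigO.of_bound C (eventually_offReal_iff.2 ⟨R, fun z hz him => ?_⟩)
    simpa only [Real.norm_of_nonneg (growth_nonneg k z)] using h z hz him

end OffReal

section VagueNull

/-- `u ε` tends to zero in the vague topology as `ε ↓ 0`. Local integrability is part of the notion
because the Bochner integral of a non-integrable function is `0`. -/
structure VagueNull (u : ℝ → ℝ → ℂ) : Prop where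
  locallyIntegrable : ∀ ε > 0, LocallyIntegrable (u ε)
  tendsto : ∀ φ : ℝ → ℝ, Continuous φ → HasCompactSupport φ →
    Tendsto (fun ε => ∫ x, (φ x : ℂ) * u ε x) (𝓝[>] 0) (𝓝 0)

theorem integrable_mul_of_hasCompactSupport {φ : ℝ → ℂ} {h : ℝ → ℂ} (hφ : Continuous φ)
    (hc : HasCompactSupport φ) (hh : LocallyIntegrable h) : Integrable fun x => φ x * h x := by
  simpa only [smul_eq_mul] using hh.integrable_smul_left_of_hasCompactSupport hφ hc

theorem integrable_ofReal_mul_of_hasCompactSupport {φ : ℝ → ℝ} {h : ℝ → ℂ} (hφ : Continuous φ)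
    (hc : HasCompactSupport φ) (hh : LocallyIntegrable h) :
    Integrable fun x => (φ x : ℂ) * h x :=
  integrable_mul_of_hasCompactSupport (Complex.continuous_ofReal.comp hφ)
    (hc.comp_left Complex.ofReal_zero) hh

namespace VagueNull

variable {u v : ℝ → ℝ → ℂ}

theorem congr (hu : VagueNull u) (h : ∀ ε > 0, ∀ x, u ε x = v ε x) : VagueNull v where
  locallyIntegrable ε hε := funext (h ε hε) ▸ hu.locallyIntegrable ε hε
  tendsto φ hφ hc := (hu.tendsto φ hφ hc).congr' <| by
    filter_upwards [self_mem_nhdsWithin] with ε hε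
    simp only [h ε hε]

theorem add (hu : VagueNull u) (hv : VagueNull v) : VagueNull fun ε x => u ε x + v ε x where
  locallyIntegrable ε hε := (hu.locallyIntegrable ε hε).add (hv.locallyIntegrable ε hε)
  tendsto φ hφ hc := by
    have hsum := (hu.tendsto φ hφ hc).add (hv.tendsto φ hφ hc)
    rw [add_zero] at hsum
    refine hsum.congr' ?_
    filter_upwards [self_mem_nhdsWithin] with ε hε
    rw [← integral_add
      (integrable_ofReal_mul_of_hasCompactSupport hφ hc (hu.locallyIntegrable ε hε))
      (integrable_ofReal_mul_of_hasCompactSupport hφ hc (hv.locallyIntegrable ε hε))]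
    simp only [mul_add]

theorem const_mul (hu : VagueNull u) (k : ℂ) : VagueNull fun ε x => k * u ε x where
  locallyIntegrable ε hε := (hu.locallyIntegrable ε hε).smul k
  tendsto φ hφ hc := by
    simpa only [← integral_const_mul, mul_left_comm k, mul_zero]
      using (hu.tendsto φ hφ hc).const_mul k

theorem tendsto_complex (hu : VagueNull u) {φ : ℝ → ℂ} (hφ : Continuous φ)
    (hc : HasCompactSupport φ) : Tendsto (fun ε => ∫ x, φ x * u ε x) (𝓝[>] 0) (𝓝 0) := by
  have hre := Complex.continuous_re.comp hφ
  have him := Complex.continuous_im.comp hφ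
  have hcre : HasCompactSupport (Complex.re ∘ φ) := hc.comp_left Complex.zero_re
  have hcim : HasCompactSupport (Complex.im ∘ φ) := hc.comp_left Complex.zero_im
  have hsum := (hu.tendsto _ hre hcre).add ((hu.tendsto _ him hcim).const_mul I)
  rw [mul_zero, add_zero] at hsum
  refine hsum.congr' ?_
  filter_upwards [self_mem_nhdsWithin] with ε hε
  have hε := hu.locallyIntegrable ε hε
  rw [← integral_const_mul, ← integral_add
    (integrable_ofReal_mul_of_hasCompactSupport hre hcre hε)
    ((integrable_ofReal_mul_of_hasCompactSupport him hcim hε).const_mul I)]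
  refine integral_congr_ae (.of_forall fun x => ?_)
  simp only [Function.comp_apply]
  linear_combination u ε x * Complex.re_add_im (φ x)

theorem tendsto_intervalIntegral (hu : VagueNull u) {a b : ℝ} (hab : a ≤ b) {k : ℝ → ℂ}
    (hk : ContinuousOn k (Icc a b)) (ha : k a = 0) (hb : k b = 0) :
    Tendsto (fun ε => ∫ x in a..b, k x * u ε x) (𝓝[>] 0) (𝓝 0) := by
  set φ : ℝ → ℂ := IccExtend hab ((Icc a b).domRestrict k) with hφ
  have hφ_eq : ∀ x ∈ Icc a b, φ x = k x := fun x hx => IccExtend_of_mem hab _ hx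
  have hφ_zero : ∀ x, x ∉ Ioc a b → φ x = 0 := fun x hx => by
    rcases le_or_gt x a with h | h
    · rw [hφ, IccExtend_of_le_left hab _ h]; exact ha
    · rw [hφ, IccExtend_of_right_le hab _ (not_le.1 fun h' => hx ⟨h, h'⟩).le]; exact hb
  have hcont : Continuous φ := (continuousOn_iff_continuous_domRestrict.1 hk).Icc_extend'
  have hsupp : HasCompactSupport φ := HasCompactSupport.intro isCompact_Icc fun x hx =>
    hφ_zero x fun h => hx (Ioc_subset_Icc_self h)
  refine (hu.tendsto_complex hcont hsupp).congr fun ε => ?_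
  rw [← intervalIntegral.integral_eq_integral_of_support_subset fun x hx =>
    by_contra fun h => hx (by simp only [hφ_zero x h, zero_mul])]
  refine intervalIntegral.integral_congr fun x hx => ?_
  simp only [hφ_eq x (uIcc_of_le hab ▸ hx)]

end VagueNull

/-- The difference of the boundary values of `f` on the real line vanishes in the vague sense. -/
def NoJump (f : ℂ → ℂ) : Prop := VagueNull fun ε x => f (x + ε * I) - f (x - ε * I)

theorem continuous_horizontal {f : ℂ → ℂ} (hf : ContinuousOn f {z | z.im ≠ 0}) {ε : ℝ}
    (hε : ε ≠ 0) : Continuous fun x : ℝ => f (x + ε * I) :=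
  hf.comp_continuous (by fun_prop) fun x => by simpa using hε

theorem continuous_horizontal_sub {f : ℂ → ℂ} (hf : ContinuousOn f {z | z.im ≠ 0}) {ε : ℝ}
    (hε : ε ≠ 0) : Continuous fun x : ℝ => f (x - ε * I) :=
  hf.comp_continuous (by fun_prop) fun x => by simpa using hε

end VagueNull

section ResidueEstimate

variable {f g : ℂ → ℂ} {L M ε : ℝ} {s : Finset ℂ} {r : ℂ → ℂ}

theorem norm_upper_residues_sub_integral_le (hf : DifferentiableOn ℂ f {z | z.im ≠ 0})
    (hg : Differentiable ℂ g) (hL : 0 < L) (hε : 0 < ε)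
    (hs : ∀ ζ ∈ s, ζ.im ≠ 0 ∧ ζ ∈ Ioo (-L) L ×ℂ Ioo (-L) L)
    (hM : ∀ z ∈ rectBoundary (-L) L (-L) L, 0 < z.im →
      ‖f (z + ε * I) * g z * ∑ ζ ∈ s, r ζ * (z - ζ)⁻¹‖ ≤ M) :
    ‖2 * Real.pi * I * (∑ ζ ∈ s with 0 < ζ.im, r ζ * (f (ζ + ε * I) * g ζ))
      - ∫ x in (-L)..L, f (x + ε * I) * g x * ∑ ζ ∈ s, r ζ * (x - ζ)⁻¹‖ ≤ 4 * L * M := by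
  classical
  have hmem : ∀ ζ ∈ s, ζ ∈ Ioo (-L) L ×ℂ Ioo 0 L ↔ 0 < ζ.im := fun ζ hζ =>
    ⟨fun h => h.2.1, fun h => ⟨(hs ζ hζ).2.1, h, (hs ζ hζ).2.2.2⟩⟩
  have hoff : ∀ ζ ∈ s, ζ ∉ rectBoundary (-L) L 0 L := fun ζ hζ h =>
    h.2 ((hmem ζ hζ).2 (lt_of_le_of_ne h.1.2.1 (hs ζ hζ).1.symm))
  have hshift : DifferentiableOn ℂ (fun z => f (z + ε * I) * g z) {z | -ε < z.im} :=
    .mul (hf.comp (by fun_prop) fun z (hz : -ε < z.im) => by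
      simpa using ne_of_gt (by linarith : 0 < z.im + ε)) hg.differentiableOn
  have hres := rectIntegral_mul_sum_inv_sub (by linarith : -L ≤ L) hL.le
    (isOpen_lt continuous_const Complex.continuous_im) hshift
    (fun z hz => show -ε < z.im from (neg_lt_zero.2 hε).trans_le hz.2.1) s r hoff
  rw [Finset.filter_congr hmem] at hres
  have hest := norm_rectIntegral_sub_bottom_le (a := -L) (b := L) (by linarith) hL
    (f := fun z => f (z + ε * I) * g z * ∑ ζ ∈ s, r ζ * (z - ζ)⁻¹) (M := M)
    fun z hz him => hM z ⟨⟨hz.1.1, by linarith, hz.1.2.2⟩, fun h => hz.2 ⟨h.1, him, h.2.2⟩⟩ him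
  rw [hres] at hest
  simp only [Complex.ofReal_zero, zero_mul, add_zero] at hest
  linarith

theorem norm_lower_residues_add_integral_le (hf : DifferentiableOn ℂ f {z | z.im ≠ 0})
    (hg : Differentiable ℂ g) (hL : 0 < L) (hε : 0 < ε)
    (hs : ∀ ζ ∈ s, ζ.im ≠ 0 ∧ ζ ∈ Ioo (-L) L ×ℂ Ioo (-L) L)
    (hM : ∀ z ∈ rectBoundary (-L) L (-L) L, z.im < 0 →
      ‖f (z - ε * I) * g z * ∑ ζ ∈ s, r ζ * (z - ζ)⁻¹‖ ≤ M) :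
    ‖2 * Real.pi * I * (∑ ζ ∈ s with ¬ 0 < ζ.im, r ζ * (f (ζ - ε * I) * g ζ))
      + ∫ x in (-L)..L, f (x - ε * I) * g x * ∑ ζ ∈ s, r ζ * (x - ζ)⁻¹‖ ≤ 4 * L * M := by
  classical
  have hmem : ∀ ζ ∈ s, ζ ∈ Ioo (-L) L ×ℂ Ioo (-L) 0 ↔ ¬ 0 < ζ.im := fun ζ hζ =>
    ⟨fun h => h.2.2.le.not_gt,
      fun h => ⟨(hs ζ hζ).2.1, (hs ζ hζ).2.2.1, lt_of_le_of_ne (not_lt.1 h) (hs ζ hζ).1⟩⟩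
  have hoff : ∀ ζ ∈ s, ζ ∉ rectBoundary (-L) L (-L) 0 := fun ζ hζ h =>
    h.2 ((hmem ζ hζ).2 (not_lt.2 h.1.2.2))
  have hshift : DifferentiableOn ℂ (fun z => f (z - ε * I) * g z) {z | z.im < ε} :=
    .mul (hf.comp (by fun_prop) fun z (hz : z.im < ε) => by
      simpa using ne_of_lt (by linarith : z.im - ε < 0)) hg.differentiableOn
  have hres := rectIntegral_mul_sum_inv_sub (by linarith : -L ≤ L) (by linarith : -L ≤ 0)
    (isOpen_lt Complex.continuous_im continuous_const) hshift
    (fun z hz => show z.im < ε from lt_of_le_of_lt hz.2.2 hε) s r hoff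
  rw [Finset.filter_congr hmem] at hres
  have hest := norm_rectIntegral_add_top_le (a := -L) (b := L) (c := -L) (d := 0) (by linarith)
    (by linarith) (f := fun z => f (z - ε * I) * g z * ∑ ζ ∈ s, r ζ * (z - ζ)⁻¹) (M := M)
    fun z hz him => hM z ⟨⟨hz.1.1, hz.1.2.1, by linarith⟩, fun h => hz.2 ⟨h.1, h.2.1, him⟩⟩ him
  rw [hres] at hest
  simp only [Complex.ofReal_zero, zero_mul, add_zero] at hest
  linarith

theorem tendsto_sum_residues (hf : DifferentiableOn ℂ f {z | z.im ≠ 0})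
    (hs : ∀ ζ ∈ s, ζ.im ≠ 0) (τ : ℂ) :
    Tendsto (fun ε : ℝ => ∑ ζ ∈ s, r ζ * (f (ζ + ε * τ) * g ζ)) (𝓝[>] 0)
      (𝓝 (∑ ζ ∈ s, r ζ * (f ζ * g ζ))) := by
  refine tendsto_finsetSum _ fun ζ hζ => (Tendsto.mul_const _ ?_).const_mul _
  have hcont : ContinuousAt f ζ :=
    (hf.differentiableAt (isOpen_im_ne_zero.mem_nhds (hs ζ hζ))).continuousAt
  have hshift : Tendsto (fun ε : ℝ => ζ + ε * τ) (𝓝 0) (𝓝 ζ) := by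
    have : Continuous fun ε : ℝ => ζ + ε * τ := by fun_prop
    simpa using this.tendsto 0
  exact hcont.tendsto.comp (hshift.mono_left nhdsWithin_le_nhds)

/-- The real segment contributes nothing in the limit because `f` has no jump there. -/
theorem NoJump.norm_sum_residues_le (hj : NoJump f) (hf : DifferentiableOn ℂ f {z | z.im ≠ 0})
    (hg : Differentiable ℂ g) (hL : 0 < L) (hgL : g L = 0) (hgL' : g (-L) = 0)
    (hs : ∀ ζ ∈ s, ζ.im ≠ 0 ∧ ζ ∈ Ioo (-L) L ×ℂ Ioo (-L) L)
    (hup : ∀ ε ∈ Ioo (0 : ℝ) 1, ∀ z ∈ rectBoundary (-L) L (-L) L, 0 < z.im →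
      ‖f (z + ε * I) * g z * ∑ ζ ∈ s, r ζ * (z - ζ)⁻¹‖ ≤ M)
    (hlow : ∀ ε ∈ Ioo (0 : ℝ) 1, ∀ z ∈ rectBoundary (-L) L (-L) L, z.im < 0 →
      ‖f (z - ε * I) * g z * ∑ ζ ∈ s, r ζ * (z - ζ)⁻¹‖ ≤ M) :
    ‖2 * Real.pi * I * ∑ ζ ∈ s, r ζ * (f ζ * g ζ)‖ ≤ 8 * L * M := by
  set S : ℂ → ℂ := fun z => ∑ ζ ∈ s, r ζ * (z - ζ)⁻¹
  have hScont : Continuous fun x : ℝ => g x * S x :=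
    (hg.continuous.comp Complex.continuous_ofReal).mul <|
      continuous_finsetSum _ fun ζ hζ => continuous_const.mul <| Continuous.inv₀ (by fun_prop)
        fun x h0 => (hs ζ hζ).1 (by rw [← sub_eq_zero.1 h0, Complex.ofReal_im])
  have hsegment := hj.tendsto_intervalIntegral (by linarith : -L ≤ L) hScont.continuousOn
    (by simp [hgL']) (by simp [hgL])
  have him : ∀ {p : ℂ → Prop} [DecidablePred p], ∀ ζ ∈ s.filter p, ζ.im ≠ 0 := fun ζ hζ =>
    (hs ζ (Finset.mem_of_mem_filter ζ hζ)).1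
  have hupper := tendsto_sum_residues (r := r) (g := g) hf (him (p := fun ζ => 0 < ζ.im)) I
  have hlower := tendsto_sum_residues (r := r) (g := g) hf (him (p := fun ζ => ¬ 0 < ζ.im)) (-I)
  have hlim := (((hupper.add hlower).const_mul (2 * Real.pi * I)).sub hsegment).norm
  rw [sub_zero, Finset.sum_filter_add_sum_filter_not] at hlim
  refine le_of_tendsto hlim ?_
  filter_upwards [Ioo_mem_nhdsGT (zero_lt_one (α := ℝ))] with ε hε
  have hjump : ∫ x in (-L)..L, g x * S x * (f (x + ε * I) - f (x - ε * I))
      = (∫ x in (-L)..L, f (x + ε * I) * g x * S x)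
        - ∫ x in (-L)..L, f (x - ε * I) * g x * S x := by
    have hint : ∀ h : ℝ → ℂ, Continuous h →
        IntervalIntegrable (fun x => h x * (g x * S x)) volume (-L) L := fun h hh =>
      (hh.mul hScont).intervalIntegrable _ _
    simp only [mul_assoc (f _)]
    rw [← intervalIntegral.integral_sub
      (hint _ (continuous_horizontal hf.continuousOn hε.1.ne'))
      (hint _ (continuous_horizontal_sub hf.continuousOn hε.1.ne'))]
    exact intervalIntegral.integral_congr fun x _ => by ring
  have hsplit := norm_add_le_of_le
    (norm_upper_residues_sub_integral_le hf hg hL hε.1 hs (hup ε hε))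
    (norm_lower_residues_add_integral_le hf hg hL hε.1 hs (hlow ε hε))
  simp only [hjump, mul_neg, ← sub_eq_add_neg]
  refine le_of_eq_of_le (congrArg norm ?_) (hsplit.trans_eq (by ring))
  ring

end ResidueEstimate

section Liouville

theorem sum_nodalWeight_mul_inv_sub {s : Finset ℂ} (hs : s.Nonempty) {z : ℂ}
    (hz : ∀ a ∈ s, z ≠ a) :
    ∑ a ∈ s, Lagrange.nodalWeight s id a * (z - a)⁻¹ = (∏ a ∈ s, (z - a))⁻¹ := by
  have hone := Lagrange.eval_interpolate_not_at_node (s := s) (v := id) (x := z) 1 hz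
  rw [Lagrange.interpolate_one (injOn_id _) hs, eval_one, Lagrange.eval_nodal] at hone
  simp only [Pi.one_apply, mul_one, id] at hone
  exact eq_inv_of_mul_eq_one_right hone.symm

variable {L : ℝ} {z : ℂ}

theorem rectBoundary_square_cases (hz : z ∈ rectBoundary (-L) L (-L) L) :
    |z.re| ≤ L ∧ |z.im| ≤ L ∧ (|z.re| = L ∨ |z.im| = L) := by
  have hre : |z.re| ≤ L := abs_le.2 hz.1.1
  have him : |z.im| ≤ L := abs_le.2 hz.1.2
  refine ⟨hre, him, ?_⟩
  by_contra! h
  exact hz.2 ⟨abs_lt.1 (hre.lt_of_ne h.1), abs_lt.1 (him.lt_of_ne h.2)⟩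

theorem le_norm_of_mem_rectBoundary_square (hz : z ∈ rectBoundary (-L) L (-L) L) :
    L ≤ ‖z‖ := by
  obtain ⟨-, -, h | h⟩ := rectBoundary_square_cases hz
  exacts [h ▸ Complex.abs_re_le_norm z, h ▸ Complex.abs_im_le_norm z]

/-- The factor `z ^ 2 - L ^ 2` vanishes where the square meets the real line and thus absorbs the
singularity `1 / |Im z|` of the growth bound. -/
theorem norm_sq_sub_sq_le (hL : 0 < L) (hz : z ∈ rectBoundary (-L) L (-L) L) :
    ‖z ^ 2 - (L : ℂ) ^ 2‖ ≤ 9 * L * |z.im| := by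
  obtain ⟨hre, him, hside⟩ := rectBoundary_square_cases hz
  have hz2 := Complex.norm_le_abs_re_add_abs_im z
  have hLn : ‖(L : ℂ)‖ = L := by simp [abs_of_pos hL]
  have hsub : ‖z - L‖ ≤ 3 * L := (norm_sub_le z L).trans (by linarith)
  have hadd : ‖z + L‖ ≤ 3 * L := (norm_add_le z L).trans (by linarith)
  have hcorner : ∀ w : ℂ, w.re = 0 → ‖w‖ = |w.im| := fun w hw => by
    rw [← Complex.re_add_im w, hw]; simp
  rw [show z ^ 2 - (L : ℂ) ^ 2 = (z - L) * (z + L) by ring, norm_mul]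
  rcases hside with h | h
  · rcases (abs_eq hL.le).1 h with h | h
    · rw [hcorner (z - L) (by simp [h])]
      simp only [Complex.sub_im, Complex.ofReal_im, sub_zero]
      nlinarith [abs_nonneg z.im]
    · rw [hcorner (z + L) (by simp [h])]
      simp only [Complex.add_im, Complex.ofReal_im, add_zero]
      nlinarith [abs_nonneg z.im]
  · rw [h]
    nlinarith [norm_nonneg (z - L), norm_nonneg (z + L)]

theorem norm_inv_prod_sub_le (hL : 0 < L) (hz : z ∈ rectBoundary (-L) L (-L) L) {s : Finset ℂ}
    (hs : ∀ a ∈ s, 2 * ‖a‖ ≤ L) : ‖(∏ a ∈ s, (z - a))⁻¹‖ ≤ ((L / 2) ^ s.card)⁻¹ := by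
  rw [norm_inv, norm_prod]
  refine inv_anti₀ (by positivity) ?_
  rw [← Finset.prod_const]
  refine Finset.prod_le_prod (fun _ _ => by positivity) fun a ha => ?_
  linarith [norm_sub_norm_le z a, hs a ha, le_norm_of_mem_rectBoundary_square hz]

theorem growth_sub_one_le (hL : 1 ≤ L) (hz : z ∈ rectBoundary (-L) L (-L) L) (him : z.im ≠ 0)
    {w : ℂ} (hre : w.re = z.re) (him1 : |z.im| ≤ |w.im|) (him2 : |w.im| ≤ |z.im| + 1) (m : ℕ) :
    growth (m - 1) w ≤ (3 * L) ^ m / L * (1 + 1 / |z.im|) := by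
  have _ : 0 < L := by linarith
  have _ : 0 < |z.im| := abs_pos.2 him
  obtain ⟨hzre, hzim, hside⟩ := rectBoundary_square_cases hz
  have hlower : L ≤ ‖w‖ := by
    rcases hside with h | h
    · exact h ▸ hre ▸ Complex.abs_re_le_norm w
    · exact (h ▸ him1).trans (Complex.abs_im_le_norm w)
  have hupper : ‖w‖ ≤ 3 * L := by
    have := Complex.norm_le_abs_re_add_abs_im w
    rw [hre] at this
    linarith
  rw [growth, zpow_sub_one₀ (by linarith), zpow_natCast, ← div_eq_mul_inv]
  gcongr

theorem norm_mul_sq_sub_sq_mul_sum_nodalWeight_le (hL : 1 ≤ L)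
    (hz : z ∈ rectBoundary (-L) L (-L) L) (him : z.im ≠ 0) {w c : ℂ} (hre : w.re = z.re)
    (him1 : |z.im| ≤ |w.im|) (him2 : |w.im| ≤ |z.im| + 1) {C : ℝ} (hC : 0 ≤ C) {s : Finset ℂ}
    {m : ℕ} (hc : ‖c‖ ≤ C * growth (m - 1) w) (hs : s.card = m + 1) (hsL : ∀ a ∈ s, 2 * ‖a‖ ≤ L) :
    ‖c * (z ^ 2 - (L : ℂ) ^ 2) * ∑ a ∈ s, Lagrange.nodalWeight s id a * (z - a)⁻¹‖
      ≤ 18 * C * 3 ^ m * 2 ^ (m + 1) := by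
  have hL0 : 0 < L := by linarith
  have : 0 < |z.im| := abs_pos.2 him
  have hne : ∀ a ∈ s, z ≠ a := by
    rintro a ha rfl
    linarith [hsL z ha, le_norm_of_mem_rectBoundary_square hz]
  rw [sum_nodalWeight_mul_inv_sub (Finset.card_pos.1 (by omega)) hne, norm_mul, norm_mul]
  calc ‖c‖ * ‖z ^ 2 - (L : ℂ) ^ 2‖ * ‖(∏ a ∈ s, (z - a))⁻¹‖
      ≤ C * ((3 * L) ^ m / L * (1 + 1 / |z.im|)) * (9 * L * |z.im|) * ((L / 2) ^ (m + 1))⁻¹ := by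
        gcongr
        · exact hc.trans (mul_le_mul_of_nonneg_left
            (growth_sub_one_le hL hz him hre him1 him2 m) hC)
        · exact norm_sq_sub_sq_le hL0 hz
        · exact hs ▸ norm_inv_prod_sub_le hL0 hz hsL
    _ = C * (3 * L) ^ m * 9 * (|z.im| + 1) * ((L / 2) ^ (m + 1))⁻¹ := by
        field_simp
    _ ≤ C * (3 * L) ^ m * 9 * (L + L) * ((L / 2) ^ (m + 1))⁻¹ := by
        gcongr
        exact (rectBoundary_square_cases hz).2.1
    _ = 18 * C * 3 ^ m * 2 ^ (m + 1) := by
        rw [mul_pow, div_pow]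
        field_simp
        ring

theorem NoJump.norm_sum_nodalWeight_mul_le {f : ℂ → ℂ} (hj : NoJump f)
    (hf : DifferentiableOn ℂ f {z | z.im ≠ 0}) {C : ℝ} (hC : 0 ≤ C) {m : ℕ} (hL : 1 ≤ L)
    (hbound : ∀ z : ℂ, L ≤ ‖z‖ → z.im ≠ 0 → ‖f z‖ ≤ C * growth (m - 1) z)
    {s : Finset ℂ} (hs : s.card = m + 1) (him : ∀ a ∈ s, a.im ≠ 0) (hsL : ∀ a ∈ s, 2 * ‖a‖ ≤ L) :
    ‖2 * Real.pi * I * ∑ a ∈ s, Lagrange.nodalWeight s id a * (f a * (a ^ 2 - (L : ℂ) ^ 2))‖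
      ≤ 8 * L * (18 * C * 3 ^ m * 2 ^ (m + 1)) := by
  have hL0 : 0 < L := by linarith
  have hinside : ∀ a ∈ s, a ∈ Ioo (-L) L ×ℂ Ioo (-L) L := fun a ha => by
    have ha0 : a ≠ 0 := fun h => him a ha (by simp [h])
    have hlt : ‖a‖ < L := by linarith [hsL a ha, norm_pos_iff.2 ha0]
    exact ⟨abs_lt.1 ((Complex.abs_re_le_norm a).trans_lt hlt),
      abs_lt.1 ((Complex.abs_im_le_norm a).trans_lt hlt)⟩
  have hkernel : ∀ z ∈ rectBoundary (-L) L (-L) L, z.im ≠ 0 → ∀ w : ℂ, w.re = z.re →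
      |z.im| ≤ |w.im| → |w.im| ≤ |z.im| + 1 →
      ‖f w * (z ^ 2 - (L : ℂ) ^ 2) * ∑ a ∈ s, Lagrange.nodalWeight s id a * (z - a)⁻¹‖
        ≤ 18 * C * 3 ^ m * 2 ^ (m + 1) := fun z hz hz0 w hre him1 him2 => by
    refine norm_mul_sq_sub_sq_mul_sum_nodalWeight_le hL hz hz0 hre him1 him2 hC
      (hbound w ?_ (abs_pos.1 ((abs_pos.2 hz0).trans_le him1))) hs hsL
    obtain ⟨-, -, h | h⟩ := rectBoundary_square_cases hz
    · exact h ▸ hre ▸ Complex.abs_re_le_norm w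
    · exact (h ▸ him1).trans (Complex.abs_im_le_norm w)
  refine hj.norm_sum_residues_le hf (g := fun z => z ^ 2 - (L : ℂ) ^ 2) (by fun_prop) hL0
    (by simp) (by simp) (fun a ha => ⟨him a ha, hinside a ha⟩) (fun ε hε z hz hpos => ?_)
    (fun ε hε z hz hneg => ?_)
  · refine hkernel z hz hpos.ne' _ (by simp) ?_ ?_ <;>
    · simp only [Complex.add_im, Complex.im_ofReal_mul, Complex.I_im, mul_one]
      rw [abs_of_pos hpos, abs_of_pos (by linarith [hε.1])]
      linarith [hε.1, hε.2]
  · refine hkernel z hz hneg.ne _ (by simp) ?_ ?_ <;>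
    · simp only [Complex.sub_im, Complex.im_ofReal_mul, Complex.I_im, mul_one]
      rw [abs_of_neg hneg, abs_of_neg (by linarith [hε.1])]
      linarith [hε.1, hε.2]

theorem eq_zero_of_eventually_norm_sub_sq_mul_le {A T : ℂ} {K : ℝ}
    (h : ∀ᶠ L : ℝ in atTop, ‖T - (L : ℂ) ^ 2 * A‖ ≤ K * L) : A = 0 := by
  have hle : ∀ᶠ L : ℝ in atTop, ‖A‖ ≤ ‖T‖ * (L⁻¹ * L⁻¹) + K * L⁻¹ := by
    filter_upwards [h, eventually_gt_atTop 0] with L hL hL0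
    have hnorm : ‖(L : ℂ) ^ 2 * A‖ ≤ ‖T‖ + K * L := by
      linarith [norm_le_norm_add_norm_sub T ((L : ℂ) ^ 2 * A)]
    rw [norm_mul, norm_pow, Complex.norm_real, Real.norm_of_nonneg hL0.le] at hnorm
    field_simp
    linarith
  have hlim : Tendsto (fun L : ℝ => ‖T‖ * (L⁻¹ * L⁻¹) + K * L⁻¹) atTop (𝓝 0) := by
    simpa using ((tendsto_inv_atTop_zero.mul tendsto_inv_atTop_zero).const_mul ‖T‖).add
      (tendsto_inv_atTop_zero.const_mul K)
  exact norm_le_zero_iff.1 (ge_of_tendsto hlim hle)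

/-- The left-hand side is the divided difference of `f` at the nodes `s`. -/
theorem NoJump.sum_nodalWeight_mul_eq_zero {f : ℂ → ℂ} (hj : NoJump f)
    (hf : DifferentiableOn ℂ f {z | z.im ≠ 0}) {m : ℕ} (hO : f =O[offReal] growth (m - 1))
    {s : Finset ℂ} (hs : s.card = m + 1) (him : ∀ a ∈ s, a.im ≠ 0) :
    ∑ a ∈ s, Lagrange.nodalWeight s id a * f a = 0 := by
  obtain ⟨C, R, hC, hbound⟩ := isBigO_growth_iff.1 hO
  obtain ⟨B, hB⟩ : ∃ B, ∀ a ∈ s, 2 * ‖a‖ ≤ B := by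
    obtain ⟨B, hB⟩ := (s.image fun a : ℂ => 2 * ‖a‖).bddAbove
    exact ⟨B, fun a ha => hB (Finset.mem_coe.2 (Finset.mem_image_of_mem _ ha))⟩
  have hsplit : ∀ L : ℂ, 2 * Real.pi * I *
      ∑ a ∈ s, Lagrange.nodalWeight s id a * (f a * (a ^ 2 - L ^ 2))
        = 2 * Real.pi * I * (∑ a ∈ s, Lagrange.nodalWeight s id a * (f a * a ^ 2))
          - L ^ 2 * (2 * Real.pi * I * ∑ a ∈ s, Lagrange.nodalWeight s id a * f a) := fun L => by
    simp only [Finset.mul_sum, ← Finset.sum_sub_distrib]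
    exact Finset.sum_congr rfl fun a _ => by ring
  have hzero : 2 * Real.pi * I * ∑ a ∈ s, Lagrange.nodalWeight s id a * f a = 0 := by
    refine eq_zero_of_eventually_norm_sub_sq_mul_le
      (T := 2 * Real.pi * I * ∑ a ∈ s, Lagrange.nodalWeight s id a * (f a * a ^ 2))
      (K := 8 * (18 * C * 3 ^ m * 2 ^ (m + 1))) ?_
    filter_upwards [eventually_ge_atTop 1, eventually_ge_atTop R, eventually_ge_atTop B]
      with L hL1 hLR hLB
    have hest := hj.norm_sum_nodalWeight_mul_le hf hC hL1
      (fun z hz => hbound z (hLR.trans hz)) hs him fun a ha => (hB a ha).trans hLB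
    rw [hsplit] at hest
    linarith
  simpa [Real.pi_ne_zero] using hzero

variable {T : Finset ℂ}

theorem nodalWeight_insert_self (hz : z ∉ T) :
    Lagrange.nodalWeight (insert z T) id z = (∏ a ∈ T, (z - a))⁻¹ := by
  rw [Lagrange.nodalWeight, Finset.erase_insert hz, Finset.prod_inv_distrib]
  rfl

theorem nodalWeight_insert_of_mem (hz : z ∉ T) {a : ℂ} (ha : a ∈ T) :
    Lagrange.nodalWeight (insert z T) id a = -(Lagrange.nodalWeight T id a * (z - a)⁻¹) := by
  have hza : z ≠ a := fun h => hz (h ▸ ha)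
  rw [Lagrange.nodalWeight, Finset.erase_insert_of_ne hza, Finset.prod_insert
    (fun h => hz (Finset.mem_of_mem_erase h)), Lagrange.nodalWeight]
  simp only [id]
  rw [← neg_sub z a, inv_neg]
  ring

theorem eval_interpolate_eq_of_sum_nodalWeight_insert_eq_zero (hz : z ∉ T) {f : ℂ → ℂ}
    (h : ∑ a ∈ insert z T, Lagrange.nodalWeight (insert z T) id a * f a = 0) :
    (Lagrange.interpolate T id f).eval z = f z := by
  have hne : ∀ a ∈ T, z ≠ a := fun a ha h => hz (h ▸ ha)
  have hprod : ∏ a ∈ T, (z - a) ≠ 0 :=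
    Finset.prod_ne_zero_iff.2 fun a ha => sub_ne_zero.2 (hne a ha)
  rw [Finset.sum_insert hz, nodalWeight_insert_self hz,
    Finset.sum_congr rfl fun a ha => by rw [nodalWeight_insert_of_mem hz ha, neg_mul],
    Finset.sum_neg_distrib, ← sub_eq_add_neg, sub_eq_zero] at h
  rw [Lagrange.eval_interpolate_not_at_node (v := id) f hne, Lagrange.eval_nodal]
  simp only [id]
  rw [← h, mul_inv_cancel_left₀ hprod]

theorem NoJump.exists_polynomial {f : ℂ → ℂ} (hj : NoJump f)
    (hf : DifferentiableOn ℂ f {z | z.im ≠ 0}) {m : ℕ} (hO : f =O[offReal] growth (m - 1)) :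
    ∃ P : ℂ[X], P.degree < m ∧ ∀ z : ℂ, z.im ≠ 0 → f z = P.eval z := by
  have hinj : Function.Injective fun k : ℕ => ((k + 1 : ℝ) : ℂ) * I := fun j k h => by
    simpa using mul_right_cancel₀ Complex.I_ne_zero h
  set T : Finset ℂ := (Finset.range m).map ⟨_, hinj⟩ with hT
  have hcard : T.card = m := by rw [hT, Finset.card_map, Finset.card_range]
  have him : ∀ a ∈ T, a.im ≠ 0 := by
    intro a ha
    obtain ⟨k, -, rfl⟩ := Finset.mem_map.1 ha
    simpa using Nat.cast_add_one_ne_zero (R := ℝ) k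
  refine ⟨Lagrange.interpolate T id f, ?_, fun z hz => ?_⟩
  · exact hcard ▸ Lagrange.degree_interpolate_lt _ (injOn_id _)
  by_cases hzT : z ∈ T
  · exact (Lagrange.eval_interpolate_at_node f (injOn_id _) hzT).symm
  · refine (eval_interpolate_eq_of_sum_nodalWeight_insert_eq_zero hzT ?_).symm
    exact hj.sum_nodalWeight_mul_eq_zero hf hO
      (by rw [Finset.card_insert_of_notMem hzT, hcard])
      ((Finset.forall_mem_insert _ _ _).2 ⟨hz, him⟩)

end Liouville

section Cauchy

/-- The Cauchy transform `∫ h(s) / (z - s) ds`, with the sign convention of the Weyl functions. -/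
noncomputable def cauchy (h : ℝ → ℂ) (z : ℂ) : ℂ := ∫ s : ℝ, h s / (z - s)

theorem isClosed_image_ofReal {S : Set ℝ} (hS : IsClosed S) :
    IsClosed ((fun x : ℝ => (x : ℂ)) '' S) :=
  Complex.isometry_ofReal.isClosedEmbedding.isClosedMap S hS

theorem notMem_image_ofReal_of_im_ne_zero {S : Set ℝ} {z : ℂ} (hz : z.im ≠ 0) :
    z ∉ (fun x : ℝ => (x : ℂ)) '' S := by
  rintro ⟨x, -, rfl⟩
  exact hz (Complex.ofReal_im x)

theorem exists_ball_forall_le_norm_sub {S : Set ℝ} (hS : IsClosed S) {z : ℂ}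
    (hz : z ∉ (fun x : ℝ => (x : ℂ)) '' S) :
    ∃ δ > 0, ∀ u ∈ Metric.ball z δ, ∀ s ∈ S, δ ≤ ‖u - s‖ := by
  obtain ⟨r, hr, hball⟩ := Metric.isOpen_iff.1 (isClosed_image_ofReal hS).isOpen_compl z hz
  refine ⟨r / 2, half_pos hr, fun u hu s hs => ?_⟩
  by_contra! hlt
  refine hball (a := (s : ℂ)) ?_ ⟨s, hs, rfl⟩
  rw [← dist_eq_norm] at hlt
  rw [Metric.mem_ball] at hu ⊢
  linarith [dist_triangle_left (s : ℂ) z u]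

variable {h : ℝ → ℂ} {z : ℂ}

theorem abs_im_le_norm_sub_ofReal (z : ℂ) (s : ℝ) : |z.im| ≤ ‖z - s‖ := by
  simpa using Complex.abs_im_le_norm (z - s)

theorem sub_ofReal_ne_zero (hz : z.im ≠ 0) (s : ℝ) : z - s ≠ 0 :=
  norm_pos_iff.1 ((abs_pos.2 hz).trans_le (abs_im_le_norm_sub_ofReal z s))

theorem aestronglyMeasurable_div_sub (hm : AEStronglyMeasurable h) (z : ℂ) :
    AEStronglyMeasurable fun s : ℝ => h s / (z - s) :=
  (hm.aemeasurable.div (by fun_prop)).aestronglyMeasurable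

theorem integrable_div_of_le {X : Type*} [MeasurableSpace X] {μ : Measure X} {f u : X → ℂ}
    (hf : Integrable f μ) (hu : AEMeasurable u μ) {δ : ℝ} (hδ : 0 < δ)
    (hle : ∀ᵐ x ∂μ, f x ≠ 0 → δ ≤ ‖u x‖) : Integrable (fun x => f x / u x) μ := by
  refine (hf.norm.const_mul δ⁻¹).mono' (hf.1.aemeasurable.div hu).aestronglyMeasurable ?_
  filter_upwards [hle] with x hx
  by_cases h0 : f x = 0
  · simp only [h0, zero_div, norm_zero, mul_zero, le_refl]
  · rw [norm_div, div_eq_inv_mul]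
    gcongr
    exact hx h0

theorem integrable_div_sub_of_le (hi : Integrable h) {δ : ℝ} (hδ : 0 < δ)
    (hz : ∀ᵐ s : ℝ, h s ≠ 0 → δ ≤ ‖z - s‖) : Integrable fun s : ℝ => h s / (z - s) :=
  integrable_div_of_le hi (by fun_prop) hδ hz

theorem integrable_div_sub_of_notMem (hi : Integrable h) {S : Set ℝ} (hS : IsClosed S)
    (h0 : ∀ᵐ s : ℝ, s ∉ S → h s = 0) (hz : z ∉ (fun x : ℝ => (x : ℂ)) '' S) :
    Integrable fun s : ℝ => h s / (z - s) := by
  obtain ⟨δ, hδ, hd⟩ := exists_ball_forall_le_norm_sub hS hz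
  refine integrable_div_sub_of_le hi hδ ?_
  filter_upwards [h0] with s hs hne
  exact hd z (Metric.mem_ball_self hδ) s (not_imp_comm.1 hs hne)

theorem integrable_div_sub (hi : Integrable h) (hz : z.im ≠ 0) :
    Integrable fun s : ℝ => h s / (z - s) :=
  integrable_div_sub_of_le hi (abs_pos.2 hz)
    (ae_of_all _ fun s _ => abs_im_le_norm_sub_ofReal z s)

theorem differentiableAt_cauchy (hi : Integrable h) {S : Set ℝ} (hS : IsClosed S)
    (h0 : ∀ᵐ s : ℝ, s ∉ S → h s = 0) (hz : z ∉ (fun x : ℝ => (x : ℂ)) '' S) :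
    DifferentiableAt ℂ (cauchy h) z := by
  obtain ⟨δ, hδ, hd⟩ := exists_ball_forall_le_norm_sub hS hz
  refine (hasDerivAt_integral_of_dominated_loc_of_deriv_le
    (F := fun (u : ℂ) (s : ℝ) => h s / (u - s)) (F' := fun u s => -(h s / (u - s) ^ 2))
    (bound := fun s => δ⁻¹ ^ 2 * ‖h s‖) (Metric.ball_mem_nhds z hδ)
    (Eventually.of_forall fun u => aestronglyMeasurable_div_sub hi.1 u)
    (integrable_div_sub_of_notMem hi hS h0 hz)
    (hi.1.aemeasurable.div (by fun_prop)).neg.aestronglyMeasurable ?_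
    (hi.norm.const_mul _) ?_).2.differentiableAt
  · filter_upwards [h0] with s hs u hu
    by_cases hsS : s ∈ S
    · rw [norm_neg, norm_div, norm_pow, div_eq_inv_mul, ← inv_pow]
      gcongr
      exact hd u hu s hsS
    · simp only [hs hsS, zero_div, neg_zero, norm_zero, mul_zero, le_refl]
  · filter_upwards [h0] with s hs u hu
    by_cases hsS : s ∈ S
    · have hne : u - s ≠ 0 := norm_pos_iff.1 (hδ.trans_le (hd u hu s hsS))
      have hderiv := (hasDerivAt_const u (h s)).div ((hasDerivAt_id u).sub_const (s : ℂ)) hne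
      simp only [zero_mul, id, mul_one, zero_sub, neg_div] at hderiv
      exact hderiv
    · simpa only [hs hsS, zero_div, neg_zero] using hasDerivAt_const u (0 : ℂ)

theorem continuousOn_cauchy (hi : Integrable h) : ContinuousOn (cauchy h) {z | z.im ≠ 0} :=
  fun _ hz => (differentiableAt_cauchy hi isClosed_univ (ae_of_all _ fun _ hs => (hs trivial).elim)
    (notMem_image_ofReal_of_im_ne_zero hz)).continuousAt.continuousWithinAt

section Plemelj

/-- `π` times the Poisson integral of `φ` at height `ε`. -/
noncomputable def poisson (φ : ℝ → ℝ) (ε s : ℝ) : ℝ := ∫ t, φ (s + ε * t) * (1 + t ^ 2)⁻¹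

variable {φ : ℝ → ℝ} {M : ℝ}

theorem integral_mul_eq_poisson (φ : ℝ → ℝ) (s : ℝ) {ε : ℝ} (hε : 0 < ε) :
    ∫ x, φ x * (ε / ((x - s) ^ 2 + ε ^ 2)) = poisson φ ε s := by
  have hscale := Measure.integral_comp_mul_left
    (fun u => φ (s + u) * (ε / ((s + u - s) ^ 2 + ε ^ 2))) ε
  rw [abs_of_pos (inv_pos.2 hε), smul_eq_mul, ← div_eq_inv_mul, eq_div_iff hε.ne'] at hscale
  rw [← integral_add_left_eq_self _ s, ← hscale, poisson, ← integral_mul_const]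
  congr with t
  have hsq : (s + ε * t - s) ^ 2 + ε ^ 2 = ε ^ 2 * (1 + t ^ 2) := by ring
  rw [hsq]
  field_simp

theorem norm_mul_inv_one_add_sq_le (hM : ∀ x, ‖φ x‖ ≤ M) (x t : ℝ) :
    ‖φ x * (1 + t ^ 2)⁻¹‖ ≤ M * (1 + t ^ 2)⁻¹ := by
  rw [norm_mul, Real.norm_of_nonneg (by positivity : 0 ≤ (1 + t ^ 2)⁻¹)]
  gcongr
  exact hM x

theorem tendsto_poisson (hφ : Continuous φ) (hM : ∀ x, ‖φ x‖ ≤ M) (s : ℝ) :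
    Tendsto (fun ε => poisson φ ε s) (𝓝[>] 0) (𝓝 (Real.pi * φ s)) := by
  have hzero : Real.pi * φ s = poisson φ 0 s := by
    simp only [poisson, zero_mul, add_zero]
    rw [integral_const_mul, integral_univ_inv_one_add_sq, mul_comm]
  rw [hzero]
  refine Tendsto.mono_left (Continuous.tendsto (f := fun ε => poisson φ ε s) ?_ 0)
    nhdsWithin_le_nhds
  exact continuous_of_dominated
    (fun ε => (by fun_prop : Measurable _).aestronglyMeasurable)
    (fun ε => ae_of_all _ fun t => norm_mul_inv_one_add_sq_le hM _ t)
    (integrable_inv_one_add_sq.const_mul M) (ae_of_all _ fun t => by fun_prop)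

theorem norm_poisson_le (hM : ∀ x, ‖φ x‖ ≤ M) (ε s : ℝ) : ‖poisson φ ε s‖ ≤ M * Real.pi := by
  rw [← integral_univ_inv_one_add_sq, ← integral_const_mul]
  exact norm_integral_le_of_norm_le (integrable_inv_one_add_sq.const_mul M)
    (ae_of_all _ fun t => norm_mul_inv_one_add_sq_le hM _ t)

theorem continuous_poisson (hφ : Continuous φ) (hM : ∀ x, ‖φ x‖ ≤ M) (ε : ℝ) :
    Continuous (poisson φ ε) :=
  continuous_of_dominated
    (fun s => (by fun_prop : Measurable _).aestronglyMeasurable)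
    (fun s => ae_of_all _ fun t => norm_mul_inv_one_add_sq_le hM _ t)
    (integrable_inv_one_add_sq.const_mul M) (ae_of_all _ fun t => by fun_prop)

theorem cauchy_sub_cauchy (hi : Integrable h) (x : ℝ) {ε : ℝ} (hε : ε ≠ 0) :
    cauchy h (x + ε * I) - cauchy h (x - ε * I)
      = ∫ s : ℝ, -2 * I * h s * ((ε / ((x - s) ^ 2 + ε ^ 2) : ℝ) : ℂ) := by
  have hp : ((x : ℂ) + ε * I).im ≠ 0 := by simpa using hε
  have hm : ((x : ℂ) - ε * I).im ≠ 0 := by simpa using hε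
  rw [cauchy, cauchy, ← integral_sub (integrable_div_sub hi hp) (integrable_div_sub hi hm)]
  congr with s
  have hfactor : ((x : ℂ) - s) ^ 2 + ε ^ 2 = (x + ε * I - s) * (x - ε * I - s) := by
    linear_combination ((ε : ℂ) ^ 2) * Complex.I_sq
  have hp0 := sub_ofReal_ne_zero hp s
  have hm0 := sub_ofReal_ne_zero hm s
  push_cast
  rw [hfactor]
  field_simp
  ring

theorem integrable_mul_poissonKernel (hi : Integrable h) (hφ : Integrable φ) {ε : ℝ} (hε : 0 < ε) :
    Integrable (fun p : ℝ × ℝ =>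
        (φ p.1 : ℂ) * (-2 * I * h p.2 * ((ε / ((p.1 - p.2) ^ 2 + ε ^ 2) : ℝ) : ℂ)))
      ((volume : Measure ℝ).prod volume) := by
  have hprod : Integrable (fun p : ℝ × ℝ => (φ p.1 : ℂ) * (-2 * I * h p.2))
      ((volume : Measure ℝ).prod volume) := hφ.ofReal.mul_prod (hi.const_mul (-2 * I))
  simp only [← mul_assoc] at hprod ⊢
  refine hprod.mul_bdd (c := ε⁻¹) ?_ (ae_of_all _ fun p => ?_)
  · exact (by fun_prop : Measurable _).aestronglyMeasurable
  · rw [Complex.norm_real, Real.norm_of_nonneg (by positivity), div_le_iff₀ (by positivity)]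
    field_simp
    nlinarith [sq_nonneg (p.1 - p.2)]

theorem integral_mul_cauchy_sub_cauchy (hi : Integrable h) (hφ : Integrable φ) {ε : ℝ}
    (hε : 0 < ε) :
    ∫ x : ℝ, (φ x : ℂ) * (cauchy h (x + ε * I) - cauchy h (x - ε * I))
      = ∫ s : ℝ, -2 * I * h s * (poisson φ ε s : ℂ) := by
  simp_rw [cauchy_sub_cauchy hi _ hε.ne', ← integral_const_mul]
  rw [integral_integral_swap (integrable_mul_poissonKernel hi hφ hε)]
  congr with s
  rw [← integral_mul_eq_poisson φ s hε, ← integral_complex_ofReal, ← integral_const_mul]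
  congr with x
  push_cast
  ring

theorem tendsto_integral_mul_poisson (hi : Integrable h) (hφ : Continuous φ)
    (hM : ∀ x, ‖φ x‖ ≤ M) :
    Tendsto (fun ε : ℝ => ∫ s : ℝ, h s * (poisson φ ε s : ℂ)) (𝓝[>] 0)
      (𝓝 (∫ s : ℝ, h s * ((Real.pi * φ s : ℝ) : ℂ))) := by
  refine tendsto_integral_filter_of_dominated_convergence (fun s => ‖h s‖ * (M * Real.pi))
    (Eventually.of_forall fun ε => ?_) (Eventually.of_forall fun ε => ae_of_all _ fun s => ?_)
    (hi.norm.mul_const _) (ae_of_all _ fun s => ?_)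
  · exact hi.1.mul
      (Complex.continuous_ofReal.comp (continuous_poisson hφ hM ε)).aestronglyMeasurable
  · rw [norm_mul, Complex.norm_real]
    gcongr
    exact norm_poisson_le hM ε s
  · exact ((Complex.continuous_ofReal.tendsto _).comp (tendsto_poisson hφ hM s)).const_mul _

theorem vagueNull_cauchy_sub_cauchy_add (hi : Integrable h) :
    VagueNull fun ε x =>
      cauchy h (x + ε * I) - cauchy h (x - ε * I) + 2 * Real.pi * I * h x where
  locallyIntegrable ε hε :=
    ((continuous_horizontal (continuousOn_cauchy hi) hε.ne').sub
      (continuous_horizontal_sub (continuousOn_cauchy hi) hε.ne')).locallyIntegrable.add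
      (hi.const_mul _).locallyIntegrable
  tendsto φ hφ hc := by
    obtain ⟨M, hM⟩ := hc.exists_bound_of_continuous hφ
    have hlim := (tendsto_integral_mul_poisson (hi.const_mul (-2 * I)) hφ hM).add_const
      (∫ x : ℝ, (φ x : ℂ) * (2 * Real.pi * I * h x))
    have hcancel : (∫ s : ℝ, -2 * I * h s * ((Real.pi * φ s : ℝ) : ℂ))
        + ∫ x : ℝ, (φ x : ℂ) * (2 * Real.pi * I * h x) = 0 := by
      rw [← eq_neg_iff_add_eq_zero, ← integral_neg]
      congr with x
      push_cast
      ring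
    rw [hcancel] at hlim
    refine hlim.congr' ?_
    filter_upwards [self_mem_nhdsWithin] with ε hε
    simp only [mul_add]
    rw [integral_add, integral_mul_cauchy_sub_cauchy hi (hφ.integrable_of_hasCompactSupport hc) hε]
    · exact integrable_ofReal_mul_of_hasCompactSupport hφ hc
        ((continuous_horizontal (continuousOn_cauchy hi) (ne_of_gt hε)).sub
          (continuous_horizontal_sub (continuousOn_cauchy hi) (ne_of_gt hε))).locallyIntegrable
    · exact integrable_ofReal_mul_of_hasCompactSupport hφ hc (hi.const_mul _).locallyIntegrable

end Plemelj

section BoundaryValue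

variable {F : ℂ → ℂ} {b : ℝ → ℂ} {D : ℝ → ℝ}

theorem tendsto_sub_mul_I (x : ℝ) :
    Tendsto (fun ε : ℝ => (x : ℂ) - ε * I) (𝓝[>] 0) (𝓝 x) := by
  have hcont : Continuous fun ε : ℝ => (x : ℂ) - ε * I := by fun_prop
  simpa using (hcont.tendsto 0).mono_left nhdsWithin_le_nhds

theorem tendsto_boundaryValue_mul (hF : ∀ x : ℝ, b x ≠ 0 → ContinuousAt F x) (x : ℝ) :
    Tendsto (fun ε : ℝ => F (x - ε * I) * b x) (𝓝[>] 0) (𝓝 (F x * b x)) := by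
  by_cases hx : b x = 0
  · simp only [hx, mul_zero, tendsto_const_nhds]
  · exact ((hF x hx).tendsto.comp (tendsto_sub_mul_I x)).mul_const _

theorem vagueNull_boundaryValue_mul (hc : ContinuousOn F {z | z.im ≠ 0})
    (hF : ∀ x : ℝ, b x ≠ 0 → ContinuousAt F x) (hb : LocallyIntegrable b) (hD : LocallyIntegrable D)
    (hle : ∀ ε ∈ Ioo (0 : ℝ) 1, ∀ x : ℝ, ‖F (x - ε * I) * b x‖ ≤ D x) :
    VagueNull fun ε x => F (x - ε * I) * b x - F x * b x := by
  have hmeas : ∀ ε : ℝ, 0 < ε → AEStronglyMeasurable fun x : ℝ => F (x - ε * I) * b x :=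
    fun ε hε => (continuous_horizontal_sub hc hε.ne').aestronglyMeasurable.mul
      hb.aestronglyMeasurable
  have hle0 : ∀ x : ℝ, ‖F x * b x‖ ≤ D x := fun x =>
    le_of_tendsto (tendsto_boundaryValue_mul hF x).norm
      (by filter_upwards [Ioo_mem_nhdsGT one_pos] with ε hε using hle ε hε x)
  have hmeas0 : AEStronglyMeasurable fun x : ℝ => F x * b x :=
    aestronglyMeasurable_of_tendsto_ae (𝓝[>] (0 : ℝ)) (f := fun (ε x : ℝ) =>
      if 0 < ε then F (x - ε * I) * b x else 0)
      (fun ε => by split_ifs with hε; exacts [hmeas ε hε, aestronglyMeasurable_const])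
      (ae_of_all _ fun x => (tendsto_boundaryValue_mul hF x).congr' (by
        filter_upwards [self_mem_nhdsWithin] with ε hε using (if_pos hε).symm))
  refine ⟨fun ε hε => ?_, fun φ hφ hcs => ?_⟩
  · refine LocallyIntegrable.sub ?_ (hD.mono hmeas0 (ae_of_all _ fun x => ?_))
    · exact hb.continuous_mul (continuous_horizontal_sub hc hε.ne')
    · exact (hle0 x).trans (le_abs_self _)
  · have hφD := hD.integrable_smul_left_of_hasCompactSupport hφ hcs
    have hlim : Tendsto (fun ε : ℝ => ∫ x : ℝ, (φ x : ℂ) * (F (x - ε * I) * b x - F x * b x))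
        (𝓝[>] 0) (𝓝 (∫ x : ℝ, (φ x : ℂ) * (F x * b x - F x * b x))) := by
      refine tendsto_integral_filter_of_dominated_convergence (fun x => ‖φ x • D x‖ + ‖φ x • D x‖)
        ?_ ?_ (hφD.norm.add hφD.norm)
        (ae_of_all _ fun x => ((tendsto_boundaryValue_mul hF x).sub_const _).const_mul _)
      · filter_upwards [self_mem_nhdsWithin] with ε hε
        exact (Complex.continuous_ofReal.comp hφ).aestronglyMeasurable.mul ((hmeas ε hε).sub hmeas0)
      · filter_upwards [Ioo_mem_nhdsGT one_pos] with ε hε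
        refine ae_of_all _ fun x => ?_
        rw [norm_mul, Complex.norm_real, norm_smul, ← mul_add]
        gcongr
        exact (norm_sub_le _ _).trans (add_le_add ((hle ε hε x).trans (le_abs_self _))
          ((hle0 x).trans (le_abs_self _)))
    simpa only [sub_self, mul_zero, integral_zero] using hlim

end BoundaryValue

theorem cauchy_add {f g : ℝ → ℂ} (hf : Integrable fun s : ℝ => f s / (z - s))
    (hg : Integrable fun s : ℝ => g s / (z - s)) :
    cauchy (f + g) z = cauchy f z + cauchy g z := by
  simp only [cauchy, Pi.add_apply, add_div, integral_add hf hg]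

theorem cauchy_const_smul (c : ℂ) (f : ℝ → ℂ) (z : ℂ) : cauchy (c • f) z = c * cauchy f z := by
  simp only [cauchy, Pi.smul_apply, smul_eq_mul, mul_div_assoc, integral_const_mul]

theorem cauchy_comp_neg (f : ℝ → ℂ) (z : ℂ) :
    cauchy (fun s => f (-s)) z = -cauchy f (-z) := by
  rw [cauchy, cauchy, ← integral_neg_eq_self, ← integral_neg]
  congr with s
  rw [neg_neg, Complex.ofReal_neg, ← div_neg, neg_sub, sub_neg_eq_add, sub_neg_eq_add, add_comm]

theorem ae_sub_ofReal_ne_zero (z : ℂ) : ∀ᵐ s : ℝ, z - s ≠ 0 := by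
  filter_upwards [Measure.ae_ne volume z.re] with s hs h0
  exact hs (by simpa using (congrArg Complex.re (sub_eq_zero.1 h0)).symm)

theorem mul_cauchy (hi : Integrable h) (hz : Integrable fun s : ℝ => h s / (z - s)) :
    z * cauchy h z = (∫ s, h s) + cauchy (fun s => (s : ℂ) * h s) z := by
  have hmul : (fun s : ℝ => (s : ℂ) * h s / (z - s)) =ᵐ[volume]
      fun s => z * (h s / (z - s)) - h s := by
    filter_upwards [ae_sub_ofReal_ne_zero z] with s hs
    field_simp
    ring
  rw [cauchy, cauchy, integral_congr_ae hmul, integral_sub (hz.const_mul z) hi,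
    integral_const_mul, add_sub_cancel]

/-- Partial fractions under the integral sign. -/
theorem cauchy_mul_cauchy {f g : ℝ → ℂ} (hfg : ∀ s, f s * g s = 0)
    (hl : Integrable fun p : ℝ × ℝ => f p.1 * g p.2 / (p.1 - p.2) / (z - p.1))
    (hr : Integrable fun p : ℝ × ℝ => f p.1 * g p.2 / (p.1 - p.2) / (z - p.2)) :
    cauchy f z * cauchy g z
      = cauchy (fun s => f s * cauchy g s) z + cauchy (fun t => g t * cauchy f t) z := by
  have hsplit : (fun p : ℝ × ℝ => f p.1 / (z - p.1) * (g p.2 / (z - p.2))) =ᵐ[volume]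
      fun p => f p.1 * g p.2 / (p.1 - p.2) / (z - p.1)
        - f p.1 * g p.2 / (p.1 - p.2) / (z - p.2) := by
    filter_upwards [Measure.quasiMeasurePreserving_fst.ae (ae_sub_ofReal_ne_zero z),
      Measure.quasiMeasurePreserving_snd.ae (ae_sub_ofReal_ne_zero z)] with p hp₁ hp₂
    rcases eq_or_ne p.1 p.2 with hp | hp
    · rw [div_mul_div_comm, hp, hfg]
      simp only [zero_div, sub_zero]
    · have hp' : (p.1 : ℂ) - p.2 ≠ 0 := sub_ne_zero.2 (Complex.ofReal_injective.ne hp)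
      field_simp
      ring
  rw [Measure.volume_eq_prod] at hl hr hsplit
  rw [cauchy, cauchy, ← integral_prod_mul, integral_congr_ae hsplit, integral_sub hl hr,
    integral_prod _ hl, integral_prod_symm _ hr, sub_eq_add_neg, ← integral_neg]
  congr 1
  · rw [cauchy]
    congr with s
    rw [cauchy, ← integral_const_mul, ← integral_div]
    simp only [mul_div_assoc]
  · rw [cauchy]
    congr with t
    rw [cauchy, ← integral_const_mul, ← integral_div, ← integral_neg]
    congr with s
    rw [← neg_sub (s : ℂ) t, div_neg]
    ring

theorem norm_cauchy_le (hi : Integrable h) (hz : z.im ≠ 0) :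
    ‖cauchy h z‖ ≤ (∫ s, ‖h s‖) * (1 / |z.im|) := by
  rw [← integral_mul_const]
  refine norm_integral_le_of_norm_le (hi.norm.mul_const _) (ae_of_all _ fun s => ?_)
  rw [norm_div, div_eq_mul_one_div]
  have : 0 < |z.im| := abs_pos.2 hz
  gcongr
  exact abs_im_le_norm_sub_ofReal z s

theorem isBigO_cauchy (hi : Integrable h) (hi' : Integrable fun s : ℝ => (s : ℂ) * h s) :
    cauchy h =O[offReal] growth (-1) := by
  refine isBigO_growth_iff.2 ⟨(∫ s, ‖h s‖) + ∫ s : ℝ, ‖(s : ℂ) * h s‖, 0, by positivity,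
    fun z _ hz => ?_⟩
  have hz0 : 0 < ‖z‖ := norm_pos_iff.2 fun h0 => hz (by simp [h0])
  have hnorm : ‖z‖ * ‖cauchy h z‖
      ≤ (∫ s, ‖h s‖) + (∫ s : ℝ, ‖(s : ℂ) * h s‖) * (1 / |z.im|) := by
    rw [← norm_mul, mul_cauchy hi (integrable_div_sub hi hz)]
    exact (norm_add_le _ _).trans (add_le_add (norm_integral_le_integral_norm _)
      (norm_cauchy_le hi' hz))
  rw [growth, zpow_neg_one, mul_left_comm, ← div_eq_inv_mul, le_div_iff₀' hz0]
  refine hnorm.trans ?_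
  have hi0 : 0 ≤ ∫ s, ‖h s‖ := by positivity
  have hi1 : 0 ≤ ∫ s : ℝ, ‖(s : ℂ) * h s‖ := by positivity
  have him : 0 ≤ 1 / |z.im| := by positivity
  nlinarith [mul_nonneg hi0 him]

theorem pow_mul_cauchy (hi : ∀ k : ℕ, Integrable fun s : ℝ => (s : ℂ) ^ k * h s)
    (hz : z.im ≠ 0) {n : ℕ} (hm : ∀ k < n, ∫ s : ℝ, (s : ℂ) ^ k * h s = 0) :
    z ^ n * cauchy h z = cauchy (fun s => (s : ℂ) ^ n * h s) z := by
  induction n with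
  | zero => simp only [pow_zero, one_mul]
  | succ n ih =>
    have hsucc := mul_cauchy (hi n) (integrable_div_sub (hi n) hz)
    rw [hm n n.lt_succ_self, zero_add] at hsucc
    rw [pow_succ', mul_assoc, ih fun k hk => hm k (hk.trans n.lt_succ_self), hsucc]
    simp only [pow_succ', mul_assoc]

end Cauchy

variable {α β : ℝ → ℝ}

/-- The standing assumption on the two densities: both are weights on the positive half-line and
their Cauchy bimoments are finite. -/
structure IsCauchyPair (α β : ℝ → ℝ) : Prop where
  left : IsWeight α
  right : IsWeight β
  finiteBimoments : FiniteBimoments α β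

theorem IsWeight.pos_of_ne_zero {a : ℝ → ℝ} (ha : IsWeight a) {x : ℝ} (hx : a x ≠ 0) : 0 < x :=
  not_le.1 fun h => hx (ha.eq_zero x h)

theorem IsWeight.integral_mul_pos {a : ℝ → ℝ} (ha : IsWeight a) {u : ℝ → ℝ}
    (hu : ∀ x, 0 < x → 0 ≤ u x) (hfin : {x | 0 < x ∧ u x = 0}.Finite)
    (hi : Integrable fun x => u x * a x) : 0 < ∫ x, u x * a x := by
  have hnn : ∀ x, 0 ≤ u x * a x := fun x => by
    by_cases hx : a x = 0
    · rw [hx, mul_zero]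
    · exact mul_nonneg (hu x (ha.pos_of_ne_zero hx)) (ha.nonneg x)
  refine (integral_nonneg hnn).lt_of_ne fun h0 => ha.ne_zero ?_
  filter_upwards [(integral_eq_zero_iff_of_nonneg hnn hi).1 h0.symm,
    measure_eq_zero_iff_ae_notMem.1 (hfin.measure_zero volume)] with x hprod hx
  by_contra hne
  exact hx ⟨ha.pos_of_ne_zero hne, (mul_eq_zero.1 hprod).resolve_right hne⟩

namespace IsCauchyPair

theorem integrable_bimoment (h : IsCauchyPair α β) (j k : ℕ) :
    Integrable fun s : ℝ × ℝ => s.1 ^ j * s.2 ^ k / (s.1 + s.2) * (α s.1 * β s.2) := by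
  refine (integrableOn_iff_integrable_of_support_subset fun s hs => ?_).1 (h.finiteBimoments j k)
  have hne := right_ne_zero_of_mul hs
  exact ⟨h.left.pos_of_ne_zero (left_ne_zero_of_mul hne),
    h.right.pos_of_ne_zero (right_ne_zero_of_mul hne)⟩

theorem symm (h : IsCauchyPair α β) : IsCauchyPair β α where
  left := h.right
  right := h.left
  finiteBimoments j k := by
    refine ((h.integrable_bimoment k j).swap.congr (ae_of_all _ fun s => ?_)).integrableOn
    simp only [Function.comp, Prod.fst_swap, Prod.snd_swap, add_comm s.2, mul_comm (α s.2),
      mul_comm (s.2 ^ k)]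

theorem integrable_pow_mul_mul (h : IsCauchyPair α β) (k : ℕ) :
    Integrable fun s : ℝ × ℝ => s.1 ^ k * α s.1 * β s.2 := by
  refine ((h.integrable_bimoment (k + 1) 0).add (h.integrable_bimoment k 1)).congr
    (ae_of_all _ fun s => ?_)
  by_cases hx : α s.1 = 0
  · simp only [Pi.add_apply, hx, zero_mul, mul_zero, add_zero]
  by_cases hy : β s.2 = 0
  · simp only [Pi.add_apply, hy, mul_zero, add_zero]
  have hne : s.1 + s.2 ≠ 0 :=
    (add_pos (h.left.pos_of_ne_zero hx) (h.right.pos_of_ne_zero hy)).ne'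
  simp only [Pi.add_apply]
  field_simp
  ring

theorem integrable_moment (h : IsCauchyPair α β) (k : ℕ) : Integrable fun x => x ^ k * α x := by
  have hslice := (Measure.volume_eq_prod ℝ ℝ ▸ h.integrable_pow_mul_mul k).prod_left_ae
  by_contra hnot
  refine h.right.ne_zero ?_
  filter_upwards [hslice] with y hy
  by_contra hne
  exact hnot ((integrable_mul_const_iff (isUnit_iff_ne_zero.2 hne) _).1 hy)

theorem integrable_eval_mul (h : IsCauchyPair α β) (P : ℝ[X]) :
    Integrable fun x => P.eval x * α x := by
  simp_rw [eval_eq_sum_range, Finset.sum_mul, mul_assoc]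
  exact integrable_finsetSum _ fun i _ => (h.integrable_moment i).const_mul (P.coeff i)

theorem integrable_pairing (h : IsCauchyPair α β) (p q : ℝ[X]) : Integrable fun s : ℝ × ℝ =>
    p.eval s.1 * q.eval s.2 / (s.1 + s.2) * (α s.1 * β s.2) := by
  simp_rw [eval_eq_sum_range, Finset.sum_mul_sum, Finset.sum_div, Finset.sum_mul]
  refine integrable_finsetSum _ fun i _ => integrable_finsetSum _ fun j _ => ?_
  refine ((h.integrable_bimoment i j).const_mul (p.coeff i * q.coeff j)).congr
    (ae_of_all _ fun s => ?_)
  ring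

end IsCauchyPair

section Pairing

/-- The Cauchy pairing `⟨p, q⟩ = ∬ p(x) q(y) α(x) β(y) / (x + y) dx dy`. -/
noncomputable def pairing (α β : ℝ → ℝ) (p q : ℝ[X]) : ℝ :=
  ∫ s : ℝ × ℝ, p.eval s.1 * q.eval s.2 / (s.1 + s.2) * (α s.1 * β s.2)

theorem pairing_comm (p q : ℝ[X]) : pairing α β p q = pairing β α q p := by
  rw [pairing, pairing, Measure.volume_eq_prod, ← integral_prod_swap]
  congr with s
  simp only [Prod.fst_swap, Prod.snd_swap, add_comm s.2, mul_comm (α s.2), mul_comm (p.eval s.2)]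

theorem pairing_C_mul_left (c : ℝ) (p q : ℝ[X]) :
    pairing α β (C c * p) q = c * pairing α β p q := by
  rw [pairing, pairing, ← integral_const_mul]
  congr with s
  rw [eval_mul, eval_C]
  ring

theorem pairing_C_mul_right (c : ℝ) (p q : ℝ[X]) :
    pairing α β p (C c * q) = c * pairing α β p q := by
  rw [pairing_comm, pairing_C_mul_left, pairing_comm]

namespace IsCauchyPair

theorem pairing_add_left (h : IsCauchyPair α β) (p p' q : ℝ[X]) :
    pairing α β (p + p') q = pairing α β p q + pairing α β p' q := by
  rw [pairing, pairing, pairing,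
    ← integral_add (h.integrable_pairing p q) (h.integrable_pairing p' q)]
  congr with s
  rw [eval_add]
  ring

theorem pairing_add_right (h : IsCauchyPair α β) (p q q' : ℝ[X]) :
    pairing α β p (q + q') = pairing α β p q + pairing α β p q' := by
  rw [pairing_comm, h.symm.pairing_add_left, pairing_comm, pairing_comm q']

/-- The Cauchy pairing as a bilinear map. -/
noncomputable def bilinPairing (h : IsCauchyPair α β) : ℝ[X] →ₗ[ℝ] ℝ[X] →ₗ[ℝ] ℝ :=
  LinearMap.mk₂ ℝ (pairing α β) h.pairing_add_left
    (fun c p q => by rw [smul_eq_C_mul, pairing_C_mul_left, smul_eq_mul])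
    h.pairing_add_right
    (fun c p q => by rw [smul_eq_C_mul, pairing_C_mul_right, smul_eq_mul])

theorem setIntegral_setIntegral_eq_pairing (h : IsCauchyPair α β) (p q : ℝ[X]) :
    ∫ x in Ioi (0 : ℝ), ∫ y in Ioi (0 : ℝ), p.eval x * q.eval y / (x + y) * (α x * β y)
      = pairing α β p q := by
  have hinner : ∀ x, ∫ y in Ioi (0 : ℝ), p.eval x * q.eval y / (x + y) * (α x * β y)
      = ∫ y, p.eval x * q.eval y / (x + y) * (α x * β y) := fun x =>
    setIntegral_eq_integral_of_forall_compl_eq_zero fun y hy => by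
      rw [h.right.eq_zero y (not_lt.1 hy), mul_zero, mul_zero]
  simp_rw [hinner]
  rw [setIntegral_eq_integral_of_forall_compl_eq_zero, pairing, Measure.volume_eq_prod,
    integral_prod _ (h.integrable_pairing p q)]
  intro x hx
  simp only [h.left.eq_zero x (not_lt.1 hx), zero_mul, mul_zero, integral_zero]

end IsCauchyPair

end Pairing

section Stieltjes

/-- The Stieltjes transform `∫ P(x) a(x) / (x + y) dx`; pairing `P` with `q` integrates it against
`q(y) β(y)`. -/
noncomputable def stieltjes (a : ℝ → ℝ) (P : ℝ[X]) (y : ℝ) : ℝ := ∫ x, P.eval x * a x / (x + y)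

theorem neg_ofReal_notMem_image_Ici {y : ℝ} (hy : 0 < y) :
    (-y : ℂ) ∉ (fun x : ℝ => (x : ℂ)) '' Ici 0 := by
  rw [← Complex.ofReal_neg, Complex.ofReal_injective.mem_set_image]
  exact (neg_lt_zero.2 hy).not_ge

theorem ofReal_div_add (c x y : ℝ) : ((c / (x + y) : ℝ) : ℂ) = -((c : ℂ) / (-y - x)) := by
  rw [← neg_add', div_neg, neg_neg, add_comm (y : ℂ)]
  norm_cast

theorem ofReal_stieltjes (a : ℝ → ℝ) (P : ℝ[X]) (y : ℝ) :
    (stieltjes a P y : ℂ) = -cauchy (fun x => (P.eval x * a x : ℝ)) (-y) := by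
  rw [stieltjes, cauchy, ← integral_complex_ofReal, ← integral_neg]
  congr with x
  rw [ofReal_div_add]

namespace IsCauchyPair

theorem eval_mul_eq_zero_of_notMem_Ici (h : IsCauchyPair α β) (P : ℝ[X]) :
    ∀ᵐ x : ℝ, x ∉ Ici 0 → ((P.eval x * α x : ℝ) : ℂ) = 0 :=
  ae_of_all _ fun x hx => by
    rw [h.left.eq_zero x (not_le.1 hx).le, mul_zero, Complex.ofReal_zero]

theorem integrable_div_add (h : IsCauchyPair α β) (P : ℝ[X]) {y : ℝ} (hy : 0 < y) :
    Integrable fun x => P.eval x * α x / (x + y) := by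
  have hC : Integrable fun x => ((P.eval x * α x / (x + y) : ℝ) : ℂ) := by
    simp only [ofReal_div_add]
    exact (integrable_div_sub_of_notMem (h.integrable_eval_mul P).ofReal isClosed_Ici
      (h.eval_mul_eq_zero_of_notMem_Ici P) (neg_ofReal_notMem_image_Ici hy)).neg
  simpa only [RCLike.re_eq_complex_re, Complex.ofReal_re] using hC.re

theorem continuousOn_stieltjes (h : IsCauchyPair α β) (P : ℝ[X]) :
    ContinuousOn (stieltjes α P) (Ioi 0) := by
  intro y hy
  have hC : ContinuousAt (cauchy fun x => ((P.eval x * α x : ℝ) : ℂ)) (-y) :=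
    (differentiableAt_cauchy (h.integrable_eval_mul P).ofReal isClosed_Ici
      (h.eval_mul_eq_zero_of_notMem_Ici P) (neg_ofReal_notMem_image_Ici hy)).continuousAt
  have hneg : ContinuousAt (fun y : ℝ => (-y : ℂ)) y := by fun_prop
  have hre : stieltjes α P
      = fun y : ℝ => (-cauchy (fun x => ((P.eval x * α x : ℝ) : ℂ)) (-y)).re := by
    ext y
    rw [← ofReal_stieltjes, Complex.ofReal_re]
  rw [hre]
  exact (Complex.continuous_re.continuousAt.comp
    (ContinuousAt.comp (f := fun y : ℝ => (-y : ℂ)) hC hneg).neg).continuousWithinAt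

theorem integral_pairing_slice (a b : ℝ → ℝ) (p q : ℝ[X]) (y : ℝ) :
    ∫ x, p.eval x * q.eval y / (x + y) * (a x * b y) = stieltjes a p y * q.eval y * b y := by
  rw [stieltjes, mul_assoc, ← integral_mul_const]
  congr with x
  ring

theorem pairing_eq_integral_stieltjes (h : IsCauchyPair α β) (p q : ℝ[X]) :
    pairing α β p q = ∫ y, stieltjes α p y * q.eval y * β y := by
  rw [pairing, Measure.volume_eq_prod, integral_prod_symm _ (h.integrable_pairing p q)]
  exact integral_congr_ae (ae_of_all _ (integral_pairing_slice α β p q))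

theorem integrable_stieltjes_mul (h : IsCauchyPair α β) (p q : ℝ[X]) :
    Integrable fun y => stieltjes α p y * q.eval y * β y :=
  (Measure.volume_eq_prod ℝ ℝ ▸ h.integrable_pairing p q :
    Integrable _ ((volume : Measure ℝ).prod volume)).integral_prod_right.congr
    (ae_of_all _ (integral_pairing_slice α β p q))

end IsCauchyPair

end Stieltjes

section SignChanges

variable {f : ℝ → ℝ} {J : Set ℝ}

theorem exists_sign_of_forall_ne_zero (hJ : J.OrdConnected) (hf : ContinuousOn f J)
    (hne : ∀ y ∈ J, f y ≠ 0) : ∃ σ : ℝ, (σ = 1 ∨ σ = -1) ∧ ∀ y ∈ J, 0 ≤ σ * f y := by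
  by_cases hpos : ∀ y ∈ J, 0 ≤ f y
  · exact ⟨1, Or.inl rfl, fun y hy => by simpa only [one_mul] using hpos y hy⟩
  push Not at hpos
  obtain ⟨a, ha, hfa⟩ := hpos
  refine ⟨-1, Or.inr rfl, fun b hb => ?_⟩
  by_contra! hfb
  obtain ⟨c, hc, hc0⟩ := hJ.isPreconnected.intermediate_value ha hb hf
    (⟨hfa.le, by linarith⟩ : (0 : ℝ) ∈ Icc (f a) (f b))
  exact hne c hc hc0

theorem exists_sign_mul_prod_of_lt_of_gt {m σ τ : ℝ} {S : Finset ℝ} (hS : ∀ s ∈ S, s < m)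
    (hm : f m = 0) (hσ : σ = 1 ∨ σ = -1) (hτ : τ = 1 ∨ τ = -1)
    (hlt : ∀ y ∈ J, y < m → 0 ≤ σ * f y * ∏ s ∈ S, (y - s))
    (hgt : ∀ y ∈ J, m < y → 0 ≤ τ * f y) :
    ∃ T ⊆ insert m S, ∀ y ∈ J, 0 ≤ τ * f y * ∏ s ∈ T, (y - s) := by
  have hprod : ∀ y, m < y → 0 ≤ ∏ s ∈ S, (y - s) := fun y hy =>
    Finset.prod_nonneg fun s hs => by linarith [hS s hs]
  have hcase : τ = σ ∨ τ = -σ := by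
    rcases hσ with rfl | rfl <;> rcases hτ with rfl | rfl <;> norm_num
  rcases hcase with rfl | rfl
  · refine ⟨S, Finset.subset_insert _ _, fun y hy => ?_⟩
    rcases lt_trichotomy y m with hy' | rfl | hy'
    · exact hlt y hy hy'
    · simp only [hm, mul_zero, zero_mul, le_refl]
    · exact mul_nonneg (hgt y hy hy') (hprod y hy')
  · refine ⟨insert m S, le_rfl, fun y hy => ?_⟩
    rw [Finset.prod_insert fun hmS => (hS m hmS).false]
    rcases lt_trichotomy y m with hy' | rfl | hy'
    · rw [show -σ * f y * ((y - m) * ∏ s ∈ S, (y - s))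
        = (m - y) * (σ * f y * ∏ s ∈ S, (y - s)) by ring]
      exact mul_nonneg (sub_nonneg.2 hy'.le) (hlt y hy hy')
    · simp only [hm, mul_zero, zero_mul, le_refl]
    · exact mul_nonneg (hgt y hy hy') (mul_nonneg (sub_nonneg.2 hy'.le) (hprod y hy'))

theorem exists_sign_mul_prod_nonneg (Z : Finset ℝ) : ∀ {J : Set ℝ}, J.OrdConnected →
    ContinuousOn f J → (∀ y, y ∈ Z ↔ y ∈ J ∧ f y = 0) →
    ∃ S ⊆ Z, ∃ σ : ℝ, (σ = 1 ∨ σ = -1) ∧ ∀ y ∈ J, 0 ≤ σ * f y * ∏ s ∈ S, (y - s) := by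
  induction Z using Finset.induction_on_max with
  | empty =>
    intro J hJ hf hZ
    obtain ⟨σ, hσ, hpos⟩ := exists_sign_of_forall_ne_zero hJ hf fun y hy h0 =>
      Finset.notMem_empty y ((hZ y).2 ⟨hy, h0⟩)
    exact ⟨∅, le_rfl, σ, hσ, by simpa only [Finset.prod_empty, mul_one] using hpos⟩
  | insert m Z hm ih =>
    intro J hJ hf hZ
    have hZm : ∀ y, y ∈ J → f y = 0 → y = m ∨ y ∈ Z := fun y hy h0 =>
      Finset.mem_insert.1 ((hZ y).2 ⟨hy, h0⟩)
    obtain ⟨S, hS, σ, hσ, hlt⟩ := ih (hJ.inter ordConnected_Iio)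
      (hf.mono (inter_subset_left (t := Iio m))) fun y =>
        ⟨fun hy => ⟨⟨((hZ y).1 (Finset.mem_insert_of_mem hy)).1, hm y hy⟩,
          ((hZ y).1 (Finset.mem_insert_of_mem hy)).2⟩,
        fun hy => (hZm y hy.1.1 hy.2).resolve_left (ne_of_lt hy.1.2)⟩
    obtain ⟨τ, hτ, hgt⟩ := exists_sign_of_forall_ne_zero (hJ.inter ordConnected_Ioi)
      (hf.mono (inter_subset_left (t := Ioi m))) fun y hy h0 => by
        rcases hZm y hy.1 h0 with hym | hyZ
        exacts [hy.2.ne' hym, (hm y hyZ).not_gt hy.2]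
    obtain ⟨T, hT, hpos⟩ := exists_sign_mul_prod_of_lt_of_gt (fun s hs => hm s (hS hs))
      ((hZ m).1 (Finset.mem_insert_self _ _)).2 hσ hτ (fun y hy hym => hlt y ⟨hy, hym⟩)
      fun y hy hym => hgt y ⟨hy, hym⟩
    exact ⟨T, hT.trans (Finset.insert_subset_insert m hS), τ, hτ, hpos⟩

end SignChanges

section Interpolation

theorem sum_nodalWeight_mul_inv_sub_mul_eval {F ι : Type*} [Field F] [DecidableEq ι] {s : Finset ι}
    {v : ι → F} (hv : InjOn v s) {R : F[X]} (hR : R.degree < s.card) {x : F}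
    (hx : ∀ i ∈ s, x ≠ v i) :
    ∑ i ∈ s, Lagrange.nodalWeight s v i * (x - v i)⁻¹ * R.eval (v i)
      = R.eval x / ∏ i ∈ s, (x - v i) := by
  have hne : ∏ i ∈ s, (x - v i) ≠ 0 :=
    Finset.prod_ne_zero_iff.2 fun i hi => sub_ne_zero.2 (hx i hi)
  rw [eq_div_iff hne, mul_comm, ← Lagrange.eval_nodal, ← Lagrange.eval_interpolate_not_at_node _ hx,
    ← Lagrange.eq_interpolate hv hR]

theorem eventually_atTop_eval_pos {P : ℝ[X]} (hP : P.Monic) : ∀ᶠ y in atTop, 0 < P.eval y := by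
  obtain ⟨u, hu, heq⟩ := P.isEquivalent_atTop_lead.exists_eq_mul
  filter_upwards [heq, hu.eventually (lt_mem_nhds zero_lt_one), eventually_gt_atTop 0]
    with y hy hu hy0
  rw [hy, Pi.mul_apply, hP.leadingCoeff, one_mul]
  exact mul_pos hu (pow_pos hy0 _)

end Interpolation

section Zeros

variable {P : ℝ[X]} {T : Finset ℝ}

/-- The coefficient of `stieltjes a P t` when `P² / ∏ (x + t)` is split into partial fractions. -/
noncomputable def residue (P : ℝ[X]) (T : Finset ℝ) (t : ℝ) : ℝ :=
  P.eval (-t) / ∏ u ∈ T.erase t, (u - t)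

theorem sum_residue_div_add (hP : P.degree < T.card) {x : ℝ} (hx : ∀ t ∈ T, x + t ≠ 0) :
    ∑ t ∈ T, residue P T t / (x + t) = P.eval x / ∏ t ∈ T, (x + t) := by
  have hpart := sum_nodalWeight_mul_inv_sub_mul_eval (s := T) (v := fun t => -t) (R := P) (x := x)
    neg_injective.injOn hP fun t ht h0 => hx t ht (by linarith)
  simp only [sub_neg_eq_add] at hpart
  rw [← hpart]
  refine Finset.sum_congr rfl fun t _ => ?_
  rw [Lagrange.nodalWeight, Finset.prod_inv_distrib, residue]
  simp only [sub_neg_eq_add, neg_add_eq_sub]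
  ring

namespace IsCauchyPair

theorem eval_mul_eval_div_prod_mul (h : IsCauchyPair α β) (hT : ∀ t ∈ T, 0 < t)
    (hP : P.degree < T.card) (x : ℝ) :
    P.eval x * P.eval x / (∏ t ∈ T, (x + t)) * α x
      = ∑ t ∈ T, residue P T t * (P.eval x * α x / (x + t)) := by
  by_cases hx : α x = 0
  · simp only [hx, mul_zero, zero_div, Finset.sum_const_zero]
  have hx0 := h.left.pos_of_ne_zero hx
  rw [mul_div_assoc, ← sum_residue_div_add hP fun t ht => (add_pos hx0 (hT t ht)).ne',
    Finset.mul_sum, Finset.sum_mul]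
  exact Finset.sum_congr rfl fun t _ => by ring

theorem sum_residue_mul_stieltjes_pos (h : IsCauchyPair α β) (hP0 : P ≠ 0)
    (hT : ∀ t ∈ T, 0 < t) (hP : P.degree < T.card) :
    0 < ∑ t ∈ T, residue P T t * stieltjes α P t := by
  have hi : ∀ t ∈ T, Integrable fun x => residue P T t * (P.eval x * α x / (x + t)) :=
    fun t ht => (h.integrable_div_add P (hT t ht)).const_mul _
  have hprod : ∀ x, 0 < x → 0 < ∏ t ∈ T, (x + t) := fun x hx =>
    Finset.prod_pos fun t ht => add_pos hx (hT t ht)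
  simp only [stieltjes, ← integral_const_mul]
  rw [← integral_finsetSum _ hi]
  simp only [← h.eval_mul_eval_div_prod_mul hT hP]
  refine h.left.integral_mul_pos (fun x hx => div_nonneg (mul_self_nonneg _) (hprod x hx).le) ?_ ?_
  · refine P.roots.toFinset.finite_toSet.subset ?_
    rintro x ⟨hx, h0⟩
    rw [div_eq_zero_iff, mul_self_eq_zero, or_iff_left (hprod x hx).ne'] at h0
    simpa [hP0] using h0
  · simp only [h.eval_mul_eval_div_prod_mul hT hP]
    exact integrable_finsetSum _ hi

theorem card_le_natDegree_of_stieltjes_eq_zero (h : IsCauchyPair α β) (hP : P ≠ 0)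
    (hT : ∀ t ∈ T, 0 < t ∧ stieltjes α P t = 0) : T.card ≤ P.natDegree := by
  by_contra! hlt
  have hpos := h.sum_residue_mul_stieltjes_pos hP (fun t ht => (hT t ht).1)
    ((natDegree_lt_iff_degree_lt hP).1 hlt)
  rw [Finset.sum_eq_zero fun t ht => by rw [(hT t ht).2, mul_zero]] at hpos
  exact hpos.false

theorem finite_zeros_stieltjes (h : IsCauchyPair α β) (hP : P ≠ 0) :
    {t | 0 < t ∧ stieltjes α P t = 0}.Finite := by
  by_contra hinf
  obtain ⟨T, hT, hcard⟩ := Set.Infinite.exists_subset_card_eq hinf (P.natDegree + 1)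
  have hle := h.card_le_natDegree_of_stieltjes_eq_zero hP (T := T) fun t ht => hT ht
  omega

theorem eventually_stieltjes_pos (h : IsCauchyPair α β) (hP : P.Monic)
    (hT : ∀ t ∈ T, 0 < t ∧ stieltjes α P t = 0) (hcard : T.card = P.natDegree) :
    ∀ᶠ y in atTop, 0 < stieltjes α P y := by
  filter_upwards [eventually_atTop_eval_pos hP.neg_one_pow_natDegree_mul_comp_neg_X,
    eventually_gt_atTop 0, (T.eventually_all).2 fun t _ => eventually_gt_atTop t] with y hev hy hyT
  have hyT' : y ∉ T := fun hy => (hyT y hy).false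
  have hpos := h.sum_residue_mul_stieltjes_pos (T := insert y T) hP.ne_zero
    (fun t ht => (Finset.mem_insert.1 ht).elim (fun hty => hty ▸ hy) fun ht => (hT t ht).1)
    (by rw [Finset.card_insert_of_notMem hyT', hcard, degree_eq_natDegree hP.ne_zero]
        exact_mod_cast P.natDegree.lt_succ_self)
  rw [Finset.sum_insert hyT', Finset.sum_eq_zero fun t ht => by rw [(hT t ht).2, mul_zero],
    add_zero] at hpos
  refine (pos_iff_pos_of_mul_pos hpos).1 ?_
  have hprod : ∏ u ∈ T, (u - y) = (-1) ^ P.natDegree * ∏ u ∈ T, (y - u) := by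
    rw [← hcard, ← Finset.prod_const, ← Finset.prod_mul_distrib]
    exact Finset.prod_congr rfl fun u _ => by ring
  have hsq : ((-1 : ℝ) ^ P.natDegree)⁻¹ = (-1) ^ P.natDegree := by rw [← inv_pow, inv_neg_one]
  rw [residue, Finset.erase_insert hyT', hprod, ← div_div, div_eq_mul_inv (P.eval _), hsq]
  simp only [eval_mul, eval_pow, eval_neg, eval_one, eval_comp, eval_X] at hev
  exact div_pos (by rwa [mul_comm]) (Finset.prod_pos fun u hu => sub_pos.2 (hyT u hu))

end IsCauchyPair

end Zeros

section Existence

variable {P Q : ℝ[X]} {n : ℕ}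

namespace IsCauchyPair

theorem pairing_nodal_pos (h : IsCauchyPair α β) (hP : P ≠ 0) {S : Finset ℝ} {σ : ℝ} (hσ : σ ≠ 0)
    (hS : ∀ y, 0 < y → 0 ≤ σ * stieltjes α P y * ∏ s ∈ S, (y - s)) :
    0 < σ * pairing α β P (Lagrange.nodal S id) := by
  have hint : ∀ y, σ * (stieltjes α P y * (Lagrange.nodal S id).eval y * β y)
      = σ * stieltjes α P y * (∏ s ∈ S, (y - s)) * β y := fun y => by
    simp only [Lagrange.eval_nodal, id]
    ring
  rw [h.pairing_eq_integral_stieltjes, ← integral_const_mul]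
  simp only [hint]
  refine h.right.integral_mul_pos hS ?_ ?_
  · refine ((h.finite_zeros_stieltjes hP).union S.finite_toSet).subset ?_
    rintro y ⟨hy, h0⟩
    rcases mul_eq_zero.1 h0 with h0 | h0
    · exact Or.inl ⟨hy, (mul_eq_zero.1 h0).resolve_left hσ⟩
    · obtain ⟨s, hs, hs0⟩ := Finset.prod_eq_zero_iff.1 h0
      exact Or.inr (sub_eq_zero.1 hs0 ▸ hs)
  · simpa only [hint] using (h.integrable_stieltjes_mul P (Lagrange.nodal S id)).const_mul σ

theorem exists_pairing_nodal_pos (h : IsCauchyPair α β) (hP : P ≠ 0) :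
    ∃ S : Finset ℝ, (∀ s ∈ S, 0 < s ∧ stieltjes α P s = 0) ∧ S.card ≤ P.natDegree ∧
      ∃ σ : ℝ, (σ = 1 ∨ σ = -1) ∧
        (∀ y, 0 < y → 0 ≤ σ * stieltjes α P y * ∏ s ∈ S, (y - s)) ∧
        0 < σ * pairing α β P (Lagrange.nodal S id) := by
  have hfin := h.finite_zeros_stieltjes hP
  obtain ⟨S, hS, σ, hσ, hpos⟩ := exists_sign_mul_prod_nonneg hfin.toFinset ordConnected_Ioi
    (h.continuousOn_stieltjes P) fun y => by simp only [Finite.mem_toFinset, mem_ofPred_eq, mem_Ioi]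
  have hzero : ∀ s ∈ S, 0 < s ∧ stieltjes α P s = 0 := fun s hs => hfin.mem_toFinset.1 (hS hs)
  have hσ0 : σ ≠ 0 := by rcases hσ with rfl | rfl <;> norm_num
  exact ⟨S, hzero, h.card_le_natDegree_of_stieltjes_eq_zero hP hzero, σ, hσ, hpos,
    h.pairing_nodal_pos hP hσ0 hpos⟩

theorem eq_zero_of_forall_pairing_eq_zero (h : IsCauchyPair α β)
    (hP : ∀ q : ℝ[X], q.degree ≤ P.degree → pairing α β P q = 0) : P = 0 := by
  by_contra hne
  obtain ⟨S, -, hcard, σ, -, -, hpos⟩ := h.exists_pairing_nodal_pos hne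
  rw [hP, mul_zero] at hpos
  · exact hpos.false
  · rw [Lagrange.degree_nodal, degree_eq_natDegree hne]
    exact_mod_cast hcard

theorem exists_monic_orthogonal (h : IsCauchyPair α β) (n : ℕ) :
    ∃ P : ℝ[X], P.Monic ∧ P.natDegree = n ∧ ∀ q : ℝ[X], q.degree < n → pairing α β P q = 0 := by
  have hfin : FiniteDimensional ℝ (degreeLT ℝ n) := (degreeLTEquiv ℝ n).symm.finiteDimensional
  let B : degreeLT ℝ n →ₗ[ℝ] Module.Dual ℝ (degreeLT ℝ n) :=
    h.bilinPairing.domRestrict₁₂ (degreeLT ℝ n) (degreeLT ℝ n)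
  have hinj : Function.Injective B := by
    rw [← LinearMap.ker_eq_bot, LinearMap.ker_eq_bot']
    rintro ⟨P, hP⟩ h0
    refine Subtype.ext (h.eq_zero_of_forall_pairing_eq_zero fun q hq => ?_)
    exact LinearMap.congr_fun h0 ⟨q, mem_degreeLT.2 (hq.trans_lt (mem_degreeLT.1 hP))⟩
  have hsurj : Function.Surjective B :=
    (LinearMap.injective_iff_surjective_of_finrank_eq_finrank
      (Subspace.dual_finrank_eq (K := ℝ) (V := degreeLT ℝ n)).symm).1 hinj
  obtain ⟨⟨r, hr⟩, hrB⟩ := hsurj ((h.bilinPairing (X ^ n)).domRestrict (degreeLT ℝ n))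
  rw [mem_degreeLT] at hr
  refine ⟨X ^ n - r, monic_X_pow_sub hr, natDegree_eq_of_degree_eq_some ?_, fun q hq => ?_⟩
  · rw [degree_sub_eq_left_of_degree_lt (by rwa [degree_X_pow]), degree_X_pow]
  · have heq : h.bilinPairing r q = h.bilinPairing (X ^ n) q :=
      LinearMap.congr_fun hrB ⟨q, mem_degreeLT.2 hq⟩
    change h.bilinPairing (X ^ n - r) q = 0
    rw [map_sub, LinearMap.sub_apply, heq, sub_self]

theorem pairing_eq_of_monic (h : IsCauchyPair α β)
    (hP : ∀ q : ℝ[X], q.degree < n → pairing α β P q = 0) {R : ℝ[X]} (hQ : Q.Monic)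
    (hQn : Q.natDegree = n) (hR : R.Monic) (hRn : R.natDegree = n) :
    pairing α β P Q = pairing α β P R := by
  have hdeg : (Q - R).degree < n := by
    have hlt := degree_sub_lt_left (p := Q) (q := R)
      (by rw [degree_eq_natDegree hQ.ne_zero, degree_eq_natDegree hR.ne_zero, hQn, hRn])
      hQ.ne_zero (by rw [hQ.leadingCoeff, hR.leadingCoeff])
    rwa [degree_eq_natDegree hQ.ne_zero, hQn] at hlt
  rw [← sub_add_cancel Q R, h.pairing_add_right, hP _ hdeg, zero_add]

theorem pairing_pos_of_monic (h : IsCauchyPair α β) (hP : P.Monic) (hPn : P.natDegree = n)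
    (horth : ∀ q : ℝ[X], q.degree < n → pairing α β P q = 0) (hQ : Q.Monic)
    (hQn : Q.natDegree = n) : 0 < pairing α β P Q := by
  obtain ⟨S, hS, hcard, σ, hσ, hsign, hpos⟩ := h.exists_pairing_nodal_pos hP.ne_zero
  have hSn : S.card = P.natDegree := by
    refine hcard.antisymm (not_lt.1 fun hlt => ?_)
    rw [horth _ (by rw [Lagrange.degree_nodal]; exact_mod_cast hPn ▸ hlt), mul_zero] at hpos
    exact hpos.false
  rw [h.pairing_eq_of_monic horth hQ hQn (Lagrange.nodal_monic (s := S) (v := id))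
    (by rw [Lagrange.natDegree_nodal, hSn, hPn])]
  obtain ⟨y, hy, hy0, hyS⟩ := ((h.eventually_stieltjes_pos hP hS hSn).and
    ((eventually_gt_atTop 0).and (S.eventually_all.2 fun s _ => eventually_gt_atTop s))).exists
  have hprod : 0 < ∏ s ∈ S, (y - s) := Finset.prod_pos fun s hs => sub_pos.2 (hyS s hs)
  rcases hσ with rfl | rfl
  · rwa [one_mul] at hpos
  · exact absurd (hsign y hy0) (by rw [neg_one_mul, neg_mul]; linarith [mul_pos hy hprod])

theorem exists_isCauchyBOP (h : IsCauchyPair α β) : ∃ p q : ℕ → ℝ[X], IsCauchyBOP α β p q := by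
  choose P hPm hPn hP using h.exists_monic_orthogonal
  choose Q hQm hQn hQ using h.symm.exists_monic_orthogonal
  have hpos : ∀ n, 0 < pairing α β (P n) (Q n) := fun n =>
    h.pairing_pos_of_monic (hPm n) (hPn n) (hP n) (hQm n) (hQn n)
  set c : ℕ → ℝ := fun n => (√(pairing α β (P n) (Q n)))⁻¹ with hc
  have hc0 : ∀ n, 0 < c n := fun n => inv_pos.2 (Real.sqrt_pos.2 (hpos n))
  refine ⟨fun n => C (c n) * P n, fun n => C (c n) * Q n, fun j => ?_, fun j => ?_, fun j => ?_,
    fun j => ?_, fun j k => ?_⟩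
  · rw [natDegree_C_mul (hc0 j).ne', hPn]
  · rw [natDegree_C_mul (hc0 j).ne', hQn]
  · rw [leadingCoeff_mul, leadingCoeff_mul, (hPm j).leadingCoeff, (hQm j).leadingCoeff]
  · rw [leadingCoeff_mul, leadingCoeff_C, (hPm j).leadingCoeff, mul_one]
    exact hc0 j
  · rw [h.setIntegral_setIntegral_eq_pairing, pairing_C_mul_left, pairing_C_mul_right]
    rcases lt_trichotomy j k with hlt | rfl | hgt
    · rw [if_neg hlt.ne, pairing_comm, hQ k, mul_zero, mul_zero]
      rw [degree_eq_natDegree (hPm j).ne_zero, hPn]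
      exact_mod_cast hlt
    · rw [if_pos rfl, ← mul_assoc, hc, ← mul_inv, Real.mul_self_sqrt (hpos j).le,
        inv_mul_cancel₀ (hpos j).ne']
    · rw [if_neg hgt.ne', hP j, mul_zero, mul_zero]
      rw [degree_eq_natDegree (hQm k).ne_zero, hQn]
      exact_mod_cast hgt

end IsCauchyPair

end Existence

section Supports

theorem isClosed_supp (a : ℝ → ℝ) : IsClosed (supp a) := Measure.isClosed_support

theorem ae_eq_zero_of_notMem_supp {a : ℝ → ℝ} (hm : Measurable a) (hn : ∀ x, 0 ≤ a x) :
    ∀ᵐ s : ℝ, s ∉ supp a → a s = 0 := by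
  have hmem : ∀ᵐ s ∂(volume.withDensity fun x => ENNReal.ofReal (a x)), s ∈ supp a :=
    Measure.support_mem_ae
  rw [ae_withDensity_iff (by fun_prop)] at hmem
  filter_upwards [hmem] with s hs hns
  by_contra h0
  exact hns (hs (ENNReal.ofReal_pos.2 (lt_of_le_of_ne (hn s) (Ne.symm h0))).ne')

theorem isOpen_dom (α β : ℝ → ℝ) : IsOpen (dom α β) :=
  (isClosed_image_ofReal ((isClosed_supp α).union (isClosed_supp (star β)))).isOpen_compl

theorem im_ne_zero_subset_dom (α β : ℝ → ℝ) : {z : ℂ | z.im ≠ 0} ⊆ dom α β :=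
  fun _ hz => notMem_image_ofReal_of_im_ne_zero hz

theorem notMem_image_supp_left {z : ℂ} (hz : z ∈ dom α β) :
    z ∉ (fun x : ℝ => (x : ℂ)) '' supp α :=
  fun hs => hz (image_mono subset_union_left hs)

theorem notMem_image_supp_right {z : ℂ} (hz : z ∈ dom α β) :
    z ∉ (fun x : ℝ => (x : ℂ)) '' supp (star β) :=
  fun hs => hz (image_mono subset_union_right hs)

theorem eqOn_zero_dom_of_forall_im_ne_zero {f : ℂ → ℂ} (hf : ContinuousOn f (dom α β))
    (h0 : ∀ z : ℂ, z.im ≠ 0 → f z = 0) : EqOn f 0 (dom α β) := by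
  intro z hz
  by_cases him : z.im = 0
  · have hlim : Tendsto (fun ε : ℝ => f (z + ε * I)) (𝓝[>] 0) (𝓝 (f z)) := by
      have hcont : Continuous fun ε : ℝ => z + ε * I := by fun_prop
      refine (hf.continuousAt ((isOpen_dom α β).mem_nhds hz)).tendsto.comp ?_
      simpa using (hcont.tendsto 0).mono_left nhdsWithin_le_nhds
    refine tendsto_nhds_unique hlim (tendsto_const_nhds.congr' ?_)
    filter_upwards [self_mem_nhdsWithin] with ε hε
    exact (h0 _ (by simpa [him] using ne_of_gt hε)).symm
  · exact h0 z him

end Supports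

section Densities

/-- The density `P α`, whose Cauchy transform is `P⁽¹⁾`. -/
noncomputable def dens₁ (α : ℝ → ℝ) (P : ℂ[X]) (s : ℝ) : ℂ := P.eval (s : ℂ) * α s

/-- The density `(c + C[P α]) β⋆`, where `C` is the Cauchy transform. -/
noncomputable def dens₂ (α β : ℝ → ℝ) (P : ℂ[X]) (c : ℂ) (s : ℝ) : ℂ :=
  (c + cauchy (dens₁ α P) s) * star β s

/-- The Cauchy pairing of a complex polynomial with `y ^ k`. -/
noncomputable def pairPow (α β : ℝ → ℝ) (P : ℂ[X]) (k : ℕ) : ℂ :=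
  ∫ s : ℝ × ℝ, P.eval (s.1 : ℂ) * s.2 ^ k / (s.1 + s.2) * (α s.1 * β s.2)

theorem dens₁_zero (α : ℝ → ℝ) : dens₁ α 0 = 0 := by
  funext s
  rw [dens₁, eval_zero, zero_mul, Pi.zero_apply]

theorem IsWeight.dens₁_eq_zero (hα : IsWeight α) (P : ℂ[X]) {s : ℝ} (hs : s ≤ 0) :
    dens₁ α P s = 0 := by
  rw [dens₁, hα.eq_zero s hs, Complex.ofReal_zero, mul_zero]

theorem IsWeight.star_eq_zero {a : ℝ → ℝ} (ha : IsWeight a) {s : ℝ} (hs : 0 ≤ s) :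
    star a s = 0 :=
  ha.eq_zero _ (neg_nonpos.2 hs)

theorem IsWeight.ae_dens₁_eq_zero (hα : IsWeight α) (P : ℂ[X]) :
    ∀ᵐ s : ℝ, s ∉ supp α → dens₁ α P s = 0 := by
  filter_upwards [ae_eq_zero_of_notMem_supp hα.measurable hα.nonneg] with s hs hns
  rw [dens₁, hs hns, Complex.ofReal_zero, mul_zero]

theorem IsWeight.ae_dens₂_eq_zero (hβ : IsWeight β) (P : ℂ[X]) (c : ℂ) :
    ∀ᵐ s : ℝ, s ∉ supp (star β) → dens₂ α β P c s = 0 := by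
  filter_upwards [ae_eq_zero_of_notMem_supp (hβ.measurable.comp measurable_neg)
    fun x => hβ.nonneg (-x)] with s hs hns
  rw [dens₂, show star β s = 0 from hs hns, Complex.ofReal_zero, mul_zero]

theorem integral_pairPow_slice (P : ℂ[X]) (k : ℕ) (s : ℝ) :
    (∫ x : ℝ, P.eval (x : ℂ) * ((-s : ℝ) : ℂ) ^ k / (x + (-s : ℝ)) * (α x * β (-s)))
      = (-1) ^ (k + 1) * ((s : ℂ) ^ k * (cauchy (dens₁ α P) s * star β s)) := by
  rw [cauchy, mul_comm (integral _ _), ← mul_assoc, ← mul_assoc, ← integral_const_mul]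
  congr with x
  rw [dens₁, star, Complex.ofReal_neg, ← sub_eq_add_neg, ← neg_sub (s : ℂ) x, div_neg, neg_pow]
  ring

theorem integral_pow_mul_star (β : ℝ → ℝ) (k : ℕ) :
    ∫ s : ℝ, (s : ℂ) ^ k * star β s = (-1) ^ k * ∫ y : ℝ, (y : ℂ) ^ k * β y := by
  rw [← integral_neg_eq_self, ← integral_const_mul]
  congr with y
  rw [star, neg_neg, Complex.ofReal_neg, neg_pow]
  ring

namespace IsCauchyPair

theorem integrable_pow_mul_dens₁ (h : IsCauchyPair α β) (P : ℂ[X]) (k : ℕ) :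
    Integrable fun s : ℝ => (s : ℂ) ^ k * dens₁ α P s := by
  simp_rw [dens₁, eval_eq_sum_range, Finset.sum_mul, Finset.mul_sum]
  refine integrable_finsetSum _ fun i _ => ?_
  refine ((h.integrable_moment (k + i)).ofReal.const_mul (P.coeff i)).congr
    (ae_of_all _ fun s => ?_)
  simp only [Complex.coe_algebraMap]
  push_cast
  ring

theorem integrable_dens₁ (h : IsCauchyPair α β) (P : ℂ[X]) : Integrable (dens₁ α P) := by
  simpa only [pow_zero, one_mul] using h.integrable_pow_mul_dens₁ P 0

theorem integrable_left (h : IsCauchyPair α β) : Integrable α := by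
  simpa only [pow_zero, one_mul] using h.integrable_moment 0

theorem integrable_pow_mul_star (h : IsCauchyPair α β) (k : ℕ) :
    Integrable fun s : ℝ => (s : ℂ) ^ k * (star β s : ℂ) := by
  refine ((h.symm.integrable_moment k).ofReal.const_mul ((-1 : ℂ) ^ k)).comp_neg.congr
    (ae_of_all _ fun s => ?_)
  simp only [star, Complex.coe_algebraMap]
  push_cast
  rw [← mul_assoc, ← mul_pow, neg_one_mul, neg_neg]

theorem integrable_star (h : IsCauchyPair α β) : Integrable (star β) :=
  h.symm.integrable_left.comp_neg

theorem integrable_pairPow (h : IsCauchyPair α β) (P : ℂ[X]) (k : ℕ) :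
    Integrable fun s : ℝ × ℝ => P.eval (s.1 : ℂ) * s.2 ^ k / (s.1 + s.2) * (α s.1 * β s.2) := by
  simp_rw [eval_eq_sum_range, Finset.sum_mul, Finset.sum_div, Finset.sum_mul]
  refine integrable_finsetSum _ fun i _ => ?_
  refine ((h.integrable_bimoment i k).ofReal.const_mul (P.coeff i)).congr
    (ae_of_all _ fun s => ?_)
  simp only [Complex.coe_algebraMap]
  push_cast
  ring

theorem integrable_pow_mul_cauchy_mul_star (h : IsCauchyPair α β) (P : ℂ[X]) (k : ℕ) :
    Integrable fun s : ℝ => (s : ℂ) ^ k * (cauchy (dens₁ α P) s * star β s) := by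
  have hslice := ((Measure.volume_eq_prod ℝ ℝ ▸ h.integrable_pairPow P k :
    Integrable _ ((volume : Measure ℝ).prod volume)).integral_prod_right.comp_neg).const_mul
      ((-1 : ℂ) ^ (k + 1))
  simp_rw [integral_pairPow_slice, ← mul_assoc, ← mul_pow, neg_one_mul, neg_neg, one_pow, one_mul]
    at hslice
  simpa only [mul_assoc] using hslice

theorem integrable_pow_mul_dens₂ (h : IsCauchyPair α β) (P : ℂ[X]) (c : ℂ) (k : ℕ) :
    Integrable fun s : ℝ => (s : ℂ) ^ k * dens₂ α β P c s := by
  refine ((h.integrable_pow_mul_cauchy_mul_star P k).add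
    ((h.integrable_pow_mul_star k).const_mul c)).congr (ae_of_all _ fun s => ?_)
  simp only [Pi.add_apply, dens₂]
  ring

theorem integrable_dens₂ (h : IsCauchyPair α β) (P : ℂ[X]) (c : ℂ) :
    Integrable (dens₂ α β P c) := by
  simpa only [pow_zero, one_mul] using h.integrable_pow_mul_dens₂ P c 0

theorem pairPow_eq_integral (h : IsCauchyPair α β) (P : ℂ[X]) (k : ℕ) :
    pairPow α β P k
      = (-1) ^ (k + 1) * ∫ s : ℝ, (s : ℂ) ^ k * (cauchy (dens₁ α P) s * star β s) := by
  rw [pairPow, Measure.volume_eq_prod,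
    integral_prod_symm _ (Measure.volume_eq_prod ℝ ℝ ▸ h.integrable_pairPow P k),
    ← integral_neg_eq_self, ← integral_const_mul]
  simp_rw [integral_pairPow_slice]

theorem integral_pow_mul_dens₂ (h : IsCauchyPair α β) (P : ℂ[X]) (c : ℂ) (k : ℕ) :
    ∫ s : ℝ, (s : ℂ) ^ k * dens₂ α β P c s
      = (-1) ^ k * (c * (∫ y : ℝ, (y : ℂ) ^ k * β y) - pairPow α β P k) := by
  have hsplit : ∀ s : ℝ, (s : ℂ) ^ k * dens₂ α β P c s
      = c * ((s : ℂ) ^ k * star β s) + (s : ℂ) ^ k * (cauchy (dens₁ α P) s * star β s) := by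
    intro s; rw [dens₂]; ring
  simp_rw [hsplit]
  rw [integral_add ((h.integrable_pow_mul_star k).const_mul c)
      (h.integrable_pow_mul_cauchy_mul_star P k), integral_const_mul, integral_pow_mul_star,
    h.pairPow_eq_integral]
  have hsign : (-1 : ℂ) ^ k * (-1) ^ k = 1 := by rw [← mul_pow]; norm_num
  linear_combination
    -(∫ s : ℝ, (s : ℂ) ^ k * (cauchy (dens₁ α P) s * star β s)) * hsign

end IsCauchyPair

end Densities

section Rows

/-- The row `(P, c + C[P α], d + C[(c + C[P α]) β⋆])`, where `C` is the Cauchy transform: the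
general solution of the jump relation with polynomial first entry and moderate growth. -/
noncomputable def row (α β : ℝ → ℝ) (P : ℂ[X]) (c d : ℂ) (z : ℂ) : Fin 3 → ℂ :=
  ![P.eval z, c + cauchy (dens₁ α P) z, d + cauchy (dens₂ α β P c) z]

theorem IsCauchyPair.differentiableOn_row (h : IsCauchyPair α β) (P : ℂ[X]) (c d : ℂ) (j : Fin 3) :
    DifferentiableOn ℂ (fun z => row α β P c d z j) (dom α β) := by
  intro z hz
  refine DifferentiableAt.differentiableWithinAt ?_
  fin_cases j
  · exact P.differentiable z
  · exact (differentiableAt_cauchy (h.integrable_dens₁ P) (isClosed_supp α)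
      (h.left.ae_dens₁_eq_zero P) (notMem_image_supp_left hz)).const_add c
  · exact (differentiableAt_cauchy (h.integrable_dens₂ P c) (isClosed_supp (star β))
      (h.right.ae_dens₂_eq_zero P c) (notMem_image_supp_right hz)).const_add d

theorem vecMul_jump (α β : ℝ → ℝ) (v : Fin 3 → ℂ) (x : ℝ) :
    Matrix.vecMul v (jump α β x) = ![v 0, v 0 * (-2 * Real.pi * I * α x) + v 1,
      v 1 * (-2 * Real.pi * I * star β x) + v 2] := by
  funext j
  fin_cases j <;> simp [jump, Matrix.vecMul, dotProduct, Fin.sum_univ_three]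

/-- The row vector `g` satisfies `g₊ = g₋ V` on the real line in the vague sense. -/
def HasJump (α β : ℝ → ℝ) (g : ℂ → Fin 3 → ℂ) : Prop :=
  ∀ j, VagueNull fun ε x =>
    (g (x + ε * I) - Matrix.vecMul (g (x - ε * I)) (jump α β x)) j

theorem HasJump.add {g g' : ℂ → Fin 3 → ℂ} (hg : HasJump α β g) (hg' : HasJump α β g') :
    HasJump α β (g + g') := fun j => ((hg j).add (hg' j)).congr fun ε _ x => by
  simp only [Pi.add_apply, Pi.sub_apply, Matrix.add_vecMul]
  ring

theorem HasJump.const_smul {g : ℂ → Fin 3 → ℂ} (hg : HasJump α β g) (k : ℂ) :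
    HasJump α β (k • g) := fun j => ((hg j).const_mul k).congr fun ε _ x => by
  simp only [Pi.sub_apply, Pi.smul_apply, Matrix.smul_vecMul, smul_eq_mul]
  ring

theorem HasJump.sub {g g' : ℂ → Fin 3 → ℂ} (hg : HasJump α β g) (hg' : HasJump α β g') :
    HasJump α β (g - g') := by
  rw [sub_eq_add_neg, ← neg_one_smul ℂ g']
  exact hg.add (hg'.const_smul _)

theorem vagueNull_continuous_boundaryValue_mul {F : ℂ → ℂ} {b : ℝ → ℂ} (hF : Continuous F)
    (hb : LocallyIntegrable b) : VagueNull fun ε x => F (x - ε * I) * b x - F x * b x := by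
  have hcont : Continuous fun p : ℝ × ℝ => ‖F (p.1 - p.2 * I)‖ := by fun_prop
  have hsup : Continuous fun x : ℝ => sSup ((fun ε : ℝ => ‖F (x - ε * I)‖) '' Icc 0 1) :=
    isCompact_Icc.continuous_sSup hcont
  refine vagueNull_boundaryValue_mul hF.continuousOn (fun _ _ => hF.continuousAt) hb
    (LocallyIntegrable.continuous_mul hsup fun x => (hb x).norm) fun ε hε x => ?_
  rw [norm_mul]
  gcongr
  refine le_csSup (isCompact_Icc.bddAbove_image ?_) ⟨ε, Ioo_subset_Icc_self hε, rfl⟩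
  exact Continuous.continuousOn (by fun_prop)

theorem noJump_of_continuous {F : ℂ → ℂ} (hF : Continuous F) : NoJump F := by
  have hbelow := vagueNull_continuous_boundaryValue_mul hF (locallyIntegrable_const 1)
  have habove := vagueNull_continuous_boundaryValue_mul (hF.comp Complex.continuous_conj)
    (locallyIntegrable_const 1)
  refine (habove.add (hbelow.const_mul (-1))).congr fun ε _ x => ?_
  simp only [Function.comp_apply, map_sub, map_mul, Complex.conj_ofReal, Complex.conj_I,
    mul_neg, sub_neg_eq_add]
  ring

theorem IsWeight.le_abs_sub (hα : IsWeight α) {P : ℂ[X]} {x s : ℝ} (hs : dens₁ α P s ≠ 0) :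
    -x ≤ |x - s| := by
  have hpos : 0 < s := not_le.1 fun h0 => hs (hα.dens₁_eq_zero P h0)
  linarith [neg_abs_le (x - s)]

theorem IsWeight.continuousAt_cauchy_dens₁ (hα : IsWeight α) {P : ℂ[X]}
    (hi : Integrable (dens₁ α P)) {x : ℝ} (hx : x < 0) :
    ContinuousAt (cauchy (dens₁ α P)) x := by
  refine (differentiableAt_cauchy hi (isClosed_Ici (a := (0 : ℝ)))
    (ae_of_all _ fun s hs => hα.dens₁_eq_zero P (not_le.1 hs).le) ?_).continuousAt
  rw [Complex.ofReal_injective.mem_set_image]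
  exact not_le.2 hx

theorem IsWeight.norm_cauchy_dens₁_le (hα : IsWeight α) {P : ℂ[X]} (hi : Integrable (dens₁ α P))
    {x : ℝ} (hx : x < 0) (ε : ℝ) :
    ‖cauchy (dens₁ α P) (x - ε * I)‖ ≤ ∫ s : ℝ, ‖dens₁ α P s‖ / |x - s| := by
  have hnorm : ∀ s : ℝ, ‖(x : ℂ) - s‖ = |x - s| := fun s => by
    rw [← Complex.ofReal_sub, Complex.norm_real, Real.norm_eq_abs]
  refine norm_integral_le_of_norm_le ?_ (ae_of_all _ fun s => ?_)
  · refine (integrable_div_sub_of_le (z := x) hi (neg_pos.2 hx)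
      (ae_of_all _ fun s hs => ?_)).norm.congr (ae_of_all _ fun s => ?_)
    · exact (hα.le_abs_sub hs).trans_eq (hnorm s).symm
    · simp only [norm_div, hnorm]
  · by_cases hs : dens₁ α P s = 0
    · simp only [hs, zero_div, norm_zero, le_refl]
    · have hre : |x - s| ≤ ‖(x : ℂ) - ε * I - s‖ := by
        simpa using Complex.abs_re_le_norm ((x : ℂ) - ε * I - s)
      have hpos : 0 < |x - s| := (neg_pos.2 hx).trans_le (hα.le_abs_sub hs)
      rw [norm_div]
      gcongr

namespace IsCauchyPair

theorem integrable_norm_slice (h : IsCauchyPair α β) (P : ℂ[X]) :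
    Integrable fun x : ℝ => (∫ s : ℝ, ‖dens₁ α P s‖ / |x - s|) * star β x := by
  refine (Measure.volume_eq_prod ℝ ℝ ▸ (h.integrable_pairPow P 0).norm :
    Integrable _ ((volume : Measure ℝ).prod volume)).integral_prod_right.comp_neg.congr
    (ae_of_all _ fun x => ?_)
  simp only
  rw [← integral_mul_const]
  congr with s
  have hnorm : ‖(s : ℂ) + ((-x : ℝ) : ℂ)‖ = |x - s| := by
    rw [← Complex.ofReal_add, Complex.norm_real, Real.norm_eq_abs, abs_sub_comm, sub_eq_add_neg]
  simp only [norm_mul, norm_div, hnorm, pow_zero, mul_one, dens₁, star, Complex.norm_real,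
    Real.norm_of_nonneg (h.right.nonneg (-x))]
  ring

theorem vagueNull_cauchy_mul_star (h : IsCauchyPair α β) (P : ℂ[X]) (c : ℂ) :
    VagueNull fun ε x => (c + cauchy (dens₁ α P) (x - ε * I)) * star β x - dens₂ α β P c x := by
  have hi := h.integrable_dens₁ P
  have hneg : ∀ {x : ℝ}, (star β x : ℂ) ≠ 0 → x < 0 := fun hx => not_le.1 fun h0 =>
    hx (by rw [h.right.star_eq_zero h0, Complex.ofReal_zero])
  refine vagueNull_boundaryValue_mul (F := fun z => c + cauchy (dens₁ α P) z)
    (b := fun x => (star β x : ℂ))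
    (D := fun x => ‖c‖ * star β x + (∫ s : ℝ, ‖dens₁ α P s‖ / |x - s|) * star β x)
    (continuousOn_const.add (continuousOn_cauchy hi))
    (fun x hx => continuousAt_const.add (h.left.continuousAt_cauchy_dens₁ hi (hneg hx)))
    h.integrable_star.ofReal.locallyIntegrable
    ((h.integrable_star.const_mul _).add (h.integrable_norm_slice P)).locallyIntegrable
    fun ε _ x => ?_
  by_cases hx : (star β x : ℂ) = 0
  · simp [Complex.ofReal_eq_zero.1 hx]
  · have hnonneg : 0 ≤ star β x := h.right.nonneg (-x)
    rw [norm_mul, Complex.norm_real, Real.norm_of_nonneg hnonneg, ← add_mul]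
    gcongr
    exact (norm_add_le _ _).trans (by gcongr; exact h.left.norm_cauchy_dens₁_le hi (hneg hx) ε)

theorem hasJump_row (h : IsCauchyPair α β) (P : ℂ[X]) (c d : ℂ) :
    HasJump α β (row α β P c d) := by
  have heval := vagueNull_continuous_boundaryValue_mul P.continuous
    h.integrable_left.ofReal.locallyIntegrable
  intro j
  simp_rw [vecMul_jump]
  fin_cases j
  · exact noJump_of_continuous P.continuous
  · refine ((vagueNull_cauchy_sub_cauchy_add (h.integrable_dens₁ P)).add
      (heval.const_mul (2 * Real.pi * I))).congr fun ε _ x => ?_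
    simp [row, dens₁]
    ring
  · refine ((vagueNull_cauchy_sub_cauchy_add (h.integrable_dens₂ P c)).add
      ((h.vagueNull_cauchy_mul_star P c).const_mul (2 * Real.pi * I))).congr fun ε _ x => ?_
    simp [row]
    ring

theorem locallyIntegrable_sub_vecMul_jump (h : IsCauchyPair α β) {g : ℂ → Fin 3 → ℂ}
    (hg : ∀ j, ContinuousOn (fun z => g z j) {z | z.im ≠ 0}) {ε : ℝ} (hε : 0 < ε) (j : Fin 3) :
    LocallyIntegrable fun x : ℝ =>
      (g (x + ε * I) - Matrix.vecMul (g (x - ε * I)) (jump α β x)) j := by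
  have habove := fun j => (continuous_horizontal (hg j) hε.ne').locallyIntegrable (μ := volume)
  have hbelow := fun j => (continuous_horizontal_sub (hg j) hε.ne').locallyIntegrable (μ := volume)
  have hmul : ∀ (j) {a : ℝ → ℝ}, Integrable a →
      LocallyIntegrable fun x : ℝ => g (x - ε * I) j * (-2 * Real.pi * I * a x) := fun j _ ha =>
    (ha.ofReal.const_mul _).locallyIntegrable.continuous_mul
      (continuous_horizontal_sub (hg j) hε.ne')
  simp_rw [vecMul_jump]
  fin_cases j
  · exact (habove 0).sub (hbelow 0)
  · exact (habove 1).sub ((hmul 0 h.integrable_left).add (hbelow 1))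
  · exact (habove 2).sub ((hmul 1 h.integrable_star).add (hbelow 2))

end IsCauchyPair

end Rows

section Growth

theorem norm_zpow_mul_growth {z : ℂ} (hz : z ≠ 0) (k l : ℤ) :
    ‖z ^ k‖ * growth l z = growth (k + l) z := by
  rw [growth, growth, ← mul_assoc, norm_zpow, zpow_add₀ (norm_ne_zero_iff.2 hz)]

theorem isBigO_zpow_mul {f : ℂ → ℂ} {l : ℤ} (hf : f =O[offReal] growth l) (k : ℤ) :
    (fun z => z ^ k * f z) =O[offReal] growth (k + l) := by
  refine ((Asymptotics.isBigO_refl (fun z : ℂ => z ^ k) offReal).norm_right.mul hf).congr'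
    EventuallyEq.rfl ?_
  filter_upwards [eventually_offReal_norm_ge 1] with z hz
  exact norm_zpow_mul_growth (norm_pos_iff.1 (one_pos.trans_le hz)) k l

theorem isBigO_growth_growth {k l : ℤ} (hkl : k ≤ l) : growth k =O[offReal] growth l := by
  refine Asymptotics.IsBigO.of_norm_eventuallyLE ?_
  filter_upwards [eventually_offReal_norm_ge 1] with z hz
  rw [Real.norm_of_nonneg (growth_nonneg k z), growth, growth]
  gcongr

theorem NoJump.eq_zero {f : ℂ → ℂ} (hj : NoJump f) (hf : DifferentiableOn ℂ f {z | z.im ≠ 0})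
    (hO : f =O[offReal] growth (-1)) {z : ℂ} (hz : z.im ≠ 0) : f z = 0 := by
  obtain ⟨P, hP, hfP⟩ := hj.exists_polynomial hf (m := 0) (by simpa using hO)
  rw [hfP z hz, degree_eq_bot.1 (Nat.WithBot.lt_zero_iff.1 hP), eval_zero]

theorem eq_zero_of_isBigO_growth_neg_one {c : ℂ}
    (hc : (fun _ => c) =O[offReal] growth (-1)) : c = 0 :=
  (noJump_of_continuous continuous_const).eq_zero (differentiableOn_const c) hc
    (z := I) (by simp)

theorem moment_eq_zero_of_isBigO {h : ℝ → ℂ}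
    (hi : ∀ k : ℕ, Integrable fun s : ℝ => (s : ℂ) ^ k * h s) {n : ℕ}
    (hO : cauchy h =O[offReal] growth (-n - 1)) {k : ℕ} (hk : k < n) :
    ∫ s : ℝ, (s : ℂ) ^ k * h s = 0 := by
  induction k using Nat.strong_induction_on with
  | _ k ih =>
    have hi' : ∀ j : ℕ, Integrable fun s : ℝ => (s : ℂ) ^ j * ((s : ℂ) ^ (k + 1) * h s) :=
      fun j => (hi (j + (k + 1))).congr (ae_of_all _ fun s => by ring)
    have hmain : (fun z => z ^ ((k + 1 : ℕ) : ℤ) * cauchy h z) =O[offReal] growth (-1) :=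
      (isBigO_zpow_mul hO _).trans (isBigO_growth_growth (by push_cast; omega))
    have hrem : cauchy (fun s : ℝ => (s : ℂ) ^ (k + 1) * h s) =O[offReal] growth (-1) :=
      isBigO_cauchy (hi (k + 1)) (by simpa only [pow_one] using hi' 1)
    refine eq_zero_of_isBigO_growth_neg_one ((hmain.sub hrem).congr' ?_ EventuallyEq.rfl)
    filter_upwards [eventually_offReal_im_ne_zero] with z hz
    have hpow := pow_mul_cauchy hi hz fun j hj => ih j hj (hj.trans hk)
    have hmul := mul_cauchy (hi k) (integrable_div_sub (hi k) hz)
    rw [zpow_natCast, pow_succ', mul_assoc, hpow, hmul]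
    simp only [pow_succ', mul_assoc, add_sub_cancel_right]

end Growth

section ComplexPairing

theorem pairPow_map_algebraMap (A : ℝ[X]) (k : ℕ) :
    pairPow α β (A.map (algebraMap ℝ ℂ)) k = pairing α β A (X ^ k) := by
  rw [pairPow, pairing, ← integral_complex_ofReal]
  congr with s
  rw [eval_map_algebraMap, show aeval (s.1 : ℂ) A = (A.eval s.1 : ℝ) from aeval_ofReal A s.1,
    eval_pow, eval_X]
  push_cast
  rfl

theorem pairPow_smul (c : ℂ) (P : ℂ[X]) (k : ℕ) :
    pairPow α β (c • P) k = c * pairPow α β P k := by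
  rw [pairPow, pairPow, ← integral_const_mul]
  congr with s
  rw [eval_smul, smul_eq_mul]
  ring

theorem exists_re_im_polynomial {n : ℕ} {P : ℂ[X]} (hP : P.degree < n) :
    ∃ A B : ℝ[X], A.degree < n ∧ B.degree < n ∧
      P = A.map (algebraMap ℝ ℂ) + I • B.map (algebraMap ℝ ℂ) := by
  refine ⟨ofFn n fun i => (P.coeff i).re, ofFn n fun i => (P.coeff i).im,
    ofFn_degree_lt _, ofFn_degree_lt _, ?_⟩
  ext k
  rw [coeff_add, coeff_smul, smul_eq_mul, coeff_map, coeff_map]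
  rcases lt_or_ge k n with hk | hk
  · rw [ofFn_coeff_eq_val_of_lt _ hk, ofFn_coeff_eq_val_of_lt _ hk, Complex.coe_algebraMap,
      mul_comm, Complex.re_add_im]
  · rw [ofFn_coeff_eq_zero_of_ge _ hk, ofFn_coeff_eq_zero_of_ge _ hk, map_zero, mul_zero, add_zero,
      coeff_eq_zero_of_degree_lt (hP.trans_le (by exact_mod_cast hk))]

namespace IsCauchyPair

theorem pairPow_add (h : IsCauchyPair α β) (P Q : ℂ[X]) (k : ℕ) :
    pairPow α β (P + Q) k = pairPow α β P k + pairPow α β Q k := by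
  rw [pairPow, pairPow, pairPow,
    ← integral_add (h.integrable_pairPow P k) (h.integrable_pairPow Q k)]
  congr with s
  rw [eval_add]
  ring

theorem eq_zero_of_pairing_pow_eq_zero (h : IsCauchyPair α β) {n : ℕ} {A : ℝ[X]}
    (hA : A.degree < n) (h0 : ∀ k < n, pairing α β A (X ^ k) = 0) : A = 0 := by
  refine h.eq_zero_of_forall_pairing_eq_zero fun q hq => ?_
  have hqn : q ∈ degreeLT ℝ n := mem_degreeLT.2 (hq.trans_lt hA)
  rw [degreeLT_eq_span_X_pow] at hqn
  have hker : Submodule.span ℝ _ ≤ LinearMap.ker (h.bilinPairing A) :=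
    Submodule.span_le.2 fun _ hp => by
      obtain ⟨k, hk, rfl⟩ := Finset.mem_image.1 (Finset.mem_coe.1 hp)
      exact LinearMap.mem_ker.2 (h0 k (Finset.mem_range.1 hk))
  exact LinearMap.mem_ker.1 (hker hqn)

theorem eq_zero_of_pairPow_eq_zero (h : IsCauchyPair α β) {n : ℕ} {P : ℂ[X]} (hP : P.degree < n)
    (h0 : ∀ k < n, pairPow α β P k = 0) : P = 0 := by
  obtain ⟨A, B, hA, hB, rfl⟩ := exists_re_im_polynomial hP
  have hpair : ∀ k < n, (pairing α β A (X ^ k) : ℂ) + I * pairing α β B (X ^ k) = 0 := by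
    intro k hk
    rw [← pairPow_map_algebraMap, ← pairPow_map_algebraMap, ← pairPow_smul, ← h.pairPow_add]
    exact h0 k hk
  rw [h.eq_zero_of_pairing_pow_eq_zero hA fun k hk => by
      simpa using congrArg Complex.re (hpair k hk),
    h.eq_zero_of_pairing_pow_eq_zero hB fun k hk => by
      simpa using congrArg Complex.im (hpair k hk)]
  simp only [Polynomial.map_zero, smul_zero, add_zero]

theorem isBigO_cauchy_dens₁ (h : IsCauchyPair α β) (P : ℂ[X]) :
    cauchy (dens₁ α P) =O[offReal] growth (-1) :=
  isBigO_cauchy (h.integrable_dens₁ P)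
    (by simpa only [pow_one] using h.integrable_pow_mul_dens₁ P 1)

theorem isBigO_cauchy_dens₂ (h : IsCauchyPair α β) (P : ℂ[X]) (c : ℂ) :
    cauchy (dens₂ α β P c) =O[offReal] growth (-1) :=
  isBigO_cauchy (h.integrable_dens₂ P c)
    (by simpa only [pow_one] using h.integrable_pow_mul_dens₂ P c 1)

end IsCauchyPair

end ComplexPairing

section Uniqueness

/-- The exponents of the normalisation `diag(z ^ n, 1, z ^ (-n))` at infinity. -/
def exponent (n : ℕ) : Fin 3 → ℤ := ![n, 0, -n]

theorem zpow_exponent (n : ℕ) (z : ℂ) :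
    (fun j => z ^ exponent n j) = ![z ^ n, 1, (z ^ n)⁻¹] := by
  funext j
  fin_cases j <;> simp [exponent]

/-- A row of the Riemann–Hilbert problem of index `n` that behaves like
`(v + O(1/z)) diag(z ^ n, 1, z ^ (-n))` at infinity; the rows of a solution are those whose `v` are
the unit vectors. -/
structure IsRow (α β : ℝ → ℝ) (n : ℕ) (v : Fin 3 → ℂ) (g : ℂ → Fin 3 → ℂ) : Prop where
  differentiableOn : ∀ j, DifferentiableOn ℂ (fun z => g z j) (dom α β)
  hasJump : HasJump α β g
  asymptotic : ∀ j, (fun z => g z j - v j * z ^ exponent n j)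
    =O[offReal] growth (exponent n j - 1)

theorem HasJump.eq_zero {g : ℂ → Fin 3 → ℂ} (hg : HasJump α β g)
    (hd : ∀ j, DifferentiableOn ℂ (fun z => g z j) {z | z.im ≠ 0})
    (hO : ∀ j, (fun z => g z j) =O[offReal] growth (-1)) {z : ℂ} (hz : z.im ≠ 0) : g z = 0 := by
  have hbelow : ∀ {ε : ℝ} (x : ℝ), ε > 0 → ((x : ℂ) - ε * I).im ≠ 0 := fun x hε => by
    simpa using ne_of_gt hε
  have h0 : ∀ {z : ℂ}, z.im ≠ 0 → g z 0 = 0 := NoJump.eq_zero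
    ((hg 0).congr fun ε _ x => by simp [vecMul_jump]) (hd 0) (hO 0)
  have h1 : ∀ {z : ℂ}, z.im ≠ 0 → g z 1 = 0 := NoJump.eq_zero
    ((hg 1).congr fun ε hε x => by simp [vecMul_jump, h0 (hbelow x hε)]) (hd 1) (hO 1)
  have h2 : ∀ {z : ℂ}, z.im ≠ 0 → g z 2 = 0 := NoJump.eq_zero
    ((hg 2).congr fun ε hε x => by simp [vecMul_jump, h1 (hbelow x hε)]) (hd 2) (hO 2)
  funext j
  fin_cases j
  exacts [h0 hz, h1 hz, h2 hz]

theorem row_zero (α β : ℝ → ℝ) : row α β 0 0 0 = 0 := by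
  have hcauchy : cauchy 0 = 0 := by
    funext z
    simp only [cauchy, Pi.zero_apply, zero_div, integral_zero]
  have hdens₂ : dens₂ α β 0 0 = 0 := by
    funext s
    rw [dens₂, dens₁_zero, hcauchy, Pi.zero_apply, add_zero, zero_mul, Pi.zero_apply]
  funext z j
  fin_cases j <;> simp [row, dens₁_zero, hdens₂, hcauchy]

namespace IsRow

variable {n : ℕ} {v v' : Fin 3 → ℂ} {g g' : ℂ → Fin 3 → ℂ}

theorem add (hg : IsRow α β n v g) (hg' : IsRow α β n v' g') :
    IsRow α β n (v + v') (g + g') where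
  differentiableOn j := (hg.differentiableOn j).add (hg'.differentiableOn j)
  hasJump := hg.hasJump.add hg'.hasJump
  asymptotic j := ((hg.asymptotic j).add (hg'.asymptotic j)).congr_left fun z => by
    simp only [Pi.add_apply]
    ring

theorem const_smul (hg : IsRow α β n v g) (k : ℂ) : IsRow α β n (k • v) (k • g) where
  differentiableOn j := (hg.differentiableOn j).const_mul k
  hasJump := hg.hasJump.const_smul k
  asymptotic j := ((hg.asymptotic j).const_mul_left k).congr_left fun z => by
    simp only [Pi.smul_apply, smul_eq_mul]
    ring

theorem sub (hg : IsRow α β n v g) (hg' : IsRow α β n v' g') :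
    IsRow α β n (v - v') (g - g') := by
  rw [sub_eq_add_neg, sub_eq_add_neg, ← neg_one_smul ℂ v', ← neg_one_smul ℂ g']
  exact hg.add (hg'.const_smul _)

theorem exists_eq_row (h : IsCauchyPair α β) (hg : IsRow α β n 0 g) :
    ∃ P : ℂ[X], P.degree < n ∧ ∀ z : ℂ, z.im ≠ 0 → g z = row α β P 0 0 z := by
  have hsub := im_ne_zero_subset_dom α β
  have hO : ∀ j, (fun z => g z j) =O[offReal] growth (exponent n j - 1) := fun j => by
    simpa only [Pi.zero_apply, zero_mul, sub_zero] using hg.asymptotic j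
  obtain ⟨P, hP, hgP⟩ := NoJump.exists_polynomial (f := fun z => g z 0)
    ((hg.hasJump 0).congr fun ε _ x => by simp [vecMul_jump])
    ((hg.differentiableOn 0).mono hsub) (hO 0)
  refine ⟨P, hP, fun z hz => sub_eq_zero.1 ?_⟩
  refine HasJump.eq_zero (g := g - row α β P 0 0) (hg.hasJump.sub (h.hasJump_row P 0 0))
    (fun j => ((hg.differentiableOn j).sub (h.differentiableOn_row P 0 0 j)).mono hsub)
    (fun j => ?_) hz
  fin_cases j
  · refine (Asymptotics.isBigO_zero (E' := ℂ) _ _).congr' ?_ EventuallyEq.rfl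
    filter_upwards [eventually_offReal_im_ne_zero] with z hz
    exact (sub_eq_zero.2 (hgP z hz)).symm
  · exact ((hO 1).trans (isBigO_growth_growth (by simp [exponent]))).sub
      (by simpa [row] using h.isBigO_cauchy_dens₁ P)
  · exact ((hO 2).trans (isBigO_growth_growth (by simp [exponent]))).sub
      (by simpa [row] using h.isBigO_cauchy_dens₂ P 0)

theorem eqOn_zero (h : IsCauchyPair α β) (hg : IsRow α β n 0 g) : EqOn g 0 (dom α β) := by
  obtain ⟨P, hP, hgP⟩ := hg.exists_eq_row h
  have hO : cauchy (dens₂ α β P 0) =O[offReal] growth (-n - 1) := by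
    refine (hg.asymptotic 2).congr' ?_ EventuallyEq.rfl
    filter_upwards [eventually_offReal_im_ne_zero] with z hz
    simp [hgP z hz, row]
  have hpair : ∀ k < n, pairPow α β P k = 0 := fun k hk => by
    have hmoment := moment_eq_zero_of_isBigO (h.integrable_pow_mul_dens₂ P 0) hO hk
    rw [h.integral_pow_mul_dens₂] at hmoment
    simpa using hmoment
  have hoff : ∀ z : ℂ, z.im ≠ 0 → g z = 0 := fun z hz => by
    rw [hgP z hz, h.eq_zero_of_pairPow_eq_zero hP hpair, row_zero, Pi.zero_apply]
  intro z hz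
  funext j
  exact eqOn_zero_dom_of_forall_im_ne_zero (hg.differentiableOn j).continuousOn
    (fun z hz => congrFun (hoff z hz) j) hz

theorem eqOn (h : IsCauchyPair α β) (hg : IsRow α β n v g) (hg' : IsRow α β n v g') :
    EqOn g g' (dom α β) := fun _ hz =>
  sub_eq_zero.1 (eqOn_zero h (by simpa only [sub_self] using hg.sub hg') hz)

end IsRow

end Uniqueness

section Solutions

variable {n : ℕ} {G : ℂ → Matrix (Fin 3) (Fin 3) ℂ}

theorem IsRHPSolution.isRow (h : IsCauchyPair α β) (hG : IsRHPSolution α β n G) (i : Fin 3) :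
    IsRow α β n ((1 : Matrix (Fin 3) (Fin 3) ℂ) i) fun z => G z i where
  differentiableOn j := (hG.analytic i j).differentiableOn
  hasJump j := ⟨fun ε hε => h.locallyIntegrable_sub_vecMul_jump (fun j =>
    (hG.analytic i j).continuousOn.mono (im_ne_zero_subset_dom α β)) hε j,
    fun φ hφ hc => hG.jump_rel φ hφ hc i j⟩
  asymptotic j := by
    obtain ⟨C, R, E, -, hE⟩ := hG.asymptotic
    have hEO : (fun z => E z i j) =O[offReal] growth (-1) := by
      refine Asymptotics.IsBigO.of_bound C (eventually_offReal_iff.2 ⟨R, fun z hz him => ?_⟩)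
      rw [Real.norm_of_nonneg (growth_nonneg _ z), growth, zpow_neg_one, ← mul_assoc]
      exact (hE z hz him).2 i j
    refine (isBigO_zpow_mul hEO (exponent n j)).congr' ?_ (by rw [← sub_eq_add_neg])
    refine eventually_offReal_iff.2 ⟨R, fun z hz him => ?_⟩
    simp only [(hE z hz him).1, ← zpow_exponent, Matrix.mul_diagonal, Matrix.add_apply]
    ring

theorem isRHPSolution_of_isRow
    (hG : ∀ i, IsRow α β n ((1 : Matrix (Fin 3) (Fin 3) ℂ) i) fun z => G z i) :
    IsRHPSolution α β n G where
  analytic i j := ((hG i).differentiableOn j).analyticOnNhd (isOpen_dom α β)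
  jump_rel φ hφ hc i j := ((hG i).hasJump j).tendsto φ hφ hc
  asymptotic := by
    let E : ℂ → Fin 3 → Fin 3 → ℂ := fun z i j =>
      z ^ (-exponent n j) * (G z i j - (1 : Matrix (Fin 3) (Fin 3) ℂ) i j * z ^ exponent n j)
    have hO : E =O[offReal] growth (-1) := Asymptotics.isBigO_pi.2 fun i =>
      Asymptotics.isBigO_pi.2 fun j => by
        have hij := isBigO_zpow_mul ((hG i).asymptotic j) (-exponent n j)
        rwa [show -exponent n j + (exponent n j - 1) = -1 by ring] at hij
    obtain ⟨C, hC⟩ := hO.bound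
    obtain ⟨R, hR⟩ := eventually_offReal_iff.1 hC
    refine ⟨C, max R 1, fun z => Matrix.of (E z), lt_max_of_lt_right one_pos,
      fun z hz him => ⟨?_, fun i j => ?_⟩⟩
    · have hz0 : z ≠ 0 := fun h0 => him (by rw [h0, Complex.zero_im])
      ext i j
      rw [← zpow_exponent, Matrix.mul_diagonal, Matrix.add_apply]
      simp only [E, zpow_neg, Matrix.of_apply]
      have hzj := zpow_ne_zero (exponent n j) hz0
      field_simp
      ring
    · have hbound := hR z ((le_max_left R 1).trans hz) him
      rw [Real.norm_of_nonneg (growth_nonneg _ z), growth, zpow_neg_one, ← mul_assoc,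
        ← div_eq_mul_inv] at hbound
      exact ((norm_le_pi_norm (E z i) j).trans (norm_le_pi_norm (E z) i)).trans hbound

theorem IsRHPSolution.eqOn (h : IsCauchyPair α β) {G' : ℂ → Matrix (Fin 3) (Fin 3) ℂ}
    (hG : IsRHPSolution α β n G) (hG' : IsRHPSolution α β n G') : EqOn G G' (dom α β) :=
  fun _ hz => funext fun i => (hG.isRow h i).eqOn h (hG'.isRow h i) hz

end Solutions

section Reflection

theorem star_star (a : ℝ → ℝ) : star (star a) = a := by
  funext x
  rw [star, star, neg_neg]

theorem withDensity_star_preimage_neg (a : ℝ → ℝ) (U : Set ℝ) :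
    volume.withDensity (fun x => ENNReal.ofReal (star a x)) (Neg.neg ⁻¹' U)
      = volume.withDensity (fun x => ENNReal.ofReal (a x)) U := by
  rw [withDensity_apply' _ _, withDensity_apply' _ _]
  exact (Measure.measurePreserving_neg volume).setLIntegral_comp_preimage_emb
    (Homeomorph.neg ℝ).measurableEmbedding (fun x => ENNReal.ofReal (a x)) U

theorem neg_mem_supp_of_mem_supp_star {a : ℝ → ℝ} {x : ℝ} (hx : x ∈ supp (star a)) :
    -x ∈ supp a := by
  rw [supp, Measure.mem_support_iff_forall] at hx ⊢
  intro U hU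
  rw [← withDensity_star_preimage_neg]
  exact hx _ (continuous_neg.continuousAt.preimage_mem_nhds hU)

theorem mem_dom_of_neg_mem_dom {w : ℂ} (hw : -w ∈ dom α β) : w ∈ dom β α := by
  rintro ⟨x, hx, rfl⟩
  refine hw ⟨-x, hx.symm.imp neg_mem_supp_of_mem_supp_star fun hβ => ?_, Complex.ofReal_neg x⟩
  exact neg_mem_supp_of_mem_supp_star (by rwa [star_star])

end Reflection

section RowAlgebra

theorem dens₁_add (P P' : ℂ[X]) : dens₁ α (P + P') = dens₁ α P + dens₁ α P' := by
  funext s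
  simp only [dens₁, eval_add, add_mul, Pi.add_apply]

theorem dens₁_smul (k : ℂ) (P : ℂ[X]) : dens₁ α (k • P) = k • dens₁ α P := by
  funext s
  simp only [dens₁, eval_smul, smul_eq_mul, Pi.smul_apply, mul_assoc]

theorem dens₁_X_mul (P : ℂ[X]) : dens₁ α (X * P) = fun s : ℝ => (s : ℂ) * dens₁ α P s := by
  funext s
  rw [dens₁, dens₁, eval_mul, eval_X, mul_assoc]

theorem dens₂_smul (k : ℂ) (P : ℂ[X]) (c : ℂ) :
    dens₂ α β (k • P) (k * c) = k • dens₂ α β P c := by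
  funext s
  simp only [dens₂, dens₁_smul, cauchy_const_smul, Pi.smul_apply, smul_eq_mul]
  ring

theorem row_smul (k : ℂ) (P : ℂ[X]) (c d z : ℂ) :
    row α β (k • P) (k * c) (k * d) z = k • row α β P c d z := by
  simp only [row, dens₁_smul, dens₂_smul, cauchy_const_smul, eval_smul, Matrix.smul_vec3,
    smul_eq_mul, mul_add]

namespace IsCauchyPair

theorem integrable_dens₁_div (h : IsCauchyPair α β) (P : ℂ[X]) {z : ℂ} (hz : z ∈ dom α β) :
    Integrable fun s : ℝ => dens₁ α P s / (z - s) :=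
  integrable_div_sub_of_notMem (h.integrable_dens₁ P) (isClosed_supp α)
    (h.left.ae_dens₁_eq_zero P) (notMem_image_supp_left hz)

theorem integrable_dens₂_div (h : IsCauchyPair α β) (P : ℂ[X]) (c : ℂ) {z : ℂ}
    (hz : z ∈ dom α β) : Integrable fun s : ℝ => dens₂ α β P c s / (z - s) :=
  integrable_div_sub_of_notMem (h.integrable_dens₂ P c) (isClosed_supp (star β))
    (h.right.ae_dens₂_eq_zero P c) (notMem_image_supp_right hz)

theorem integrable_dens₁_div_of_neg (h : IsCauchyPair α β) (P : ℂ[X]) {x : ℝ} (hx : x < 0) :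
    Integrable fun s : ℝ => dens₁ α P s / ((x : ℂ) - s) := by
  refine integrable_div_sub_of_notMem (h.integrable_dens₁ P) isClosed_Ici
    (ae_of_all _ fun s hs => h.left.dens₁_eq_zero P (not_le.1 hs).le) ?_
  rw [Complex.ofReal_injective.mem_set_image]
  exact not_le.2 hx

theorem dens₂_add (h : IsCauchyPair α β) (P P' : ℂ[X]) (c c' : ℂ) :
    dens₂ α β (P + P') (c + c') = dens₂ α β P c + dens₂ α β P' c' := by
  funext s
  rw [Pi.add_apply, dens₂, dens₂, dens₂]
  rcases le_or_gt 0 s with hs | hs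
  · rw [h.right.star_eq_zero hs, Complex.ofReal_zero, mul_zero, mul_zero, mul_zero, add_zero]
  · rw [dens₁_add, cauchy_add (h.integrable_dens₁_div_of_neg P hs)
      (h.integrable_dens₁_div_of_neg P' hs)]
    ring

theorem dens₂_X_mul (h : IsCauchyPair α β) (P : ℂ[X]) :
    dens₂ α β (X * P) (∫ s, dens₁ α P s) = fun s : ℝ => (s : ℂ) * dens₂ α β P 0 s := by
  funext s
  rw [dens₂, dens₂]
  rcases le_or_gt 0 s with hs | hs
  · rw [h.right.star_eq_zero hs, Complex.ofReal_zero, mul_zero, mul_zero, mul_zero]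
  · rw [dens₁_X_mul, zero_add, ← mul_assoc,
      mul_cauchy (h.integrable_dens₁ P) (h.integrable_dens₁_div_of_neg P hs)]

theorem row_add (h : IsCauchyPair α β) (P P' : ℂ[X]) (c c' d d' : ℂ) {z : ℂ} (hz : z ∈ dom α β) :
    row α β (P + P') (c + c') (d + d') z = row α β P c d z + row α β P' c' d' z := by
  rw [row, row, row, Matrix.vec3_add, dens₁_add, h.dens₂_add, eval_add,
    cauchy_add (h.integrable_dens₁_div P hz) (h.integrable_dens₁_div P' hz),
    cauchy_add (h.integrable_dens₂_div P c hz) (h.integrable_dens₂_div P' c' hz),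
    add_add_add_comm, add_add_add_comm d]

theorem row_X_mul (h : IsCauchyPair α β) (P : ℂ[X]) {z : ℂ} (hz : z ∈ dom α β) :
    row α β (X * P) (∫ s, dens₁ α P s) (∫ s, dens₂ α β P 0 s) z = z • row α β P 0 0 z := by
  rw [row, row, Matrix.smul_vec3, dens₁_X_mul, h.dens₂_X_mul, eval_mul, eval_X, zero_add, zero_add,
    smul_eq_mul, smul_eq_mul, smul_eq_mul,
    mul_cauchy (h.integrable_dens₁ P) (h.integrable_dens₁_div P hz),
    mul_cauchy (h.integrable_dens₂ P 0) (h.integrable_dens₂_div P 0 hz)]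

theorem row_sum (h : IsCauchyPair α β) {ι : Type*} (t : Finset ι) (k : ι → ℂ) (P : ι → ℂ[X])
    {z : ℂ} (hz : z ∈ dom α β) :
    row α β (∑ i ∈ t, k i • P i) 0 0 z = ∑ i ∈ t, k i • row α β (P i) 0 0 z := by
  let L : ℂ[X] →ₗ[ℂ] Fin 3 → ℂ :=
    { toFun := fun P => row α β P 0 0 z
      map_add' := fun P P' => by simpa only [add_zero] using h.row_add P P' 0 0 0 0 hz
      map_smul' := fun k P => by simpa only [mul_zero, RingHom.id_apply] using row_smul k P 0 0 z }
  calc L (∑ i ∈ t, k i • P i) = ∑ i ∈ t, k i • L (P i) := by simp only [map_sum, map_smul]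

end IsCauchyPair

end RowAlgebra

section Transforms

theorem trans₁_eq_cauchy {a : ℝ → ℝ} (ha : IsWeight a) (P : ℝ[X]) (z : ℂ) :
    trans₁ a P z = cauchy (dens₁ a (P.map (algebraMap ℝ ℂ))) z := by
  rw [trans₁, cauchy, setIntegral_eq_integral_of_forall_compl_eq_zero fun x hx => by
    rw [ha.eq_zero x (not_lt.1 hx), mul_zero, Complex.ofReal_zero, zero_div]]
  congr with s
  rw [dens₁, eval_map_algebraMap, Complex.ofReal_mul,
    show aeval (s : ℂ) P = (P.eval s : ℝ) from aeval_ofReal P s]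

theorem trans₂_eq_cauchy {a b : ℝ → ℝ} (ha : IsWeight a) (hb : IsWeight b) (P : ℝ[X]) (z : ℂ) :
    trans₂ a b P z = cauchy (dens₂ a b (P.map (algebraMap ℝ ℂ)) 0) z := by
  rw [trans₂, cauchy, setIntegral_eq_integral_of_forall_compl_eq_zero fun x hx => by
    rw [hb.eq_zero x (not_lt.1 hx), Complex.ofReal_zero, mul_zero, zero_div],
    ← integral_neg_eq_self]
  congr with s
  rw [dens₂, zero_add, trans₁_eq_cauchy ha, star, Complex.ofReal_neg, neg_neg, sub_eq_add_neg]

theorem trans_eq_row {a b : ℝ → ℝ} (ha : IsWeight a) (hb : IsWeight b) (P : ℝ[X]) (z : ℂ) :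
    trans a b P z = row a b (P.map (algebraMap ℝ ℂ)) 0 0 z := by
  rw [trans, row, zero_add, zero_add, trans₁_eq_cauchy ha, trans₂_eq_cauchy ha hb,
    eval_map_algebraMap]

theorem weylStar_eq_trans₂ (a b : ℝ → ℝ) (z : ℂ) : weylStar b a z = trans₂ a b 1 z := by
  rw [weylStar, trans₂, ← integral_neg]
  congr with y
  rw [trans₁, div_eq_mul_inv, mul_assoc, ← integral_mul_const, ← integral_neg]
  congr with x
  push_cast
  rw [eval_one, Complex.ofReal_one, ← neg_add', div_neg, mul_comm (z + (y : ℂ)), div_eq_mul_inv,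
    mul_inv]
  ring

theorem dens₁_one (a : ℝ → ℝ) : dens₁ a 1 = fun s => (a s : ℂ) := by
  funext s
  rw [dens₁, eval_one, one_mul]

theorem row_one {a b : ℝ → ℝ} (ha : IsWeight a) (hb : IsWeight b) (z : ℂ) :
    row a b 1 0 0 z = ![1, weyl a z, weylStar b a z] := by
  rw [row, weylStar_eq_trans₂, trans₂_eq_cauchy ha hb, Polynomial.map_one, eval_one, dens₁_one,
    zero_add, zero_add, weyl, cauchy]

theorem row_zero_one (a b : ℝ → ℝ) (z : ℂ) : row a b 0 1 0 z = ![0, 1, weyl (star b) z] := by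
  simp [row, weyl, cauchy, dens₂, dens₁_zero]

theorem row_zero_zero_one (a b : ℝ → ℝ) (z : ℂ) : row a b 0 0 1 z = ![0, 0, 1] := by
  simp [row, cauchy, dens₂, dens₁]

theorem matF_apply (hα : IsWeight α) (hβ : IsWeight β) (w z : ℂ) (μ : Fin 3) :
    matF α β w z μ = row β α 0 0 1 w μ • row α β 1 0 0 z + row β α 0 1 0 w μ • row α β 0 1 0 z
      + row β α 1 0 0 w μ • row α β 0 0 1 z := by
  rw [row_one hα hβ, row_one hβ hα, row_zero_one, row_zero_one, row_zero_zero_one,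
    row_zero_zero_one]
  funext ν
  fin_cases μ <;> fin_cases ν <;> simp [matF, add_comm, add_left_comm]

end Transforms

section RowAsymptotics

theorem isBigO_eval {n : ℕ} {P : ℂ[X]} (hP : P.degree < n) :
    (fun z => P.eval z) =O[offReal] growth (n - 1) := by
  have hpow : ∀ i < n, (fun z => P.coeff i * z ^ i) =O[offReal] growth (n - 1) := fun i hi => by
    have hone : (fun _ => (1 : ℂ)) =O[offReal] growth 0 := by
      refine Asymptotics.IsBigO.of_norm_le fun z => ?_
      rw [norm_one, growth, zpow_zero, one_mul]
      exact le_add_of_nonneg_right (by positivity)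
    refine (((isBigO_zpow_mul hone i).trans (isBigO_growth_growth (by omega))).const_mul_left
      (P.coeff i)).congr_left fun z => by rw [mul_one, zpow_natCast]
  refine (Asymptotics.IsBigO.fun_sum fun i hi => hpow i (Finset.mem_range.1 hi)).congr_left
    fun z => ?_
  rcases eq_or_ne P 0 with rfl | hne
  · simp
  · exact (eval_eq_sum_range' ((natDegree_lt_iff_degree_lt hne).2 hP) z).symm

theorem isBigO_eval_sub_coeff_mul {n : ℕ} {P : ℂ[X]} (hP : P.degree ≤ n) :
    (fun z => P.eval z - P.coeff n * z ^ (n : ℤ)) =O[offReal] growth (n - 1) := by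
  have hdeg : (P - monomial n (P.coeff n)).degree < n := by
    refine degree_lt_iff_coeff_zero _ _ |>.2 fun m hm => ?_
    rw [coeff_sub, coeff_monomial]
    split_ifs with h
    · rw [h, sub_self]
    · rw [sub_zero, coeff_eq_zero_of_degree_lt
        (hP.trans_lt (by exact_mod_cast lt_of_le_of_ne hm h))]
  exact (isBigO_eval hdeg).congr_left fun z => by
    rw [eval_sub, eval_monomial, zpow_natCast]

theorem isBigO_cauchy_sub_moment {h : ℝ → ℂ}
    (hi : ∀ k : ℕ, Integrable fun s : ℝ => (s : ℂ) ^ k * h s) {n : ℕ}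
    (hm : ∀ k < n, ∫ s : ℝ, (s : ℂ) ^ k * h s = 0) :
    (fun z => cauchy h z - (∫ s : ℝ, (s : ℂ) ^ n * h s) * z ^ (-(n + 1) : ℤ))
      =O[offReal] growth (-(n + 1) - 1) := by
  have hi' : ∀ k : ℕ, Integrable fun s : ℝ => (s : ℂ) ^ k * ((s : ℂ) ^ (n + 1) * h s) :=
    fun k => (hi (k + (n + 1))).congr (ae_of_all _ fun s => by ring)
  have hrem : cauchy (fun s : ℝ => (s : ℂ) ^ (n + 1) * h s) =O[offReal] growth (-1) :=
    isBigO_cauchy (hi (n + 1)) (by simpa only [pow_one] using hi' 1)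
  refine (isBigO_zpow_mul hrem (-(n + 1))).congr' ?_ (by rw [← sub_eq_add_neg])
  filter_upwards [eventually_offReal_im_ne_zero] with z hz
  have hz0 : z ≠ 0 := fun h0 => hz (by rw [h0, Complex.zero_im])
  have hexpand : z ^ (n + 1) * cauchy h z
      = (∫ s : ℝ, (s : ℂ) ^ n * h s) + cauchy (fun s : ℝ => (s : ℂ) ^ (n + 1) * h s) z := by
    rw [pow_succ', mul_assoc, pow_mul_cauchy hi hz hm, mul_cauchy (hi n)
      (integrable_div_sub (hi n) hz)]
    simp only [pow_succ', mul_assoc]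
  rw [zpow_neg, eq_sub_of_add_eq' hexpand.symm, ← Nat.cast_succ, zpow_natCast]
  field_simp

theorem HasJump.congr {g g' : ℂ → Fin 3 → ℂ} (hg : HasJump α β g)
    (h : EqOn g g' {z | z.im ≠ 0}) : HasJump α β g' := fun j =>
  (hg j).congr fun ε hε x => by
    rw [h (x := x + ε * I) (by simpa using hε.ne'), h (x := x - ε * I) (by simpa using hε.ne')]

theorem IsRow.congr {n : ℕ} {v : Fin 3 → ℂ} {g g' : ℂ → Fin 3 → ℂ} (hg : IsRow α β n v g)
    (h : EqOn g g' (dom α β)) : IsRow α β n v g' where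
  differentiableOn j := (hg.differentiableOn j).congr fun z hz => by rw [h hz]
  hasJump := hg.hasJump.congr (h.mono (im_ne_zero_subset_dom α β))
  asymptotic j := (hg.asymptotic j).congr' (by
    filter_upwards [eventually_offReal_im_ne_zero] with z hz
    rw [h (im_ne_zero_subset_dom α β hz)]) EventuallyEq.rfl

/-- The moments of `dens₂` that have to vanish are those forced by the factor `z ^ (-n)` in the
third column. -/
theorem IsCauchyPair.exists_isRow (h : IsCauchyPair α β) {n : ℕ} {P : ℂ[X]} (hP : P.degree ≤ n)
    {c d : ℂ} (hd : n ≠ 0 → d = 0)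
    (hm : ∀ k, k + 1 < n → ∫ s : ℝ, (s : ℂ) ^ k * dens₂ α β P c s = 0) :
    ∃ v, IsRow α β n v (row α β P c d) := by
  obtain ⟨v₂, hv₂⟩ : ∃ v₂, (fun z => d + cauchy (dens₂ α β P c) z - v₂ * z ^ (-n : ℤ))
      =O[offReal] growth (-n - 1) := by
    rcases n with _ | n
    · exact ⟨d, (h.isBigO_cauchy_dens₂ P c).congr_left fun z => by simp⟩
    · refine ⟨∫ s : ℝ, (s : ℂ) ^ n * dens₂ α β P c s, ?_⟩
      simpa only [hd n.succ_ne_zero, zero_add, Nat.cast_succ] using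
        isBigO_cauchy_sub_moment (h.integrable_pow_mul_dens₂ P c) fun k hk => hm k (by omega)
  refine ⟨![P.coeff n, c, v₂], h.differentiableOn_row P c d, h.hasJump_row P c d, fun j => ?_⟩
  fin_cases j
  · exact isBigO_eval_sub_coeff_mul hP
  · exact (h.isBigO_cauchy_dens₁ P).congr_left fun z => by simp [row, exponent]
  · exact hv₂

end RowAsymptotics

section Reproducing

theorem IsCauchyBOP.span_image_q {p q : ℕ → ℝ[X]} (hpq : IsCauchyBOP α β p q) (n : ℕ) :
    Submodule.span ℝ (q '' Iio n) = degreeLT ℝ n := by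
  have hne : ∀ j, (q j).leadingCoeff ≠ 0 := fun j =>
    hpq.leadingCoeff_eq j ▸ (hpq.leadingCoeff_pos j).ne'
  let S : Polynomial.Sequence ℝ :=
    ⟨q, fun j => by rw [degree_eq_natDegree (leadingCoeff_ne_zero.1 (hne j)), hpq.natDegree_q]⟩
  exact S.span_degreeLT fun j _ => (hne j).isUnit

namespace IsCauchyPair

theorem pairing_eq_ite (h : IsCauchyPair α β) {p q : ℕ → ℝ[X]} (hpq : IsCauchyBOP α β p q)
    (j k : ℕ) : pairing α β (p j) (q k) = if j = k then 1 else 0 := by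
  rw [← h.setIntegral_setIntegral_eq_pairing, hpq.biorthogonal]

theorem sum_pairing_smul (h : IsCauchyPair α β) {p q : ℕ → ℝ[X]} (hpq : IsCauchyBOP α β p q)
    {n : ℕ} {r : ℝ[X]} (hr : r.degree < n) :
    ∑ j ∈ Finset.range n, pairing α β (p j) r • q j = r := by
  let L : ℝ[X] →ₗ[ℝ] ℝ[X] := ∑ j ∈ Finset.range n, (h.bilinPairing (p j)).smulRight (q j)
  have hL : ∀ r, L r = ∑ j ∈ Finset.range n, pairing α β (p j) r • q j := fun r => by
    simp only [L, LinearMap.sum_apply, LinearMap.smulRight_apply]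
    rfl
  have hbasis : EqOn L (LinearMap.id (R := ℝ)) (q '' Iio n) := by
    rintro _ ⟨k, hk, rfl⟩
    simp only [hL, h.pairing_eq_ite hpq, ite_smul, one_smul, zero_smul, Finset.sum_ite_eq',
      Finset.mem_range, mem_Iio.1 hk, if_true, LinearMap.id_apply]
  rw [← hL]
  exact LinearMap.eqOn_span hbasis (hpq.span_image_q n ▸ mem_degreeLT.2 hr)

theorem trans_sum_smul (h : IsCauchyPair α β) {ι : Type*} (t : Finset ι) (k : ι → ℝ)
    (P : ι → ℝ[X]) {z : ℂ} (hz : z ∈ dom α β) :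
    trans α β (∑ i ∈ t, k i • P i) z = ∑ i ∈ t, (k i : ℂ) • trans α β (P i) z := by
  simp only [trans_eq_row h.left h.right, Polynomial.map_sum, Polynomial.map_smul,
    Complex.coe_algebraMap, h.row_sum t _ _ hz]

theorem pairPow_sum (h : IsCauchyPair α β) {ι : Type*} (t : Finset ι) (a : ι → ℂ) (P : ι → ℂ[X])
    (k : ℕ) : pairPow α β (∑ i ∈ t, a i • P i) k = ∑ i ∈ t, a i * pairPow α β (P i) k := by
  let L : ℂ[X] →ₗ[ℂ] ℂ :=
    { toFun := fun P => pairPow α β P k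
      map_add' := fun P P' => h.pairPow_add P P' k
      map_smul' := fun c P => pairPow_smul c P k }
  calc L (∑ i ∈ t, a i • P i) = ∑ i ∈ t, a i * L (P i) := by
        simp only [map_sum, map_smul, smul_eq_mul]

end IsCauchyPair

end Reproducing

section WeylFunctions

theorem weyl_star (a : ℝ → ℝ) (z : ℂ) : weyl (star a) z = -weyl a (-z) :=
  cauchy_comp_neg (fun s => (a s : ℂ)) z

theorem dens₂_one_zero (a b : ℝ → ℝ) (s : ℝ) : dens₂ a b 1 0 s = weyl a s * star b s := by
  rw [dens₂, zero_add, dens₁_one]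
  rfl

theorem weylStar_eq_cauchy {a b : ℝ → ℝ} (ha : IsWeight a) (hb : IsWeight b) (z : ℂ) :
    weylStar b a z = cauchy (fun s => star b s * weyl a s) z := by
  rw [weylStar_eq_trans₂, trans₂_eq_cauchy ha hb, Polynomial.map_one]
  simp_rw [mul_comm, ← dens₂_one_zero]

theorem weylStar_neg_eq_cauchy {a b : ℝ → ℝ} (ha : IsWeight a) (hb : IsWeight b) (z : ℂ) :
    weylStar a b (-z) = cauchy (fun s => a s * weyl (star b) s) z := by
  have hreflect := cauchy_comp_neg (fun s => star a s * weyl b s) z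
  rw [weylStar_eq_cauchy hb ha, ← neg_eq_iff_eq_neg.2 hreflect, cauchy, cauchy, ← integral_neg]
  congr with s
  rw [star, neg_neg, weyl_star, Complex.ofReal_neg, mul_neg, neg_div]

namespace IsCauchyPair

theorem integrable_mul_star_div (h : IsCauchyPair α β) :
    Integrable fun p : ℝ × ℝ => (α p.1 : ℂ) * star β p.2 / (p.1 - p.2) := by
  have hmp : MeasurePreserving (fun p : ℝ × ℝ => (p.1, -p.2)) :=
    (MeasurePreserving.id volume).prod (Measure.measurePreserving_neg volume)
  have hi := (h.integrable_bimoment 0 0).ofReal (𝕜 := ℂ)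
  refine ((hmp.integrable_comp hi.1).2 hi).congr (ae_of_all _ fun p => ?_)
  simp only [Function.comp, star, Complex.coe_algebraMap]
  push_cast
  ring

theorem weyl_mul_weyl_star (h : IsCauchyPair α β) {z : ℂ} (hz : z ∈ dom α β) :
    weyl α z * weyl (star β) z = weylStar α β (-z) + weylStar β α z := by
  rw [weylStar_neg_eq_cauchy h.left h.right, weylStar_eq_cauchy h.left h.right]
  obtain ⟨δ, hδ, hα⟩ := exists_ball_forall_le_norm_sub (isClosed_supp α) (notMem_image_supp_left hz)
  obtain ⟨δ', hδ', hβ⟩ :=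
    exists_ball_forall_le_norm_sub (isClosed_supp (star β)) (notMem_image_supp_right hz)
  refine cauchy_mul_cauchy (fun s => ?_)
    (integrable_div_of_le h.integrable_mul_star_div (by fun_prop) hδ ?_)
    (integrable_div_of_le h.integrable_mul_star_div (by fun_prop) hδ' ?_)
  · rcases le_total s 0 with hs | hs
    · rw [h.left.eq_zero s hs, Complex.ofReal_zero, zero_mul]
    · rw [h.right.star_eq_zero hs, Complex.ofReal_zero, mul_zero]
  · filter_upwards [Measure.quasiMeasurePreserving_fst.ae
      (ae_eq_zero_of_notMem_supp h.left.measurable h.left.nonneg)] with p hp hne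
    refine hα z (Metric.mem_ball_self hδ) _ (by_contra fun hs => hne ?_)
    rw [hp hs, Complex.ofReal_zero, zero_mul, zero_div]
  · filter_upwards [Measure.quasiMeasurePreserving_snd.ae (ae_eq_zero_of_notMem_supp
      (h.right.measurable.comp measurable_neg) fun x => h.right.nonneg (-x))] with p hp hne
    refine hβ z (Metric.mem_ball_self hδ') _ (by_contra fun hs => hne ?_)
    rw [show star β p.2 = 0 from hp hs, Complex.ofReal_zero, mul_zero, zero_div]

theorem matF_neg (h : IsCauchyPair α β) {w : ℂ} (hw : -w ∈ dom α β) :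
    matF α β w (-w) = matJ := by
  have hcorner : weyl (star α) w * weyl (star β) (-w) + weylStar α β w + weylStar β α (-w) = 0 := by
    have := h.weyl_mul_weyl_star hw
    rw [neg_neg] at this
    rw [weyl_star α, neg_mul, this]
    ring
  rw [matF, matJ, hcorner, weyl_star α, weyl_star β, neg_neg, neg_add_cancel, add_neg_cancel]

end IsCauchyPair

end WeylFunctions

section Recurrence

theorem pairPow_symm (k : ℕ) : pairPow β α (X ^ k) 0 = pairPow α β 1 k := by
  rw [pairPow, pairPow, Measure.volume_eq_prod, ← integral_prod_swap]
  congr with s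
  rw [Prod.fst_swap, Prod.snd_swap, add_comm (s.2 : ℂ), eval_pow, eval_X, eval_one]
  ring

theorem integral_dens₁_X_pow (a : ℝ → ℝ) (k : ℕ) :
    ∫ s, dens₁ a (X ^ k) s = ∫ y : ℝ, (y : ℂ) ^ k * a y := by
  simp only [dens₁, eval_pow, eval_X]

namespace IsCauchyPair

theorem integral_dens₂_zero (h : IsCauchyPair α β) (P : ℂ[X]) :
    ∫ s, dens₂ α β P 0 s = -pairPow α β P 0 := by
  simpa using h.integral_pow_mul_dens₂ P 0 0

theorem row_eq_add (h : IsCauchyPair α β) (P : ℂ[X]) (c d : ℂ) {z : ℂ} (hz : z ∈ dom α β) :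
    row α β P c d z = row α β P 0 0 z + c • row α β 0 1 0 z + d • row α β 0 0 1 z := by
  rw [← row_smul, ← row_smul, ← h.row_add _ _ _ _ _ _ hz, ← h.row_add _ _ _ _ _ _ hz]
  simp only [smul_zero, add_zero, zero_add, mul_one, mul_zero]

theorem pairPow_X_mul (h : IsCauchyPair α β) (P : ℂ[X]) (k : ℕ) :
    pairPow α β (X * P) k
      = (∫ s, dens₁ α P s) * (∫ y : ℝ, (y : ℂ) ^ k * β y) - pairPow α β P (k + 1) := by
  have hXP := h.integral_pow_mul_dens₂ (X * P) (∫ s, dens₁ α P s) k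
  have hP := h.integral_pow_mul_dens₂ P 0 (k + 1)
  simp only [h.dens₂_X_mul, ← mul_assoc, ← pow_succ] at hXP
  rw [hXP] at hP
  have hsign : (-1 : ℂ) ^ k ≠ 0 := pow_ne_zero k (by norm_num)
  refine mul_left_cancel₀ hsign ?_
  linear_combination -hP

theorem row_X_pow_succ (h : IsCauchyPair α β) (k : ℕ) {w : ℂ} (hw : w ∈ dom β α) :
    row β α (X ^ (k + 1)) 0 0 w
      = w • row β α (X ^ k) 0 0 w - (∫ y : ℝ, (y : ℂ) ^ k * β y) • row β α 0 1 0 w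
        + pairPow α β 1 k • row β α 0 0 1 w := by
  rw [← h.symm.row_X_mul _ hw, integral_dens₁_X_pow, h.symm.integral_dens₂_zero, pairPow_symm,
    h.symm.row_eq_add (X * X ^ k) (∫ y : ℝ, (y : ℂ) ^ k * β y) _ hw, pow_succ', neg_smul]
  abel

end IsCauchyPair

end Recurrence

section Kernel

/-- The Christoffel–Darboux sum `∑_{j < n} q_j^{(μ)}(w) p_j` as a polynomial in the variable of
the `p_j`. -/
noncomputable def kernelPoly (α β : ℝ → ℝ) (p q : ℕ → ℝ[X]) (n : ℕ) (w : ℂ) (μ : Fin 3) : ℂ[X] :=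
  ∑ j ∈ Finset.range n, trans β α (q j) w μ • (p j).map (algebraMap ℝ ℂ)

/-- The kernel `ℍ_n(z, w)` multiplied by `z + w`, which is regular at `z = -w`. -/
noncomputable def kernelMatrix (α β : ℝ → ℝ) (p q : ℕ → ℝ[X]) (n : ℕ) (z w : ℂ) :
    Matrix (Fin 3) (Fin 3) ℂ :=
  Matrix.of fun μ ν =>
    (z + w) * (∑ j ∈ Finset.range n, trans β α (q j) w μ * trans α β (p j) z ν)
      + matF α β w z μ ν

theorem matH_eq_smul_kernelMatrix (p q : ℕ → ℝ[X]) (n : ℕ) {z w : ℂ} (hzw : z + w ≠ 0) :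
    matH α β p q n z w = (z + w)⁻¹ • kernelMatrix α β p q n z w := by
  ext μ ν
  simp only [matH, kernelMatrix, Matrix.smul_apply, Matrix.of_apply, smul_eq_mul]
  field_simp

theorem degree_kernelPoly_lt {p q : ℕ → ℝ[X]} (hpq : IsCauchyBOP α β p q) (n : ℕ) (w : ℂ)
    (μ : Fin 3) : (kernelPoly α β p q n w μ).degree < n := by
  refine (degree_sum_le _ _).trans_lt ((Finset.sup_lt_iff (WithBot.bot_lt_coe n)).2 fun j hj => ?_)
  calc _ ≤ ((p j).map (algebraMap ℝ ℂ)).degree := degree_smul_le _ _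
    _ ≤ (p j).degree := degree_map_le
    _ ≤ (p j).natDegree := degree_le_natDegree
    _ < n := by rw [hpq.natDegree_p]; exact_mod_cast Finset.mem_range.1 hj

namespace IsCauchyPair

theorem kernelMatrix_neg (h : IsCauchyPair α β) (p q : ℕ → ℝ[X]) (n : ℕ) {w : ℂ}
    (hw : -w ∈ dom α β) : kernelMatrix α β p q n (-w) w = matJ := by
  ext μ ν
  rw [kernelMatrix, Matrix.of_apply, neg_add_cancel, zero_mul, zero_add, h.matF_neg hw]

theorem row_kernelPoly (h : IsCauchyPair α β) (p q : ℕ → ℝ[X]) (n : ℕ) (w : ℂ) (μ : Fin 3)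
    {z : ℂ} (hz : z ∈ dom α β) :
    row α β (kernelPoly α β p q n w μ) 0 0 z
      = ∑ j ∈ Finset.range n, trans β α (q j) w μ • trans α β (p j) z := by
  simp only [kernelPoly, h.row_sum _ _ _ hz, trans_eq_row h.left h.right]

theorem pairPow_kernelPoly (h : IsCauchyPair α β) {p q : ℕ → ℝ[X]} (hpq : IsCauchyBOP α β p q)
    {n k : ℕ} (hk : k < n) {w : ℂ} (hw : w ∈ dom β α) (μ : Fin 3) :
    pairPow α β (kernelPoly α β p q n w μ) k = row β α (X ^ k) 0 0 w μ := by
  have hdeg : (X ^ k : ℝ[X]).degree < n := by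
    rw [degree_X_pow]
    exact_mod_cast hk
  calc pairPow α β (kernelPoly α β p q n w μ) k
      = ∑ j ∈ Finset.range n, trans β α (q j) w μ * pairing α β (p j) (X ^ k) := by
        simp only [kernelPoly, h.pairPow_sum, pairPow_map_algebraMap]
    _ = trans β α (∑ j ∈ Finset.range n, pairing α β (p j) (X ^ k) • q j) w μ := by
        simp only [h.symm.trans_sum_smul _ _ _ hw, Finset.sum_apply, Pi.smul_apply, smul_eq_mul,
          mul_comm]
    _ = row β α (X ^ k) 0 0 w μ := by
        rw [h.sum_pairing_smul hpq hdeg, trans_eq_row h.right h.left, Polynomial.map_pow, map_X]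

theorem kernelMatrix_apply_eq_row (h : IsCauchyPair α β) (p q : ℕ → ℝ[X]) (n : ℕ) (w : ℂ)
    (μ : Fin 3) {z : ℂ} (hz : z ∈ dom α β) :
    kernelMatrix α β p q n z w μ
      = row α β (X * kernelPoly α β p q n w μ
            + (w • kernelPoly α β p q n w μ + row β α 0 0 1 w μ • 1))
          ((∫ s, dens₁ α (kernelPoly α β p q n w μ) s) + row β α 0 1 0 w μ)
          ((∫ s, dens₂ α β (kernelPoly α β p q n w μ) 0 s) + row β α 1 0 0 w μ) z := by
  have hkernel : kernelMatrix α β p q n z w μ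
      = (z + w) • row α β (kernelPoly α β p q n w μ) 0 0 z + matF α β w z μ := by
    funext ν
    simp only [kernelMatrix, Matrix.of_apply, h.row_kernelPoly p q n w μ hz, Pi.add_apply,
      Pi.smul_apply, Finset.sum_apply, smul_eq_mul]
  generalize kernelPoly α β p q n w μ = Q at *
  have hR : row α β (w • Q + row β α 0 0 1 w μ • 1) 0 0 z
      = w • row α β Q 0 0 z + row β α 0 0 1 w μ • row α β 1 0 0 z := by
    rw [← row_smul, ← row_smul, ← h.row_add _ _ _ _ _ _ hz]
    simp only [mul_zero, add_zero]
  rw [hkernel, matF_apply h.left h.right, h.row_add _ _ _ _ _ _ hz, h.row_X_mul Q hz,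
    h.row_eq_add (w • Q + _) _ _ hz, hR, add_smul]
  abel

theorem exists_isRow_kernelMatrix (h : IsCauchyPair α β) {p q : ℕ → ℝ[X]}
    (hpq : IsCauchyBOP α β p q) (n : ℕ) {w : ℂ} (hw : -w ∈ dom α β) :
    ∃ V : Matrix (Fin 3) (Fin 3) ℂ,
      ∀ μ, IsRow α β n (V μ) fun z => kernelMatrix α β p q n z w μ := by
  suffices hrow : ∀ μ, ∃ v, IsRow α β n v fun z => kernelMatrix α β p q n z w μ by
    choose V hV using hrow
    exact ⟨Matrix.of V, hV⟩
  intro μ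
  have hw' := mem_dom_of_neg_mem_dom hw
  have hQ := degree_kernelPoly_lt hpq n w μ
  have hpair := fun {k : ℕ} (hk : k < n) => h.pairPow_kernelPoly hpq hk hw' μ
  have hrow := fun {z : ℂ} (hz : z ∈ dom α β) => h.kernelMatrix_apply_eq_row p q n w μ hz
  generalize kernelPoly α β p q n w μ = Q at *
  have hdeg : (X * Q + (w • Q + row β α 0 0 1 w μ • 1)).degree ≤ (n : WithBot ℕ) := by
    have hXQ : (X * Q).degree ≤ (n : WithBot ℕ) := by
      rw [mul_comm, degree_mul_X]
      exact Nat.WithBot.add_one_le_of_lt hQ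
    have hone : (1 : ℂ[X]).degree ≤ (n : WithBot ℕ) :=
      degree_one_le.trans (by exact_mod_cast n.zero_le)
    exact degree_add_le_of_degree_le hXQ (degree_add_le_of_degree_le
      ((degree_smul_le _ _).trans hQ.le) ((degree_smul_le _ _).trans hone))
  have hconst : n ≠ 0 → (∫ s, dens₂ α β Q 0 s) + row β α 1 0 0 w μ = 0 := fun hn => by
    rw [h.integral_dens₂_zero, hpair (Nat.pos_of_ne_zero hn), pow_zero, neg_add_cancel]
  obtain ⟨v, hv⟩ := h.exists_isRow hdeg hconst
    (c := (∫ s, dens₁ α Q s) + row β α 0 1 0 w μ) fun k hk => by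
      have hrec := congrFun (h.row_X_pow_succ k hw') μ
      simp only [Pi.add_apply, Pi.sub_apply, Pi.smul_apply, smul_eq_mul] at hrec
      rw [h.integral_pow_mul_dens₂, h.pairPow_add, h.pairPow_add, pairPow_smul, pairPow_smul,
        h.pairPow_X_mul, hpair (Nat.lt_of_succ_lt hk), hpair hk, hrec]
      ring
  exact ⟨v, hv.congr fun z hz => (hrow hz).symm⟩

end IsCauchyPair

end Kernel

section Factorization

theorem matJ_mul_matJ : matJ * matJ = 1 := by
  ext i j
  fin_cases i <;> fin_cases j <;> simp [matJ, Matrix.mul_apply, Fin.sum_univ_three]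

theorem IsRow.mul {n : ℕ} {V : Matrix (Fin 3) (Fin 3) ℂ} {K : ℂ → Matrix (Fin 3) (Fin 3) ℂ}
    (hK : ∀ i, IsRow α β n (V i) fun z => K z i) (U : Matrix (Fin 3) (Fin 3) ℂ) (i : Fin 3) :
    IsRow α β n ((U * V) i) fun z => (U * K z) i := by
  have hsum := (((hK 0).const_smul (U i 0)).add ((hK 1).const_smul (U i 1))).add
    ((hK 2).const_smul (U i 2))
  convert hsum using 1
  · funext j
    simp [Matrix.mul_apply, Fin.sum_univ_three]
  · funext z j
    simp [Matrix.mul_apply, Fin.sum_univ_three]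

theorem IsRHPSolution.eqOn_mul (h : IsCauchyPair α β) {n : ℕ} {V : Matrix (Fin 3) (Fin 3) ℂ}
    {G K : ℂ → Matrix (Fin 3) (Fin 3) ℂ} (hG : IsRHPSolution α β n G)
    (hK : ∀ i, IsRow α β n (V i) fun z => K z i) : EqOn K (fun z => V * G z) (dom α β) := by
  have hVG := IsRow.mul (fun i => hG.isRow h i) V
  rw [mul_one] at hVG
  exact fun z hz => funext fun i => (hK i).eqOn h (hVG i) hz

namespace IsCauchyPair

/-- At `z = -w` the constant factor between the kernel and a solution is seen to be
`𝕁 Γ(-w)⁻¹`. -/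
theorem kernelMatrix_eq (h : IsCauchyPair α β) {p q : ℕ → ℝ[X]}
    (hpq : IsCauchyBOP α β p q) {n : ℕ} {G : ℂ → Matrix (Fin 3) (Fin 3) ℂ}
    (hG : IsRHPSolution α β n G) {w : ℂ} (hw : -w ∈ dom α β) {z : ℂ} (hz : z ∈ dom α β) :
    IsUnit (G (-w)).det ∧ kernelMatrix α β p q n z w = matJ * (G (-w))⁻¹ * G z := by
  obtain ⟨V, hV⟩ := h.exists_isRow_kernelMatrix hpq n hw
  have hVG : EqOn (fun z => kernelMatrix α β p q n z w) (fun z => V * G z) (dom α β) :=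
    hG.eqOn_mul h hV
  have hat : kernelMatrix α β p q n (-w) w = V * G (-w) := hVG hw
  have hinv : matJ * V * G (-w) = 1 := by
    rw [mul_assoc, ← hat, h.kernelMatrix_neg p q n hw, matJ_mul_matJ]
  refine ⟨Matrix.isUnit_det_of_left_inverse hinv, ?_⟩
  rw [Matrix.inv_eq_left_inv hinv, ← mul_assoc, matJ_mul_matJ, one_mul]
  exact hVG hz

theorem det_ne_zero_of_isRow_kernelMatrix (h : IsCauchyPair α β) {p q : ℕ → ℝ[X]} {n : ℕ} {w : ℂ}
    (hw : -w ∈ dom α β) {V : Matrix (Fin 3) (Fin 3) ℂ}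
    (hV : ∀ μ, IsRow α β n (V μ) fun z => kernelMatrix α β p q n z w μ) : V.det ≠ 0 := by
  intro hdet
  obtain ⟨u, hu, huV⟩ := Matrix.exists_vecMul_eq_zero_iff.2 hdet
  have hrow := IsRow.mul hV (Matrix.of fun _ => u) 0
  have hzero : (Matrix.of (fun _ : Fin 3 => u) * V) 0 = 0 := huV
  have huJ : Matrix.vecMul u matJ = 0 := by
    rw [← h.kernelMatrix_neg p q n hw]
    exact (hzero ▸ hrow).eqOn_zero h hw
  apply hu
  rw [← Matrix.vecMul_one u, ← matJ_mul_matJ, ← Matrix.vecMul_vecMul, huJ, Matrix.zero_vecMul]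

theorem exists_isRHPSolution (h : IsCauchyPair α β) (n : ℕ) : ∃ G, IsRHPSolution α β n G := by
  obtain ⟨p, q, hpq⟩ := h.exists_isCauchyBOP
  have hw : -I ∈ dom α β := im_ne_zero_subset_dom α β (by simp)
  obtain ⟨V, hV⟩ := h.exists_isRow_kernelMatrix hpq n hw
  have hdet : IsUnit V.det := (h.det_ne_zero_of_isRow_kernelMatrix hw hV).isUnit
  refine ⟨fun z => V⁻¹ * kernelMatrix α β p q n z I, isRHPSolution_of_isRow fun i => ?_⟩
  simpa only [Matrix.nonsing_inv_mul V hdet] using IsRow.mul hV V⁻¹ i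

end IsCauchyPair

end Factorization

end CauchyBOP

theorem mainTheorem4 (α β : ℝ → ℝ) (hα : CauchyBOP.IsWeight α) (hβ : CauchyBOP.IsWeight β)
    (hαβ : CauchyBOP.FiniteBimoments α β) :
    (∃ p q : ℕ → ℝ[X], CauchyBOP.IsCauchyBOP α β p q) ∧
    (∀ n : ℕ, ∃ G : ℂ → Matrix (Fin 3) (Fin 3) ℂ, CauchyBOP.IsRHPSolution α β n G ∧
      ∀ G' : ℂ → Matrix (Fin 3) (Fin 3) ℂ, CauchyBOP.IsRHPSolution α β n G' →
        EqOn G' G (CauchyBOP.dom α β)) ∧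
    ∀ p q : ℕ → ℝ[X], CauchyBOP.IsCauchyBOP α β p q →
      ∀ (n : ℕ) (G : ℂ → Matrix (Fin 3) (Fin 3) ℂ), CauchyBOP.IsRHPSolution α β n G →
        ∀ z w : ℂ, z ∈ CauchyBOP.dom α β → -w ∈ CauchyBOP.dom α β → z + w ≠ 0 →
          IsUnit (G (-w)).det ∧
          CauchyBOP.matH α β p q n z w =
            (z + w)⁻¹ • (CauchyBOP.matJ * (G (-w))⁻¹ * G z) := by
  have h : CauchyBOP.IsCauchyPair α β := ⟨hα, hβ, hαβ⟩
  refine ⟨h.exists_isCauchyBOP, fun n => ?_, fun p q hpq n G hG z w hz hw hzw => ?_⟩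
  · obtain ⟨G, hG⟩ := h.exists_isRHPSolution n
    exact ⟨G, hG, fun G' hG' => hG'.eqOn h hG⟩
  · obtain ⟨hdet, hkernel⟩ := h.kernelMatrix_eq hpq hG hw hz
    exact ⟨hdet, by rw [CauchyBOP.matH_eq_smul_kernelMatrix p q n hzw, hkernel]⟩
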